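/- Notation. $\Lambda$ is the ring of symmetric functions with complex coefficients in $x_1,x_2,\dots$ (formal infinite sums of symmetric functions of increasing degrees are allowed), with complete homogeneous, elementary and power sum functions $h_n,e_n,p_n$, $p_\lambda=\prod_i p_{\lambda_i}$, and $\omega$ the involution with $\omega(p_k)=(-1)^{k-1}p_k$ (so $\omega(h_n)=e_n$). $f[g]$ denotes plethysm: if $f=P(p_1,p_2,\dots)$ and $g$ has no constant term, then $f[g]=P(p_1[g],p_2[g],\dots)$ with $p_k[g]=g(x_1^k,x_2^k,\dots)$. The Frobenius characteristic of a representation $V$ of $S_n$ is $\mathrm{ch}\,V=\frac1{n!}\sum_{\sigma\in S_n}\chi_V(\sigma)\,p_{\mathrm{type}(\sigma)}$. Put $H=\sum_{r\ge0}h_r$, $E=\sum_{r\ge0}e_r$, $H^{\pm}=\sum_{r\ge0}(-1)^rh_r$. For a sequence $Q=(q_n)_{n\ge1}$ of symmetric functions, $q_n$ homogeneous of degree $n$, write also $Q=\sum_{n\ge1}q_n$, and for a partition $\lambda$ with $m_i$ parts equal to $i$ and length $\ell(\lambda)$ put $$H_\lambda[Q]=\prod_{i:m_i\ge1}h_{m_i}[q_i],\qquad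 E_\lambda[Q]=\prod_{i:m_i\ge1}e_{m_i}[q_i],$$ $$H[Q](t)=\sum_\lambda t^{|\lambda|}H_\lambda[Q],\qquad E[Q](t)=\sum_\lambda t^{|\lambda|}E_\lambda[Q],\qquad H^\pm[Q](t)=\sum_\lambda t^{|\lambda|}(-1)^{\ell(\lambda)}H_\lambda[Q],$$ the sums being over all partitions, including the empty one. Let $Q^{\omega}$ be the sequence $((-1)^{n-1}\omega(q_n))_{n\ge1}$. Let $C_n\subset S_n$ be generated by an $n$-cycle. Let $Lie_n$ be the Frobenius characteristic of the representation of $S_n$ induced from the character of $C_n$ that sends the generator to $\exp(2\pi i/n)$, and $Lie_n^{(2)}$ that of the representation induced from the character that sends the generator to $\exp(2\pi i\cdot 2^{k_n}/n)$, where $2^{k_n}$ is the largest power of $2$ that divides $n$. Let $Lie=\sum_{n\ge1}Lie_n$ and $Lie^{(2)}=\sum_{n\ge1}Lie^{(2)}_n$. **Theorem.** (A) The following identities hold for $Lie$. 1. $\sum_{\lambda\vdash n}H_\lambda[Lie]=p_1^n$ for all $n\ge0$. 2. $H\big[\sum_{n\ge1}(-1)^{n-1}\omega(Lie_n)\big]=1+p_1$.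 3. $\sum_{\lambda\vdash n}(-1)^{n-\ell(\lambda)}E_\lambda[Lie]=0$ for all $n\ge2$. 4. $\sum_{\lambda\vdash n}E_\lambda[Lie]=2e_2p_1^{n-2}$ for all $n\ge2$. (B) The following identities hold for $Lie^{(2)}$. 1. For all $n\ge0$, $\sum_{\lambda\vdash n}E_\lambda[Lie^{(2)}]=p_1^n$. Here $p_1^n$ is the Frobenius characteristic of the regular representation of $S_n$, so the sum is a decomposition of the regular representation. In other forms: $E[Lie^{(2)}]=(1-p_1)^{-1}$; $E[Lie^{(2)}](t)=(1-tp_1)^{-1}$; $H^{\pm}[Lie^{(2)}]=1-p_1$; $H^{\pm}[Lie^{(2)}](t)=1-tp_1$. 2. $E\big[\sum_{n\ge1}(-1)^{n-1}\omega(Lie^{(2)}_n)\big]=1+p_1$; $E[(Lie^{(2)})^{\omega}](t)=1+tp_1$; that is, $\sum_{n\ge1}e_n$ and $\sum_{n\ge1}(-1)^{n-1}\omega(Lie^{(2)}_n)$ are (two-sided) plethystic inverses of each other. 3. $\sum_{\lambda\vdash n}(-1)^{n-\ell(\lambda)}H_\lambda[Lie^{(2)}]=0$ for all $n\ge2$.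 4. For all $n\ge0$, $\sum_{\lambda\vdash n}H_\lambda[Lie^{(2)}]=\sum p_\lambda$, the sum on the right being over the partitions $\lambda$ of $n$ all of whose parts are powers of $2$ (including $1=2^0$); and $H[Lie^{(2)}](t)=\prod_{k\ge0}(1-t^{2^k}p_{2^k})^{-1}$. 5. For all $n\ge0$, $\sum_{\lambda\vdash n}(-1)^{n-\ell(\lambda)}\omega(E_\lambda[Lie^{(2)}])=\sum_{\lambda\vdash n}H_\lambda[(Lie^{(2)})^{\omega}]=\sum p_\lambda$, the last sum being over the partitions $\lambda$ of $n$ into distinct parts that are powers of $2$; and $H[(Lie^{(2)})^{\omega}](t)=\prod_{k\ge0}(1+t^{2^k}p_{2^k})$. (C) The identities in (A) are equivalent to each other, and so are the identities in (B), in the following sense. Let $F=(f_n)_{n\ge1}$ be any sequence of symmetric functions, $f_n$ homogeneous of degree $n$, with $f_1=p_1$. Then the four statements of (A) with $F$ in place of $Lie$ are equivalent to each other, and all the statements of (B), in each of the forms listed (in (B5), that the first sum equals the third, that the second sum equals the third, and the product formula), with $F$ in place of $Lie^{(2)}$, are equivalent to each other. -/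

import Mathlib

open scoped BigOperators MvPowerSeries.WithPiTopology PowerSeries.WithPiTopology

namespace PlethLie

noncomputable section

/-! ### Symmetric functions -/

/-- Formal power series of arbitrary degree in countably many variables `x₀, x₁, x₂, …` over `ℂ`.
Formal series of symmetric functions are the symmetric elements of this ring. -/
abbrev Ser : Type := MvPowerSeries ℕ ℂ

/-- `f` is invariant under every permutation of the variables. -/
def IsSymmSeries (f : Ser) : Prop :=
  ∀ (σ : Equiv.Perm ℕ) (d : ℕ →₀ ℕ),
    MvPowerSeries.coeff (d.mapDomain σ) f = MvPowerSeries.coeff d f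

/-- The power sum `p_k = ∑ᵢ xᵢ^k`, for `k ≥ 1`. -/
def psum (k : ℕ) : Ser := fun d => open Classical in
  if ∃ i, d = Finsupp.single i k then 1 else 0

/-- The complete homogeneous symmetric function `h_n`, the sum of all monomials of degree `n`. -/
def hsymm (n : ℕ) : Ser := fun d => if d.degree = n then 1 else 0

/-- The elementary symmetric function `e_n`, the sum of all squarefree monomials of degree `n`. -/
def esymm (n : ℕ) : Ser := fun d => open Classical in
  if d.degree = n ∧ ∀ i, d i ≤ 1 then 1 else 0

/-- `p_μ = ∏ᵢ p_{μᵢ}` for a partition `μ`. -/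
def psumPart {n : ℕ} (μ : n.Partition) : Ser := (μ.parts.map psum).prod

/-- `∑_{n ≥ 0} q n` for a sequence of series such that `q n` is homogeneous of degree `n`. -/
def sumAll (q : ℕ → Ser) : Ser := fun d => MvPowerSeries.coeff d (q d.degree)

/-- `∑_{n ≥ 1} q n` for a sequence of series such that `q n` is homogeneous of degree `n` for
`n ≥ 1`; the value `q 0` is ignored. -/
def sumPos (q : ℕ → Ser) : Ser := sumAll fun n => if n = 0 then 0 else q n

/-! ### Plethysm -/

/-- The value at `P` of the substitution of the power sums for the indeterminates: the series
`P(p₁, p₂, p₃, …)`. -/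
def evalPsum (P : MvPowerSeries ℕ+ ℂ) : Ser :=
  MvPowerSeries.subst (fun k : ℕ+ => psum k) P

/-! Existence and uniqueness of the expression in power sums. -/

/-- The multiset of the nonzero exponents of a monomial. -/
def vals (e : ℕ →₀ ℕ) : Multiset ℕ := e.support.val.map e

/-- The product of the `p_k` over the members `k` of a multiset. -/
def psumMul (s : Multiset ℕ) : Ser := (s.map psum).prod

theorem coeff_psum (k : ℕ) (d : ℕ →₀ ℕ) : MvPowerSeries.coeff d (psum k) =
    open Classical in if ∃ i, d = Finsupp.single i k then 1 else 0 := rfl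

theorem vals_single_add {b : ℕ →₀ ℕ} {i k : ℕ} (hk : k ≠ 0) (hi : b i = 0) :
    vals (Finsupp.single i k + b) = k ::ₘ vals b := by
  have hd : Disjoint (Finsupp.single i k).support b.support := by
    rw [Finsupp.support_single i hk]; simpa using hi
  have hs : (Finsupp.single i k + b).support = insert i b.support := by
    rw [Finsupp.support_add_eq hd, Finsupp.support_single i hk]; rfl
  have hni : i ∉ b.support := by simpa using hi
  unfold vals
  rw [hs, Finset.insert_val_of_notMem hni, Multiset.map_cons]
  simp only [Finsupp.add_apply, Finsupp.single_eq_same, hi, add_zero]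
  congr 1
  apply Multiset.map_congr rfl
  intro x hx
  have : x ≠ i := by rintro rfl; exact hni hx
  simp [this.symm]

theorem vals_erase {e : ℕ →₀ ℕ} {k : ℕ} {t : Multiset ℕ} (h : vals e = k ::ₘ t) :
    ∃ i b, b i = 0 ∧ k ≠ 0 ∧ e = Finsupp.single i k + b ∧ vals b = t := by
  have hk : k ∈ vals e := by rw [h]; exact Multiset.mem_cons_self _ _
  obtain ⟨i, hi, hik⟩ := Multiset.mem_map.1 hk
  have hi' : e i ≠ 0 := by simpa using hi
  have he : e = Finsupp.single i k + e.erase i := by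
    rw [← hik, Finsupp.single_add_erase]
  have h0 : e.erase i i = 0 := by simp
  refine ⟨i, e.erase i, h0, hik ▸ hi', he, ?_⟩
  rw [he, vals_single_add (hik ▸ hi') h0] at h
  exact (Multiset.cons_inj_right k).1 h

theorem exists_vals (s : Multiset ℕ) (hs : ∀ k ∈ s, k ≠ 0) : ∃ e, vals e = s := by
  induction s using Multiset.induction with
  | empty => exact ⟨0, by simp [vals]⟩
  | cons k t ih =>
    obtain ⟨e, he⟩ := ih fun k hk => hs k (Multiset.mem_cons_of_mem hk)
    obtain ⟨i, hi⟩ := Infinite.exists_notMem_finset e.support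
    exact ⟨Finsupp.single i k + e, by
      rw [vals_single_add (hs k (Multiset.mem_cons_self _ _)) (by simpa using hi), he]⟩

theorem exists_perm_of_vals_eq (s : Multiset ℕ) : ∀ e e' : ℕ →₀ ℕ, vals e = s → vals e' = s →
    ∃ σ : Equiv.Perm ℕ, e.mapDomain σ = e' := by
  induction s using Multiset.induction with
  | empty =>
    intro e e' h h'
    have aux : ∀ e : ℕ →₀ ℕ, vals e = 0 → e = 0 := fun e h => by
      simpa [vals] using h
    exact ⟨1, by rw [aux e h, aux e' h', Finsupp.mapDomain_zero]⟩
  | cons k t ih =>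
    intro e e' h h'
    obtain ⟨i, b, hb, hk, rfl, hbt⟩ := vals_erase h
    obtain ⟨j, b', hb', -, rfl, hbt'⟩ := vals_erase h'
    obtain ⟨σ, hσ⟩ := ih b b' hbt hbt'
    have hσi : b' (σ i) = 0 := by
      rw [← hσ, Finsupp.mapDomain_apply σ.injective, hb]
    refine ⟨σ.trans (Equiv.swap (σ i) j), ?_⟩
    rw [Finsupp.mapDomain_add, Finsupp.mapDomain_single]
    congr 1
    · simp
    · rw [Equiv.coe_trans, Finsupp.mapDomain_comp, hσ]
      ext x
      obtain ⟨y, rfl⟩ := (Equiv.swap (σ i) j).surjective x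
      rw [Finsupp.mapDomain_apply (Equiv.injective _)]
      rcases eq_or_ne y (σ i) with rfl | h1
      · rw [Equiv.swap_apply_left, hσi, hb']
      · rcases eq_or_ne y j with rfl | h2
        · rw [Equiv.swap_apply_right, hσi, hb']
        · rw [Equiv.swap_apply_of_ne_of_ne h1 h2]

theorem IsSymmSeries.mul {f g : Ser} (hf : IsSymmSeries f) (hg : IsSymmSeries g) :
    IsSymmSeries (f * g) := by
  classical
  intro σ d
  rw [MvPowerSeries.coeff_mul, MvPowerSeries.coeff_mul]
  symm
  refine Finset.sum_nbij' (fun p => (p.1.mapDomain σ, p.2.mapDomain σ))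
    (fun p => (p.1.mapDomain σ.symm, p.2.mapDomain σ.symm)) ?_ ?_ ?_ ?_ ?_
  · intro p hp
    rw [Finset.HasAntidiagonal.mem_antidiagonal] at hp ⊢
    rw [← hp, Finsupp.mapDomain_add]
  · intro p hp
    rw [Finset.HasAntidiagonal.mem_antidiagonal] at hp ⊢
    rw [← Finsupp.mapDomain_add, hp, ← Finsupp.mapDomain_comp]
    simp [Finsupp.mapDomain_id]
  · intro p _
    simp [← Finsupp.mapDomain_comp, Finsupp.mapDomain_id]
  · intro p _
    simp [← Finsupp.mapDomain_comp, Finsupp.mapDomain_id]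
  · intro p _
    rw [hf σ, hg σ]

theorem isSymmSeries_psum (k : ℕ) : IsSymmSeries (psum k) := by
  classical
  intro σ d
  rw [coeff_psum, coeff_psum]
  congr 1
  apply propext
  constructor
  · rintro ⟨i, hi⟩
    refine ⟨σ.symm i, Finsupp.mapDomain_injective σ.injective ?_⟩
    rw [hi, Finsupp.mapDomain_single]; simp
  · rintro ⟨i, rfl⟩
    exact ⟨σ i, Finsupp.mapDomain_single⟩

theorem isSymmSeries_psumMul (s : Multiset ℕ) : IsSymmSeries (psumMul s) := by
  induction s using Multiset.induction with
  | empty =>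
    intro σ d
    classical
    simp only [psumMul, Multiset.map_zero, Multiset.prod_zero, MvPowerSeries.coeff_one]
    congr 1
    apply propext
    exact ⟨fun h => Finsupp.mapDomain_injective σ.injective (by rw [h, Finsupp.mapDomain_zero]),
      fun h => by rw [h, Finsupp.mapDomain_zero]⟩
  | cons k t ih =>
    simpa [psumMul] using (isSymmSeries_psum k).mul ih

/-- A monomial that occurs in `p_s` has at most as many variables as `s` has members, with
equality only if its exponents are the members of `s`. -/
theorem coeff_psumMul_ne_zero (s : Multiset ℕ) : ∀ e : ℕ →₀ ℕ,
    MvPowerSeries.coeff e (psumMul s) ≠ 0 → (∀ k ∈ s, k ≠ 0) →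
      (vals e).card ≤ s.card ∧ (vals e).sum = s.sum ∧ ((vals e).card = s.card → vals e = s) := by
  classical
  induction s using Multiset.induction with
  | empty =>
    intro e he _
    have : e = 0 := by
      by_contra h
      exact he (by simp [psumMul, MvPowerSeries.coeff_one, h])
    subst this
    simp [vals]
  | cons k t ih =>
    intro e he hs
    have hk : k ≠ 0 := hs k (Multiset.mem_cons_self _ _)
    rw [psumMul, Multiset.map_cons, Multiset.prod_cons, MvPowerSeries.coeff_mul] at he
    obtain ⟨⟨a, b⟩, hab, hne⟩ := Finset.exists_ne_zero_of_sum_ne_zero he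
    rw [Finset.HasAntidiagonal.mem_antidiagonal] at hab
    obtain ⟨i, rfl⟩ : ∃ i, a = Finsupp.single i k := by
      by_contra h
      exact hne (by rw [coeff_psum, if_neg h, zero_mul])
    simp only at hab
    subst hab
    obtain ⟨h1, h2, h3⟩ := ih b (right_ne_zero_of_mul hne)
      fun k hk => hs k (Multiset.mem_cons_of_mem hk)
    by_cases hi : b i = 0
    · rw [vals_single_add hk hi]
      simp only [Multiset.card_cons, Multiset.sum_cons]
      exact ⟨by omega, by omega, fun h => by rw [h3 (by omega)]⟩
    · have e1 : b = Finsupp.single i (b i) + b.erase i := (Finsupp.single_add_erase i b).symm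
      have h0 : b.erase i i = 0 := by simp
      have e2 : Finsupp.single i k + b = Finsupp.single i (k + b i) + b.erase i := by
        conv_lhs => rw [e1, ← add_assoc, ← Finsupp.single_add]
      have v1 : vals b = b i ::ₘ vals (b.erase i) := by
        conv_lhs => rw [e1]
        exact vals_single_add hi h0
      have v2 := vals_single_add (k := k + b i) (by omega) h0
      rw [← e2] at v2
      rw [v1] at h1 h2
      rw [v2]
      simp only [Multiset.card_cons, Multiset.sum_cons] at h1 h2 ⊢
      exact ⟨by omega, by omega, fun h => by omega⟩

open scoped ComplexOrder in
theorem coeff_psumMul_nonneg (s : Multiset ℕ) (e : ℕ →₀ ℕ) :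
    0 ≤ MvPowerSeries.coeff e (psumMul s) := by
  classical
  induction s using Multiset.induction generalizing e with
  | empty =>
    simp only [psumMul, Multiset.map_zero, Multiset.prod_zero, MvPowerSeries.coeff_one]
    split_ifs <;> simp
  | cons k t ih =>
    rw [psumMul, Multiset.map_cons, Multiset.prod_cons, MvPowerSeries.coeff_mul]
    refine Finset.sum_nonneg fun p _ => mul_nonneg ?_ (ih _)
    rw [coeff_psum]
    split_ifs <;> simp

open scoped ComplexOrder in
theorem coeff_psumMul_vals (s : Multiset ℕ) : ∀ e : ℕ →₀ ℕ, vals e = s →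
    MvPowerSeries.coeff e (psumMul s) ≠ 0 := by
  classical
  induction s using Multiset.induction with
  | empty =>
    intro e he
    have : e = 0 := by simpa [vals] using he
    subst this
    simp [psumMul]
  | cons k t ih =>
    intro e he
    obtain ⟨i, b, hb, hk, rfl, hbt⟩ := vals_erase he
    rw [psumMul, Multiset.map_cons, Multiset.prod_cons, MvPowerSeries.coeff_mul]
    intro h
    rw [Finset.sum_eq_zero_iff_of_nonneg] at h
    · have := h (Finsupp.single i k, b) (by simp)
      simp only [coeff_psum] at this
      rw [if_pos ⟨i, rfl⟩, one_mul] at this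
      exact ih b hbt this
    · intro p _
      refine mul_nonneg ?_ (coeff_psumMul_nonneg t _)
      rw [coeff_psum]
      split_ifs <;> simp

theorem hasSubst_psum : MvPowerSeries.HasSubst (fun k : ℕ+ => psum k) where
  const_coeff k := by
    rw [← MvPowerSeries.coeff_zero_eq_constantCoeff_apply, coeff_psum, if_neg]
    · exact IsNilpotent.zero
    · rintro ⟨i, hi⟩
      exact k.ne_zero (Finsupp.single_eq_zero.1 hi.symm)
  coeff_zero d := by
    refine Set.Finite.subset (Set.finite_le_nat d.degree |>.preimage
      (f := fun k : ℕ+ => (k : ℕ)) PNat.coe_injective.injOn) ?_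
    intro k hk
    by_contra h
    apply hk
    change MvPowerSeries.coeff d (psum k) = 0
    rw [coeff_psum, if_neg]
    rintro ⟨i, rfl⟩
    exact h (by simp)

/-- The multiset of positive integers of a monomial in the power sums. -/
def toMul (d : ℕ+ →₀ ℕ) : Multiset ℕ := (Finsupp.toMultiset d).map fun k : ℕ+ => (k : ℕ)

theorem toMul_injective : Function.Injective toMul :=
  (Multiset.map_injective PNat.coe_injective).comp (AddEquiv.injective Multiset.toFinsupp.symm)

theorem toMul_ne_zero (d : ℕ+ →₀ ℕ) : ∀ k ∈ toMul d, k ≠ 0 := by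
  intro k hk
  obtain ⟨k, -, rfl⟩ := Multiset.mem_map.1 hk
  exact k.ne_zero

theorem exists_toMul (s : Multiset ℕ) (hs : ∀ k ∈ s, k ≠ 0) : ∃ d, toMul d = s := by
  refine ⟨Multiset.toFinsupp (s.attach.map fun k => Nat.toPNat k.1 (Nat.pos_of_ne_zero (hs _ k.2))), ?_⟩
  rw [toMul, Multiset.toFinsupp_toMultiset, Multiset.map_map]
  exact Multiset.attach_map_val s

theorem prod_psum_eq (d : ℕ+ →₀ ℕ) :
    (d.prod fun k n => psum k ^ n) = psumMul (toMul d) := by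
  rw [psumMul, toMul, Multiset.map_map, Finsupp.toMultiset_map, Finsupp.prod_toMultiset,
    Finsupp.prod_mapDomain_index (fun _ => pow_zero _) (fun _ _ _ => pow_add _ _ _)]
  rfl

theorem coeff_evalPsum (P : MvPowerSeries ℕ+ ℂ) (e : ℕ →₀ ℕ) :
    MvPowerSeries.coeff e (evalPsum P) =
      ∑ᶠ d, MvPowerSeries.coeff d P * MvPowerSeries.coeff e (psumMul (toMul d)) := by
  rw [evalPsum, MvPowerSeries.coeff_subst hasSubst_psum]
  simp_rw [prod_psum_eq, smul_eq_mul]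

theorem isSymmSeries_evalPsum (P : MvPowerSeries ℕ+ ℂ) : IsSymmSeries (evalPsum P) := by
  intro σ e
  simp_rw [coeff_evalPsum, isSymmSeries_psumMul _ σ e]

/-- The excess of the size of a partition over its length. -/
def excess (d : ℕ+ →₀ ℕ) : ℕ := (toMul d).sum - (toMul d).card

theorem card_le_sum {s : Multiset ℕ} (hs : ∀ k ∈ s, k ≠ 0) : s.card ≤ s.sum := by
  simpa using Multiset.card_nsmul_le_sum (a := 1) (fun x hx => Nat.pos_of_ne_zero (hs x hx))

theorem excess_lt {d d' : ℕ+ →₀ ℕ} {e : ℕ →₀ ℕ} (he : vals e = toMul d)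
    (h : MvPowerSeries.coeff e (psumMul (toMul d')) ≠ 0) (hne : d' ≠ d) :
    excess d' < excess d := by
  obtain ⟨h1, h2, h3⟩ := coeff_psumMul_ne_zero _ e h (toMul_ne_zero d')
  rw [he] at h1 h2 h3
  have h4 : (toMul d).card ≠ (toMul d').card := fun h => hne (toMul_injective (h3 h).symm)
  have := card_le_sum (toMul_ne_zero d')
  unfold excess
  omega

/-- The power sums are algebraically independent, also for infinite series. -/
theorem evalPsum_injective : Function.Injective evalPsum := by
  intro P Q hPQ
  ext d
  induction hm : excess d using Nat.strong_induction_on generalizing d with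
  | _ m ih =>
    subst hm
    obtain ⟨e, he⟩ := exists_vals (toMul d) (toMul_ne_zero d)
    have key : ∀ R : MvPowerSeries ℕ+ ℂ, (fun d' => MvPowerSeries.coeff d' R *
        MvPowerSeries.coeff e (psumMul (toMul d'))).HasFiniteSupport := fun R => by
      simpa only [prod_psum_eq, smul_eq_mul] using
        MvPowerSeries.coeff_subst_finite hasSubst_psum R e
    have h := congrArg (MvPowerSeries.coeff e) hPQ
    rw [coeff_evalPsum, coeff_evalPsum, ← sub_eq_zero, ← finsum_sub_distrib (key P) (key Q),
      finsum_eq_single _ d, ← sub_mul] at h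
    · exact sub_eq_zero.1 ((mul_eq_zero.1 h).resolve_right (coeff_psumMul_vals _ e he))
    · intro d' hd'
      by_cases h0 : MvPowerSeries.coeff e (psumMul (toMul d')) = 0
      · simp [h0]
      · rw [ih _ (excess_lt he h0 hd') d' rfl, sub_self]

/-- Every symmetric series is a series in the power sums. -/
theorem evalPsum_surjective {f : Ser} (hf : IsSymmSeries f) : ∃ P, evalPsum P = f := by
  choose e he using fun d : ℕ+ →₀ ℕ => exists_vals (toMul d) (toMul_ne_zero d)
  let c (d d' : ℕ+ →₀ ℕ) : ℂ := MvPowerSeries.coeff (e d) (psumMul (toMul d'))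
  have hc : ∀ d, c d d ≠ 0 := fun d => coeff_psumMul_vals _ _ (he d)
  let wf : WellFounded fun d d' : ℕ+ →₀ ℕ => excess d < excess d' :=
    (measure excess).wf
  let P : MvPowerSeries ℕ+ ℂ := wf.fix fun d rec =>
    (MvPowerSeries.coeff (e d) f -
      ∑ᶠ d', if h : excess d' < excess d then rec d' h * c d d' else 0) / c d d
  have hP : ∀ d, P d = (MvPowerSeries.coeff (e d) f -
      ∑ᶠ d', if excess d' < excess d then P d' * c d d' else 0) / c d d := by
    intro d
    have := wf.fix_eq (fun d rec => (MvPowerSeries.coeff (e d) f -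
      ∑ᶠ d', if h : excess d' < excess d then rec d' h * c d d' else 0) / c d d) d
    simpa only [dite_eq_ite] using this
  refine ⟨P, ?_⟩
  have main : ∀ d, MvPowerSeries.coeff (e d) (evalPsum P) = MvPowerSeries.coeff (e d) f := by
    intro d
    have fin : (fun d' => P d' * c d d').HasFiniteSupport := by
      have := MvPowerSeries.coeff_subst_finite hasSubst_psum P (e d)
      simp only [prod_psum_eq, smul_eq_mul] at this
      exact this
    have split : (fun d' => P d' * c d d') = fun d' =>
        (if excess d' < excess d then P d' * c d d' else 0) +
          (if d' = d then P d * c d d else 0) := by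
      funext d'
      rcases eq_or_ne d' d with rfl | hne
      · simp
      · by_cases h0 : c d d' = 0
        · simp [h0, hne]
        · simp [excess_lt (he d) h0 hne, hne]
    have f1 : (fun d' => if excess d' < excess d then P d' * c d d' else 0).HasFiniteSupport := by
      refine Set.Finite.subset fin ?_
      intro d' hd' h0
      apply hd'
      simp only at h0 ⊢
      rw [h0, ite_self]
    have f2 : (fun d' => if d' = d then P d * c d d else 0).HasFiniteSupport := by
      refine Set.Finite.subset (Set.finite_singleton d) ?_
      intro d' hd'
      by_contra h
      exact hd' (if_neg h)
    rw [coeff_evalPsum]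
    change ∑ᶠ d', P d' * c d d' = _
    rw [split, finsum_add_distrib f1 f2, finsum_eq_single _ d (fun d' h => if_neg h), if_pos rfl,
      hP d, div_mul_cancel₀ _ (hc d)]
    ring
  ext x
  obtain ⟨d, hd⟩ := exists_toMul (vals x) (by
    intro k hk
    obtain ⟨i, hi, rfl⟩ := Multiset.mem_map.1 hk
    simpa using hi)
  obtain ⟨σ, hσ⟩ := exists_perm_of_vals_eq (vals x) (e d) x ((he d).trans hd) rfl
  rw [← hσ, isSymmSeries_evalPsum P σ, hf σ, main]

/-- The expression of `f` as a series in the power sums: the series `P` with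
`f = P(p₁, p₂, p₃, …)`. It exists and is unique for every symmetric `f`, see
`evalPsum_injective`, `evalPsum_surjective`, `evalPsum_psumExpr`. -/
def psumExpr (f : Ser) : MvPowerSeries ℕ+ ℂ := Function.invFun evalPsum f

theorem evalPsum_psumExpr {f : Ser} (hf : IsSymmSeries f) : evalPsum (psumExpr f) = f :=
  Function.invFun_eq (evalPsum_surjective hf)

theorem psumExpr_evalPsum (P : MvPowerSeries ℕ+ ℂ) : psumExpr (evalPsum P) = P :=
  Function.leftInverse_invFun evalPsum_injective P

/-- `p_k[g] = g(x₀^k, x₁^k, x₂^k, …)`. -/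
def psumPleth (k : ℕ+) (g : Ser) : Ser := MvPowerSeries.expand (k : ℕ) k.ne_zero g

/-- The plethysm `f[g]`, for a symmetric `f` and a series `g` without constant term: if
`f = P(p₁, p₂, …)`, then `f[g] = P(p₁[g], p₂[g], …)`. -/
def pleth (f g : Ser) : Ser :=
  MvPowerSeries.subst (fun k : ℕ+ => psumPleth k g) (psumExpr f)

/-- The involution `ω`, determined by `ω(p_k) = (-1)^(k-1) p_k`. -/
def omega (f : Ser) : Ser :=
  MvPowerSeries.subst (fun k : ℕ+ => (-1 : ℂ) ^ ((k : ℕ) - 1) • psum k) (psumExpr f)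

/-- `f` and `g` are inverse to each other for plethysm. -/
def IsPlethInverse (f g : Ser) : Prop := pleth f g = psum 1 ∧ pleth g f = psum 1

/-- `H = ∑_{r ≥ 0} h_r`. -/
def hSeries : Ser := sumAll hsymm

/-- `E = ∑_{r ≥ 0} e_r`. -/
def eSeries : Ser := sumAll esymm

/-- `H^± = ∑_{r ≥ 0} (-1)^r h_r`. -/
def hpmSeries : Ser := sumAll fun r => (-1 : ℂ) ^ r • hsymm r

/-- `H_μ[Q] = ∏_i h_{mᵢ}[qᵢ]`, over the `i` that occur in `μ`, `mᵢ` times. -/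
def Hpart (q : ℕ → Ser) {n : ℕ} (μ : n.Partition) : Ser :=
  ∏ i ∈ μ.parts.toFinset, pleth (hsymm (μ.parts.count i)) (q i)

/-- `E_μ[Q] = ∏_i e_{mᵢ}[qᵢ]`, over the `i` that occur in `μ`, `mᵢ` times. -/
def Epart (q : ℕ → Ser) {n : ℕ} (μ : n.Partition) : Ser :=
  ∏ i ∈ μ.parts.toFinset, pleth (esymm (μ.parts.count i)) (q i)

/-- The length of a partition, the number of its parts. -/
def len {n : ℕ} (μ : n.Partition) : ℕ := μ.parts.card

/-- `H[Q](t) = ∑_μ t^{|μ|} H_μ[Q]`. -/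
def genH (q : ℕ → Ser) : PowerSeries Ser :=
  PowerSeries.mk fun n => ∑ μ : n.Partition, Hpart q μ

/-- `E[Q](t) = ∑_μ t^{|μ|} E_μ[Q]`. -/
def genE (q : ℕ → Ser) : PowerSeries Ser :=
  PowerSeries.mk fun n => ∑ μ : n.Partition, Epart q μ

/-- `H^±[Q](t) = ∑_μ t^{|μ|} (-1)^{ℓ(μ)} H_μ[Q]`. -/
def genHpm (q : ℕ → Ser) : PowerSeries Ser :=
  PowerSeries.mk fun n => ∑ μ : n.Partition, (-1 : ℂ) ^ len μ • Hpart q μ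

/-- The sequence `(-1)^(n-1) ω(q_n)`, for `n ≥ 1`. -/
def altOmega (q : ℕ → Ser) (n : ℕ) : Ser := (-1 : ℂ) ^ (n - 1) • omega (q n)

/-- The partitions of `n` all of whose parts are powers of `2` (including `1 = 2^0`). -/
def twoPowerParts (n : ℕ) : Finset n.Partition := open Classical in
  Finset.univ.filter fun μ => ∀ i ∈ μ.parts, ∃ a : ℕ, i = 2 ^ a

/-- The partitions of `n` with distinct parts, all of which are powers of `2`. -/
def twoPowerDistinctParts (n : ℕ) : Finset n.Partition := open Classical in
  (twoPowerParts n).filter fun μ => μ.parts.Nodup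

/-- `t^k p_k`. -/
def tpsum (k : ℕ) : PowerSeries Ser := PowerSeries.C (psum k) * PowerSeries.X ^ k

/-! ### The modules -/

/-- The Frobenius characteristic `ch V = (1/n!) ∑_{σ ∈ S_n} χ_V(σ) p_{type(σ)}`. -/
def ch {n : ℕ} {V : Type*} [AddCommGroup V] [Module ℂ V]
    (ρ : Representation ℂ (Equiv.Perm (Fin n)) V) : Ser :=
  (n.factorial : ℂ)⁻¹ • ∑ σ : Equiv.Perm (Fin n),
    LinearMap.trace ℂ V (ρ σ) • psumPart σ.partition

/-- The subgroup `C_n` of `S_n` generated by the `n`-cycle `(0 1 ⋯ n-1)`. -/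
def cyc (n : ℕ) : Subgroup (Equiv.Perm (Fin n)) := Subgroup.zpowers (finRotate n)

/-- The generator of `C_n`. -/
def cycGen (n : ℕ) : cyc n := ⟨finRotate n, Subgroup.mem_zpowers _⟩

/-- The complex number `exp((2πi/n) r)`. -/
def rootExp (n r : ℕ) : ℂˣ :=
  Units.mk0 (Complex.exp (2 * Real.pi * Complex.I / n * r)) (Complex.exp_ne_zero _)

theorem mem_zpowers_cycGen (n : ℕ) (x : cyc n) : x ∈ Subgroup.zpowers (cycGen n) := by
  obtain ⟨x, k, rfl⟩ := x
  exact ⟨k, Subtype.ext (by simp [cycGen])⟩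

theorem orderOf_rootExp_dvd (n r : ℕ) : orderOf (rootExp n r) ∣ orderOf (cycGen n) := by
  have h1 : orderOf (cycGen n) = orderOf (finRotate n) := Subgroup.orderOf_mk ..
  rw [h1]
  rcases n with _ | _ | n
  · have : rootExp 0 r = 1 := by ext; simp [rootExp]
    simp [this]
  · have : rootExp 1 r = 1 := by
      ext
      simp only [rootExp, Units.val_mk0, Units.val_one]
      rw [Complex.exp_eq_one_iff]
      exact ⟨r, by push_cast; ring⟩
    simp [this]
  · rw [← Equiv.Perm.lcm_cycleType, cycleType_finRotate]
    simp only [Multiset.lcm_singleton, normalize_eq]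
    rw [orderOf_dvd_iff_pow_eq_one]
    ext
    simp only [rootExp, Units.val_pow_eq_pow_val, Units.val_mk0, Units.val_one]
    rw [← Complex.exp_nat_mul, Complex.exp_eq_one_iff]
    refine ⟨r, ?_⟩
    have : ((n + 2 : ℕ) : ℂ) ≠ 0 := by exact_mod_cast (by omega : n + 2 ≠ 0)
    rw [mul_comm ((n + 2 : ℕ) : ℂ)]
    push_cast at this ⊢
    have h2 : (n : ℂ) + 1 + 1 ≠ 0 := by rwa [add_assoc, one_add_one_eq_two]
    field_simp
    ring

/-- The linear character of `C_n` that sends the generator to `exp((2πi/n) r)`. -/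
def cycChar (n r : ℕ) : cyc n →* ℂˣ :=
  monoidHomOfForallMemZpowers (mem_zpowers_cycGen n) (orderOf_rootExp_dvd n r)

theorem cycChar_gen (n r : ℕ) : cycChar n r (cycGen n) = rootExp n r :=
  monoidHomOfForallMemZpowers_apply_gen _ _

/-- The one-dimensional representation of `C_n` afforded by `cycChar n r`. -/
def cycRep (n r : ℕ) : Representation ℂ (cyc n) ℂ :=
  ((Algebra.lmul ℂ ℂ : ℂ →* Module.End ℂ ℂ).comp (Units.coeHom ℂ)).comp (cycChar n r)

/-- The induced representation of `S_n` from the character `exp((2πi/n) r)` of `C_n`. -/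
def cycInd (n r : ℕ) : Representation ℂ (Equiv.Perm (Fin n))
    (Representation.IndV (cyc n).subtype (cycRep n r)) :=
  Representation.ind (cyc n).subtype (cycRep n r)

/-- (The Frobenius characteristic of) `Lie_n`, induced from the character `exp(2πi/n)`. -/
def LieSym (n : ℕ) : Ser := ch (cycInd n 1)

/-- (The Frobenius characteristic of) `Lie_n^{(2)}`, induced from the character
`exp((2πi/n) 2^k)`, where `2^k` is the largest power of `2` that divides `n`. -/
def LieTwoSym (n : ℕ) : Ser := ch (cycInd n (2 ^ padicValNat 2 n))

end

end PlethLie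

open PlethLie

/-!
The Euler derivation `θ`, multiplication by `n` in degree `n`, turns `H = exp (∑ p_k / k)` into
`θ(H[g]) = H[g] · ∑_{k ≥ 1} p_k[θ g]`, so that a value of `H[g]` is detected by the linear
expression `∑_k p_k[θ g]`. Since `E[g] = H[g] / p_2[H[g]]`, the same holds for `E[g]`.

If `V` is induced from a character `χ` of `C_n`, then `n · ch V = ∑_{d ∣ n} c_d p_d^{n/d}`, where
`c_d` is the sum of `χ` over the elements of order `d`. If `χ` sends the generator to `ζ_n^r`,
orthogonality of characters gives `∑_{i ∣ d} c_i = d` if `d ∣ r` and `0` otherwise. The operator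
`∑_k p_k[·]` undoes the Möbius inversion in `c`. For `g = Lie` it leaves
`∑_k p_k[θ g] = p_1 / (1 - p_1)`, hence `H[Lie] = 1 / (1 - p_1)`. For `g = Lie^(2)`, where `d ∣ r`
means that `d` is a power of `2`, it leaves `M = ∑_a 2^a p_{2^a} / (1 - p_{2^a})`, and
`M = p_1 / (1 - p_1) + 2 p_2[M]` gives `E[Lie^(2)] = 1 / (1 - p_1)`.

For the equivalences, `λ ↦ H_λ[F]` sums to `H[F]` and homogeneous components separate degrees,
the involution `p_k ↦ -p_k` exchanges `F` with its twist by `ω`, and iterating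
`H[g] = E[g] · p_2[H[g]]` yields the products over the powers of `2`.
-/

namespace PlethLie

noncomputable section

open MvPowerSeries

/-! ### Homogeneous power series -/

section Homogeneous

variable {σ τ ι R : Type*} [CommRing R]

theorem isHomogeneous_one : (1 : MvPowerSeries σ R).IsHomogeneous 0 := by
  classical
  intro d hd
  rw [coeff_one] at hd
  rw [of_not_not fun h => hd (if_neg h), map_zero]

theorem isHomogeneous_zero (n : ℕ) : (0 : MvPowerSeries σ R).IsHomogeneous n :=
  fun hd => absurd (coeff_zero _) hd

theorem isHomogeneous_smul {f : MvPowerSeries σ R} {n : ℕ} (c : R) (hf : f.IsHomogeneous n) :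
    (c • f).IsHomogeneous n :=
  fun hd => hf fun h => hd (by rw [coeff_smul, h, mul_zero])

theorem isHomogeneous_neg {f : MvPowerSeries σ R} {n : ℕ} (hf : f.IsHomogeneous n) :
    (-f).IsHomogeneous n :=
  fun hd => hf fun h => hd (by rw [map_neg, h, neg_zero])

theorem isHomogeneous_sum (s : Finset ι) {f : ι → MvPowerSeries σ R} {n : ℕ}
    (hf : ∀ i ∈ s, (f i).IsHomogeneous n) : (∑ i ∈ s, f i).IsHomogeneous n :=
  Finset.sum_induction f (·.IsHomogeneous n) (fun _ _ => .add) (isHomogeneous_zero n) hf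

theorem isHomogeneous_pow {f : MvPowerSeries σ R} {n : ℕ} (hf : f.IsHomogeneous n) (m : ℕ) :
    (f ^ m).IsHomogeneous (m * n) := by
  induction m with
  | zero => rw [pow_zero, zero_mul]; exact isHomogeneous_one
  | succ m ih => rw [pow_succ, add_mul, one_mul]; exact ih.mul hf

theorem isHomogeneous_prod (s : Finset ι) {f : ι → MvPowerSeries σ R} {n : ι → ℕ}
    (hf : ∀ i ∈ s, (f i).IsHomogeneous (n i)) :
    (∏ i ∈ s, f i).IsHomogeneous (∑ i ∈ s, n i) := by
  classical
  induction s using Finset.induction with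
  | empty => exact isHomogeneous_one
  | insert a s ha ih =>
    rw [Finset.prod_insert ha, Finset.sum_insert ha]
    exact IsHomogeneous.mul (hf a (Finset.mem_insert_self _ _))
      (ih fun i hi => hf i (Finset.mem_insert_of_mem hi))

theorem homogeneousComponent_of_isHomogeneous {f : MvPowerSeries σ R} {n : ℕ}
    (hf : f.IsHomogeneous n) (m : ℕ) : homogeneousComponent m f = if m = n then f else 0 := by
  ext d
  rw [coeff_homogeneousComponent]
  split_ifs with hd hm hm
  · rfl
  · rw [hf.coeff_eq_zero (hd.trans_ne hm), map_zero]
  · rw [hf.coeff_eq_zero (hm ▸ hd)]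
  · rw [map_zero]

theorem eq_of_homogeneousComponent_eq {f g : MvPowerSeries σ R}
    (h : ∀ n, homogeneousComponent n f = homogeneousComponent n g) : f = g := by
  ext d
  simpa only [coeff_homogeneousComponent, if_true] using congrArg (coeff d) (h d.degree)

theorem constantCoeff_of_isHomogeneous {f : MvPowerSeries σ R} {n : ℕ} (hf : f.IsHomogeneous n)
    (hn : n ≠ 0) : constantCoeff f = 0 := by
  rw [← coeff_zero_eq_constantCoeff_apply, hf.coeff_eq_zero (by simpa using hn.symm)]

theorem homogeneousComponent_zero_of_constantCoeff_eq_zero {f : MvPowerSeries σ R}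
    (hf : constantCoeff f = 0) : homogeneousComponent 0 f = 0 :=
  homogeneousComponent_of_lt_order_eq_zero
    (Order.one_le_iff_pos.1 (one_le_order_iff_constCoeff_eq_zero.2 hf))

theorem homogeneousComponent_mul (n : ℕ) (f g : MvPowerSeries σ R) :
    homogeneousComponent n (f * g) = ∑ p ∈ Finset.HasAntidiagonal.antidiagonal n,
      homogeneousComponent p.1 f * homogeneousComponent p.2 g := by
  classical
  ext d
  rw [coeff_homogeneousComponent, coeff_mul, ← Finset.sum_const_zero, ← Finset.sum_ite_irrel]
  simp only [coeff_homogeneousComponent, map_sum, coeff_mul]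
  rw [Finset.sum_comm]
  refine Finset.sum_congr rfl fun x hx => ?_
  rw [← Finset.HasAntidiagonal.mem_antidiagonal.1 hx, map_add]
  have hp (p : ℕ × ℕ) : ((if x.1.degree = p.1 then coeff x.1 f else 0) *
      if x.2.degree = p.2 then coeff x.2 g else 0) =
        if (x.1.degree, x.2.degree) = p then coeff x.1 f * coeff x.2 g else 0 := by
    simp only [ite_zero_mul_ite_zero, Prod.ext_iff]
  simp only [hp, Finset.sum_ite_eq, Finset.HasAntidiagonal.mem_antidiagonal]

theorem homogeneousComponent_subst {a : σ → MvPowerSeries τ R} (ha : HasSubst a) {w : σ → ℕ}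
    (hw : ∀ s, (a s).IsHomogeneous (w s)) (n : ℕ) (P : MvPowerSeries σ R) :
    homogeneousComponent n (subst a P) = subst a (weightedHomogeneousComponent w n P) := by
  classical
  have hprod (d : σ →₀ ℕ) : (d.prod fun s m => a s ^ m).IsHomogeneous (Finsupp.weight w d) :=
    isHomogeneous_prod d.support fun s _ => isHomogeneous_pow (hw s) (d s)
  ext e
  rw [coeff_homogeneousComponent, coeff_subst ha, coeff_subst ha, ← finsum_zero (α := σ →₀ ℕ),
    ← apply_ite finsum]
  refine finsum_congr fun d => ?_
  rw [ite_apply, coeff_weightedHomogeneousComponent]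
  by_cases h : e.degree = Finsupp.weight w d
  · split_ifs <;> simp_all
  · simp [IsHomogeneous.coeff_eq_zero (hprod d) h]

/-- The ring homomorphism sending `f` to `∑ₙ fₙ tⁿ`, where `fₙ` is the homogeneous component of
degree `n` of `f`. -/
def grade : MvPowerSeries σ R →+* PowerSeries (MvPowerSeries σ R) where
  toFun f := PowerSeries.mk fun n => homogeneousComponent n f
  map_zero' := by ext1 n; rw [PowerSeries.coeff_mk, map_zero, map_zero]
  map_one' := by
    ext1 n
    rw [PowerSeries.coeff_mk, homogeneousComponent_of_isHomogeneous isHomogeneous_one,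
      PowerSeries.coeff_one]
  map_add' f g := by ext1 n; simp only [PowerSeries.coeff_mk, map_add]
  map_mul' f g := by
    ext1 n
    simp only [PowerSeries.coeff_mk, PowerSeries.coeff_mul, homogeneousComponent_mul]

theorem coeff_grade (n : ℕ) (f : MvPowerSeries σ R) :
    PowerSeries.coeff n (grade f) = homogeneousComponent n f :=
  PowerSeries.coeff_mk n fun n => homogeneousComponent n f

theorem grade_injective :
    Function.Injective (grade : MvPowerSeries σ R →+* PowerSeries (MvPowerSeries σ R)) :=
  fun f g h => eq_of_homogeneousComponent_eq fun n => by rw [← coeff_grade, h, coeff_grade]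

theorem grade_of_isHomogeneous {f : MvPowerSeries σ R} {n : ℕ} (hf : f.IsHomogeneous n) :
    grade f = PowerSeries.C f * PowerSeries.X ^ n := by
  ext1 m
  rw [coeff_grade, homogeneousComponent_of_isHomogeneous hf, PowerSeries.coeff_C_mul,
    PowerSeries.coeff_X_pow, mul_ite, mul_one, mul_zero]

theorem continuous_grade [TopologicalSpace R] :
    Continuous (grade : MvPowerSeries σ R →+* PowerSeries (MvPowerSeries σ R)) := by
  refine continuous_iff_continuousAt.2 fun f =>
    (PowerSeries.WithPiTopology.tendsto_iff_coeff_tendsto _ _ _ _).2 fun n =>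
      (MvPowerSeries.WithPiTopology.tendsto_iff_coeff_tendsto _ _ _).2 fun d => ?_
  simp only [coeff_grade, coeff_homogeneousComponent]
  split_ifs with h
  · exact (MvPowerSeries.WithPiTopology.continuous_coeff R d).tendsto f
  · exact tendsto_const_nhds

end Homogeneous

/-! ### Expansion, the Euler derivation and linear series -/

section Expand

variable {σ R : Type*} [CommRing R]

theorem exists_eq_smul_or_coeff_expand_eq_zero {k : ℕ} (hk : k ≠ 0) (d : σ →₀ ℕ) :
    (∃ m, d = k • m) ∨ ∀ f : MvPowerSeries σ R, coeff d (expand k hk f) = 0 := by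
  by_cases h : ∀ i, k ∣ d i
  · refine .inl ⟨d.mapRange (· / k) (Nat.zero_div k), Finsupp.ext fun i => ?_⟩
    rw [Finsupp.smul_apply, Finsupp.mapRange_apply, smul_eq_mul, Nat.mul_div_cancel' (h i)]
  · obtain ⟨i, hi⟩ := not_forall.1 h
    exact .inr fun f => coeff_expand_of_not_dvd k hk f hi

theorem expand_injective {k : ℕ} (hk : k ≠ 0) :
    Function.Injective (expand k hk : MvPowerSeries σ R → MvPowerSeries σ R) := fun f g h =>
  ext fun d => by rw [← coeff_expand_smul k hk f d, h, coeff_expand_smul]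

theorem eq_C_of_expand_eq {k : ℕ} (hk : 1 < k) {f : MvPowerSeries σ R}
    (hf : expand k (Nat.ne_zero_of_lt hk) f = f) : f = C (constantCoeff f) := by
  classical
  ext d
  induction hm : d.degree using Nat.strong_induction_on generalizing d with
  | _ m ih =>
    rw [coeff_C]
    split_ifs with hd
    · rw [hd, coeff_zero_eq_constantCoeff_apply]
    obtain ⟨e, rfl⟩ | hzero :=
      exists_eq_smul_or_coeff_expand_eq_zero (R := R) (Nat.ne_zero_of_lt hk) d
    · have he : e ≠ 0 := right_ne_zero_of_smul hd
      have hlt : e.degree < m := by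
        rw [← hm, map_nsmul, smul_eq_mul]
        exact lt_mul_of_one_lt_left
          (Nat.pos_of_ne_zero ((Finsupp.degree_eq_zero_iff e).not.2 he)) hk
      rw [← hf, coeff_expand_smul, ih _ hlt e rfl, coeff_C, if_neg he]
    · rw [← hf, hzero]

theorem isHomogeneous_expand {k : ℕ} (hk : k ≠ 0) {f : MvPowerSeries σ R} {n : ℕ}
    (hf : f.IsHomogeneous n) : (expand k hk f).IsHomogeneous (k * n) := by
  intro d hd
  obtain ⟨m, rfl⟩ | h := exists_eq_smul_or_coeff_expand_eq_zero (R := R) hk d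
  · rw [coeff_expand_smul] at hd
    rw [map_nsmul, smul_eq_mul, hf hd]
  · exact absurd (h f) hd

theorem continuous_expand [TopologicalSpace R] {k : ℕ} (hk : k ≠ 0) :
    Continuous (expand k hk : MvPowerSeries σ R → MvPowerSeries σ R) := by
  refine continuous_pi fun d => ?_
  obtain ⟨m, rfl⟩ | h := exists_eq_smul_or_coeff_expand_eq_zero (R := R) hk d
  · exact (MvPowerSeries.WithPiTopology.continuous_coeff R m).congr fun f =>
      (coeff_expand_smul k hk f m).symm
  · exact continuous_const.congr fun f => (h f).symm

theorem hasSubst_expand {f : MvPowerSeries σ R} (hf : constantCoeff f = 0) :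
    HasSubst fun k : ℕ+ => expand (k : ℕ) k.ne_zero f where
  const_coeff k := by
    rw [constantCoeff_expand, hf]
    exact IsNilpotent.zero
  coeff_zero d := by
    refine (((Set.finite_Iic d.degree).preimage PNat.coe_injective.injOn)).subset fun k hk => ?_
    obtain ⟨m, rfl⟩ | h := exists_eq_smul_or_coeff_expand_eq_zero (R := R) k.ne_zero d
    · rw [Set.mem_ofPred_eq, coeff_expand_smul] at hk
      have hm : m ≠ 0 := by
        rintro rfl
        exact hk hf
      rw [Set.mem_preimage, Set.mem_Iic, map_nsmul, smul_eq_mul]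
      exact Nat.le_mul_of_pos_right _
        (Nat.pos_of_ne_zero fun h => hm ((Finsupp.degree_eq_zero_iff m).1 h))
    · exact absurd (h f) hk

end Expand

section Linear

variable {σ τ R : Type*} [CommRing R]

/-- The linear series `∑ₛ wₛ Xₛ`. -/
def linSeries (w : σ → R) : MvPowerSeries σ R := fun d => ∑ᶠ s, w s * coeff d (X s)

theorem coeff_single_linSeries (w : σ → R) (s : σ) :
    coeff (Finsupp.single s 1) (linSeries w) = w s := by
  classical
  change ∑ᶠ t, w t * coeff (Finsupp.single s 1) (X t) = w s
  rw [finsum_eq_single _ s fun t ht => by rw [coeff_index_single_X, if_neg ht.symm, mul_zero],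
    coeff_index_single_self_X, mul_one]

theorem coeff_linSeries_eq_zero (w : σ → R) {d : σ →₀ ℕ} (hd : ∀ s, d ≠ Finsupp.single s 1) :
    coeff d (linSeries w) = 0 := by
  classical
  change ∑ᶠ t, w t * coeff d (X t) = 0
  exact finsum_eq_zero_of_forall_eq_zero fun t => by rw [coeff_X, if_neg (hd t), mul_zero]

theorem constantCoeff_linSeries (w : σ → R) : constantCoeff (linSeries w) = 0 :=
  coeff_linSeries_eq_zero w fun _ => (Finsupp.single_ne_zero.2 one_ne_zero).symm

theorem coeff_subst_linSeries {a : σ → MvPowerSeries τ R} (ha : HasSubst a) (w : σ → R)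
    (e : τ →₀ ℕ) : coeff e (subst a (linSeries w)) = ∑ᶠ s, w s * coeff e (a s) := by
  have hsupport : (Function.support fun d => coeff d (linSeries w) •
      coeff e (d.prod fun s n => a s ^ n)) ⊆ Set.range fun s => Finsupp.single s 1 := fun d hd => by
    by_contra h
    exact hd (by simp only [coeff_linSeries_eq_zero w fun s hs => h ⟨s, hs.symm⟩, zero_smul])
  rw [coeff_subst ha, ← finsum_mem_univ, ← finsum_mem_inter_support, Set.univ_inter,
    ← Set.inter_eq_right.2 hsupport, finsum_mem_inter_support,
    finsum_mem_range (Finsupp.single_left_injective one_ne_zero)]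
  refine finsum_congr fun s => ?_
  rw [coeff_single_linSeries, Finsupp.prod_single_index (h := fun s n => a s ^ n) (pow_zero _),
    pow_one, smul_eq_mul]

end Linear

section Euler

variable {σ R : Type*} [CommRing R]

/-- The Euler derivation, which multiplies the homogeneous component of degree `n` by `n`. -/
def euler : Derivation R (MvPowerSeries σ R) (MvPowerSeries σ R) :=
  Derivation.mk'
    { toFun f := fun d => d.degree * coeff d f
      map_add' f g := by ext d; exact mul_add _ _ _
      map_smul' c f := by ext d; exact mul_left_comm _ _ _ } fun f g => by
    classical
    ext d
    rw [smul_eq_mul, smul_eq_mul, mul_comm g, map_add, coeff_mul, coeff_mul,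
      ← Finset.sum_add_distrib]
    change (d.degree : R) * coeff d (f * g) = _
    rw [coeff_mul, Finset.mul_sum]
    refine Finset.sum_congr rfl fun p hp => ?_
    change _ = coeff p.1 f * (p.2.degree * coeff p.2 g) + p.1.degree * coeff p.1 f * coeff p.2 g
    rw [← Finset.HasAntidiagonal.mem_antidiagonal.1 hp, map_add, Nat.cast_add]
    ring

theorem coeff_euler (f : MvPowerSeries σ R) (d : σ →₀ ℕ) :
    coeff d (euler f) = d.degree * coeff d f := rfl

theorem constantCoeff_euler (f : MvPowerSeries σ R) : constantCoeff (euler f) = 0 := by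
  rw [← coeff_zero_eq_constantCoeff_apply, coeff_euler, map_zero, Nat.cast_zero, zero_mul]

theorem euler_of_isHomogeneous {f : MvPowerSeries σ R} {n : ℕ} (hf : f.IsHomogeneous n) :
    euler f = (n : R) • f := by
  ext d
  rw [coeff_euler, coeff_smul]
  by_cases h : d.degree = n
  · rw [h]
  · rw [hf.coeff_eq_zero h, mul_zero, mul_zero]

theorem euler_expand {k : ℕ} (hk : k ≠ 0) (f : MvPowerSeries σ R) :
    euler (expand k hk f) = (k : R) • expand k hk (euler f) := by
  ext d
  rw [coeff_euler, coeff_smul]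
  obtain ⟨m, rfl⟩ | h := exists_eq_smul_or_coeff_expand_eq_zero (R := R) hk d
  · rw [coeff_expand_smul, coeff_expand_smul, coeff_euler, map_nsmul, smul_eq_mul, Nat.cast_mul,
      mul_assoc]
  · rw [h, h, mul_zero, mul_zero]

theorem coeff_rescale_const (c : R) (f : MvPowerSeries σ R) (d : σ →₀ ℕ) :
    coeff d (rescale (fun _ => c) f) = c ^ d.degree * coeff d f := by
  rw [coeff_rescale, Finsupp.prod, Finset.prod_pow_eq_pow_sum, Finsupp.degree_apply]

theorem rescale_const_of_isHomogeneous (c : R) {f : MvPowerSeries σ R} {n : ℕ}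
    (hf : f.IsHomogeneous n) : rescale (fun _ => c) f = c ^ n • f := by
  ext d
  rw [coeff_rescale_const, coeff_smul]
  by_cases h : d.degree = n
  · rw [h]
  · rw [hf.coeff_eq_zero h, mul_zero, mul_zero]

theorem euler_rescale (c : R) (f : MvPowerSeries σ R) :
    euler (rescale (fun _ => c) f) = rescale (fun _ => c) (euler f) := by
  ext d
  rw [coeff_euler, coeff_rescale_const, coeff_rescale_const, coeff_euler, mul_left_comm]

theorem eq_zero_of_euler_eq_mul [IsDomain R] [CharZero R] {N W : MvPowerSeries σ R}
    (hN : constantCoeff N = 0) (hW : euler W = N * W) (h0 : constantCoeff W = 0) : W = 0 := by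
  classical
  ext d
  rw [map_zero]
  induction hm : d.degree using Nat.strong_induction_on generalizing d with
  | _ m ih =>
    by_cases hd : d = 0
    · rw [hd, coeff_zero_eq_constantCoeff_apply, h0]
    have hdeg : (d.degree : R) ≠ 0 := by rwa [Nat.cast_ne_zero, Ne, Finsupp.degree_eq_zero_iff]
    have hcoeff := congrArg (coeff d) hW
    rw [coeff_euler, coeff_mul, Finset.sum_eq_zero] at hcoeff
    · exact (mul_eq_zero.1 hcoeff).resolve_left hdeg
    intro p hp
    by_cases hp1 : p.1 = 0
    · rw [hp1, coeff_zero_eq_constantCoeff_apply, hN, zero_mul]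
    have hp1' : p.1.degree ≠ 0 := by rwa [Ne, Finsupp.degree_eq_zero_iff]
    have hadd := congrArg Finsupp.degree (Finset.HasAntidiagonal.mem_antidiagonal.1 hp)
    rw [map_add] at hadd
    rw [ih p.2.degree (by omega) p.2 rfl, mul_zero]

theorem eq_of_euler_eq_mul [IsDomain R] [CharZero R] {N U V : MvPowerSeries σ R}
    (hN : constantCoeff N = 0) (hU : euler U = N * U) (hV : euler V = N * V)
    (h0 : constantCoeff U = constantCoeff V) : U = V :=
  sub_eq_zero.1 <| eq_zero_of_euler_eq_mul hN (by rw [map_sub, hU, hV, mul_sub])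
    (by rw [map_sub, h0, sub_self])

theorem coeff_subst_eq_coeff_aeval_trunc {a : MvPowerSeries σ R} (ha : constantCoeff a = 0)
    (F : PowerSeries R) {d : σ →₀ ℕ} {N : ℕ} (hd : d.degree < N) :
    coeff d (F.subst a) = coeff d (Polynomial.aeval a (F.trunc N)) := by
  have hs := PowerSeries.HasSubst.of_constantCoeff_zero ha
  rw [← PowerSeries.subst_coe hs, PowerSeries.coeff_subst hs, PowerSeries.coeff_subst hs]
  refine finsum_congr fun n => ?_
  rw [Polynomial.coeff_coe, PowerSeries.coeff_trunc]
  split_ifs with hn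
  · rfl
  · rw [coeff_of_lt_order, smul_zero, smul_zero]
    exact (Nat.cast_lt.2 (by omega)).trans_le (le_order_pow_of_constantCoeff_eq_zero n ha)

theorem euler_subst {a : MvPowerSeries σ R} (ha : constantCoeff a = 0) (F : PowerSeries R) :
    euler (F.subst a) = (PowerSeries.derivative R F).subst a * euler a := by
  classical
  ext d
  calc coeff d (euler (F.subst a))
      = coeff d (euler (Polynomial.aeval a (F.trunc (d.degree + 2)))) := by
        rw [coeff_euler, coeff_euler,
          coeff_subst_eq_coeff_aeval_trunc ha F (Nat.lt_add_of_pos_right two_pos)]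
    _ = coeff d (Polynomial.aeval a ((PowerSeries.derivative R F).trunc (d.degree + 1)) *
          euler a) := by
        rw [Derivation.map_aeval, PowerSeries.trunc_derivative, smul_eq_mul]
    _ = coeff d ((PowerSeries.derivative R F).subst a * euler a) := by
        rw [coeff_mul, coeff_mul]
        refine Finset.sum_congr rfl fun p hp => ?_
        rw [coeff_subst_eq_coeff_aeval_trunc ha]
        rw [← Finset.HasAntidiagonal.mem_antidiagonal.1 hp, map_add]
        omega

end Euler

section Exp

variable {σ τ R : Type*} [CommRing R] [Algebra ℚ R]

/-- The exponential `∑ₙ aⁿ / n!` of a series without constant term. -/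
def expSeries (a : MvPowerSeries σ R) : MvPowerSeries σ R := (PowerSeries.exp R).subst a

theorem subst_expSeries {b : σ → MvPowerSeries τ R} (hb : HasSubst b) {a : MvPowerSeries σ R}
    (ha : constantCoeff a = 0) : subst b (expSeries a) = expSeries (subst b a) :=
  subst_comp_subst_apply (PowerSeries.HasSubst.of_constantCoeff_zero ha).const hb _

theorem constantCoeff_expSeries {a : MvPowerSeries σ R} (ha : constantCoeff a = 0) :
    constantCoeff (expSeries a) = 1 := by
  rw [← coeff_zero_eq_constantCoeff_apply, expSeries,
    coeff_subst_eq_coeff_aeval_trunc ha _ (N := 1) (by simp), PowerSeries.trunc_one_left]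
  simp

theorem euler_expSeries {a : MvPowerSeries σ R} (ha : constantCoeff a = 0) :
    euler (expSeries a) = euler a * expSeries a := by
  rw [expSeries, euler_subst ha, PowerSeries.derivative_exp, mul_comm]

theorem expSeries_add [IsDomain R] {a b : MvPowerSeries σ R} (ha : constantCoeff a = 0)
    (hb : constantCoeff b = 0) : expSeries (a + b) = expSeries a * expSeries b := by
  have : CharZero R := algebraRat.charZero R
  have hab : constantCoeff (a + b) = 0 := by rw [map_add, ha, hb, add_zero]
  apply eq_of_euler_eq_mul (constantCoeff_euler (a + b)) (euler_expSeries hab)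
  · rw [Derivation.leibniz, euler_expSeries ha, euler_expSeries hb, map_add, smul_eq_mul,
      smul_eq_mul]
    ring
  · rw [map_mul, constantCoeff_expSeries hab, constantCoeff_expSeries ha,
      constantCoeff_expSeries hb, mul_one]

end Exp

/-! ### The algebra of symmetric series and plethysm -/

theorem constantCoeff_subst_of_constantCoeff_eq_zero {σ τ R : Type*} [CommRing R]
    {a : σ → MvPowerSeries τ R} (ha : HasSubst a) (ha0 : ∀ s, constantCoeff (a s) = 0)
    (P : MvPowerSeries σ R) : constantCoeff (subst a P) = constantCoeff P := by
  rw [constantCoeff_subst ha, finsum_eq_single _ 0 fun d hd => ?_]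
  · rw [Finsupp.prod_zero_index, map_one, smul_eq_mul, mul_one, coeff_zero_eq_constantCoeff_apply]
  · obtain ⟨s, hs⟩ := Finsupp.ne_iff.1 hd
    rw [Finsupp.prod, map_prod, Finset.prod_eq_zero (Finsupp.mem_support_iff.2 hs), smul_zero]
    rw [map_pow, ha0, zero_pow hs]

theorem isHomogeneous_psum (k : ℕ) : (psum k).IsHomogeneous k := by
  intro d hd
  obtain ⟨i, rfl⟩ := not_not.1 fun h => hd (if_neg h)
  exact (Finsupp.weight_single _ _ _).trans (mul_one k)

theorem isHomogeneous_psumMul (s : Multiset ℕ) : (psumMul s).IsHomogeneous s.sum := by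
  induction s using Multiset.induction with
  | empty =>
    rw [psumMul, Multiset.map_zero, Multiset.prod_zero]
    exact isHomogeneous_one
  | cons k t ih =>
    rw [psumMul, Multiset.map_cons, Multiset.prod_cons, Multiset.sum_cons]
    exact IsHomogeneous.mul (isHomogeneous_psum k) ih

theorem constantCoeff_psum {k : ℕ} (hk : k ≠ 0) : constantCoeff (psum k) = 0 :=
  constantCoeff_of_isHomogeneous (isHomogeneous_psum k) hk

theorem constantCoeff_evalPsum (P : MvPowerSeries ℕ+ ℂ) :
    constantCoeff (evalPsum P) = constantCoeff P :=
  constantCoeff_subst_of_constantCoeff_eq_zero hasSubst_psum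
    (fun k => constantCoeff_psum k.ne_zero) P

theorem exists_evalPsum {f : Ser} (hf : IsSymmSeries f) : ∃ P, f = evalPsum P :=
  ⟨_, (evalPsum_psumExpr hf).symm⟩

theorem evalPsum_X (k : ℕ+) : evalPsum (X k) = psum k := subst_X hasSubst_psum k

theorem evalPsum_one : evalPsum 1 = 1 := by
  rw [evalPsum, ← coe_substAlgHom hasSubst_psum, map_one]

theorem evalPsum_smul (c : ℂ) (P : MvPowerSeries ℕ+ ℂ) : evalPsum (c • P) = c • evalPsum P :=
  subst_smul hasSubst_psum c P

theorem evalPsum_add (P Q : MvPowerSeries ℕ+ ℂ) : evalPsum (P + Q) = evalPsum P + evalPsum Q :=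
  subst_add hasSubst_psum P Q

theorem evalPsum_mul (P Q : MvPowerSeries ℕ+ ℂ) : evalPsum (P * Q) = evalPsum P * evalPsum Q :=
  subst_mul hasSubst_psum P Q

theorem isSymmSeries_zero : IsSymmSeries 0 := fun _ _ => rfl

theorem isSymmSeries_one : IsSymmSeries 1 := evalPsum_one ▸ isSymmSeries_evalPsum 1

theorem IsSymmSeries.smul {f : Ser} (c : ℂ) (hf : IsSymmSeries f) : IsSymmSeries (c • f) :=
  fun σ d => by rw [coeff_smul, coeff_smul, hf σ]

theorem IsSymmSeries.neg {f : Ser} (hf : IsSymmSeries f) : IsSymmSeries (-f) :=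
  fun σ d => by rw [map_neg, map_neg, hf σ]

theorem IsSymmSeries.add {f g : Ser} (hf : IsSymmSeries f) (hg : IsSymmSeries g) :
    IsSymmSeries (f + g) :=
  fun σ d => by rw [map_add, map_add, hf σ, hg σ]

theorem IsSymmSeries.sub {f g : Ser} (hf : IsSymmSeries f) (hg : IsSymmSeries g) :
    IsSymmSeries (f - g) :=
  sub_eq_add_neg f g ▸ hf.add hg.neg

theorem psumPleth_psum (k : ℕ+) (j : ℕ) : psumPleth k (psum j) = psum (k * j) := by
  ext d
  obtain ⟨m, rfl⟩ | h := exists_eq_smul_or_coeff_expand_eq_zero (R := ℂ) k.ne_zero d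
  · rw [psumPleth, coeff_expand_smul, coeff_psum, coeff_psum]
    congr 1
    refine propext (exists_congr fun i => ?_)
    rw [← smul_eq_mul, ← Finsupp.smul_single, (smul_right_injective _ k.ne_zero).eq_iff]
  · rw [psumPleth, h, coeff_psum, if_neg]
    rintro ⟨i, rfl⟩
    have h1 := h (psum j)
    rw [← smul_eq_mul, ← Finsupp.smul_single, coeff_expand_smul, coeff_psum, if_pos ⟨i, rfl⟩] at h1
    exact one_ne_zero h1

theorem psumPleth_psumPleth (j k : ℕ+) (g : Ser) :
    psumPleth j (psumPleth k g) = psumPleth (j * k) g :=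
  (expand_mul _ j.ne_zero _ k.ne_zero g).symm

theorem constantCoeff_psumPleth (k : ℕ+) (g : Ser) :
    constantCoeff (psumPleth k g) = constantCoeff g :=
  constantCoeff_expand _ k.ne_zero g

theorem hasSubst_psumPleth {g : Ser} (hg : constantCoeff g = 0) :
    HasSubst fun k : ℕ+ => psumPleth k g :=
  hasSubst_expand hg

theorem psumPleth_subst (k : ℕ+) {σ : Type*} {a : σ → Ser} (ha : HasSubst a)
    (P : MvPowerSeries σ ℂ) : psumPleth k (subst a P) = subst (fun j => psumPleth k (a j)) P :=
  expand_subst _ k.ne_zero ha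

instance tendstoCofinite_mul (k : ℕ+) : Filter.TendstoCofinite (k * ·) :=
  Filter.tendstoCofinite_of_injective (mul_right_injective k)

theorem subst_rename_mul (k : ℕ+) {a : ℕ+ → Ser} (ha : HasSubst a) (P : MvPowerSeries ℕ+ ℂ) :
    subst a (rename (k * ·) P) = subst (fun j => a (k * j)) P := by
  rw [rename_eq_subst, subst_comp_subst_apply (HasSubst.X_comp _) ha]
  simp only [Function.comp_apply, subst_X ha]

theorem psumPleth_evalPsum (k : ℕ+) (P : MvPowerSeries ℕ+ ℂ) :
    psumPleth k (evalPsum P) = evalPsum (rename (k * ·) P) := by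
  rw [evalPsum, evalPsum, psumPleth_subst k hasSubst_psum, subst_rename_mul k hasSubst_psum]
  simp only [psumPleth_psum, PNat.mul_coe]

theorem IsSymmSeries.psumPleth {f : Ser} (hf : IsSymmSeries f) (k : ℕ+) :
    IsSymmSeries (psumPleth k f) := by
  obtain ⟨P, rfl⟩ := exists_evalPsum hf
  rw [psumPleth_evalPsum]
  exact isSymmSeries_evalPsum _

theorem pleth_evalPsum (P : MvPowerSeries ℕ+ ℂ) (g : Ser) :
    pleth (evalPsum P) g = subst (fun k : ℕ+ => psumPleth k g) P := by
  rw [pleth, psumExpr_evalPsum]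

section PlethAlgebra

variable {g : Ser} (hg : constantCoeff g = 0)
include hg

theorem pleth_one : pleth 1 g = 1 := by
  rw [← evalPsum_one, pleth_evalPsum, ← coe_substAlgHom (hasSubst_psumPleth hg), map_one,
    evalPsum_one]

variable {f f' : Ser} (hf : IsSymmSeries f) (hf' : IsSymmSeries f')
include hf

theorem pleth_smul (c : ℂ) : pleth (c • f) g = c • pleth f g := by
  obtain ⟨P, rfl⟩ := exists_evalPsum hf
  simp only [← evalPsum_smul, pleth_evalPsum, subst_smul (hasSubst_psumPleth hg)]

theorem pleth_neg : pleth (-f) g = -pleth f g := by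
  rw [← neg_one_smul ℂ f, pleth_smul hg hf, neg_one_smul]

include hf'

theorem pleth_add : pleth (f + f') g = pleth f g + pleth f' g := by
  obtain ⟨P, rfl⟩ := exists_evalPsum hf
  obtain ⟨Q, rfl⟩ := exists_evalPsum hf'
  simp only [← evalPsum_add, pleth_evalPsum, subst_add (hasSubst_psumPleth hg)]

theorem pleth_mul : pleth (f * f') g = pleth f g * pleth f' g := by
  obtain ⟨P, rfl⟩ := exists_evalPsum hf
  obtain ⟨Q, rfl⟩ := exists_evalPsum hf'
  simp only [← evalPsum_mul, pleth_evalPsum, subst_mul (hasSubst_psumPleth hg)]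

end PlethAlgebra

theorem pleth_psum {g : Ser} (hg : constantCoeff g = 0) (k : ℕ+) :
    pleth (psum k) g = psumPleth k g := by
  rw [← evalPsum_X, pleth_evalPsum, subst_X (hasSubst_psumPleth hg)]

theorem pleth_psum_one {f : Ser} (hf : IsSymmSeries f) : pleth f (psum 1) = f := by
  obtain ⟨P, rfl⟩ := exists_evalPsum hf
  rw [pleth_evalPsum, evalPsum]
  simp only [psumPleth_psum, mul_one]

theorem constantCoeff_pleth {f g : Ser} (hf : IsSymmSeries f) (hg : constantCoeff g = 0) :
    constantCoeff (pleth f g) = constantCoeff f := by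
  obtain ⟨P, rfl⟩ := exists_evalPsum hf
  rw [pleth_evalPsum, constantCoeff_evalPsum,
    constantCoeff_subst_of_constantCoeff_eq_zero (hasSubst_psumPleth hg)]
  exact fun k => (constantCoeff_psumPleth k g).trans hg

theorem pleth_psumPleth (k : ℕ+) {f g : Ser} (hf : IsSymmSeries f) (hg : constantCoeff g = 0) :
    pleth (psumPleth k f) g = psumPleth k (pleth f g) := by
  obtain ⟨P, rfl⟩ := exists_evalPsum hf
  rw [psumPleth_evalPsum, pleth_evalPsum, pleth_evalPsum, psumPleth_subst k (hasSubst_psumPleth hg),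
    subst_rename_mul k (hasSubst_psumPleth hg)]
  simp only [psumPleth_psumPleth]

theorem hasSubst_rename_mul {Q : MvPowerSeries ℕ+ ℂ} (hQ : constantCoeff Q = 0) :
    HasSubst fun k : ℕ+ => rename (k * ·) Q where
  const_coeff k := by
    rw [constantCoeff_rename, hQ]
    exact IsNilpotent.zero
  coeff_zero d := by
    obtain rfl | hd := eq_or_ne d 0
    · refine Set.finite_empty.subset fun k hk => hk ?_
      rw [coeff_zero_eq_constantCoeff_apply, constantCoeff_rename, hQ]
    · obtain ⟨i, hi⟩ := Finsupp.ne_iff.1 hd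
      refine (Set.finite_Iic i).subset fun k hk => Set.mem_Iic.2 <| not_lt.1 fun hik => hk ?_
      refine coeff_rename_eq_zero _ _ ?_
      rintro ⟨e, rfl⟩
      refine hi (Finsupp.mapDomain_of_notMem_range _ _ ?_)
      rintro ⟨s, rfl⟩
      exact not_le.2 hik (PNat.coe_le_coe _ _ |>.1 <| by
        simpa only [PNat.mul_coe] using Nat.le_mul_of_pos_right (k : ℕ) s.pos)

theorem pleth_eq_evalPsum (f : Ser) {Q : MvPowerSeries ℕ+ ℂ} (hQ : constantCoeff Q = 0) :
    pleth f (evalPsum Q) = evalPsum (subst (fun k : ℕ+ => rename (k * ·) Q) (psumExpr f)) := by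
  conv_rhs => rw [evalPsum, subst_comp_subst_apply (hasSubst_rename_mul hQ) hasSubst_psum]
  simp only [pleth, psumPleth_evalPsum]
  rfl

theorem isSymmSeries_pleth (f : Ser) {g : Ser} (hg : IsSymmSeries g) (hg0 : constantCoeff g = 0) :
    IsSymmSeries (pleth f g) := by
  obtain ⟨Q, rfl⟩ := exists_evalPsum hg
  rw [pleth_eq_evalPsum f (constantCoeff_evalPsum Q ▸ hg0)]
  exact isSymmSeries_evalPsum _

theorem pleth_assoc (f : Ser) {g h : Ser} (hg : IsSymmSeries g) (hg0 : constantCoeff g = 0)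
    (hh : constantCoeff h = 0) : pleth (pleth f g) h = pleth f (pleth g h) := by
  obtain ⟨Q, rfl⟩ := exists_evalPsum hg
  have hQ : constantCoeff Q = 0 := constantCoeff_evalPsum Q ▸ hg0
  rw [pleth_eq_evalPsum f hQ, pleth_evalPsum,
    subst_comp_subst_apply (hasSubst_rename_mul hQ) (hasSubst_psumPleth hh), pleth, pleth_evalPsum]
  simp only [← pleth_evalPsum, ← psumPleth_evalPsum, pleth_psumPleth _ hg hh]

theorem homogeneousComponent_evalPsum (n : ℕ) (P : MvPowerSeries ℕ+ ℂ) :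
    homogeneousComponent n (evalPsum P) =
      evalPsum (weightedHomogeneousComponent (fun k : ℕ+ => (k : ℕ)) n P) :=
  homogeneousComponent_subst hasSubst_psum (fun k => isHomogeneous_psum k) n P

theorem homogeneousComponent_pleth {f g : Ser} (hf : IsSymmSeries f) {i : ℕ} (hi : i ≠ 0)
    (hg : g.IsHomogeneous i) (n : ℕ) : homogeneousComponent n (pleth f g) =
      if i ∣ n then pleth (homogeneousComponent (n / i) f) g else 0 := by
  obtain ⟨P, rfl⟩ := exists_evalPsum hf
  have hs := hasSubst_psumPleth (constantCoeff_of_isHomogeneous hg hi)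
  rw [pleth_evalPsum, homogeneousComponent_evalPsum, pleth_evalPsum,
    homogeneousComponent_subst hs fun k : ℕ+ => isHomogeneous_expand k.ne_zero hg]
  have hweight (d : ℕ+ →₀ ℕ) : Finsupp.weight (fun k : ℕ+ => (k : ℕ) * i) d =
      i * Finsupp.weight (fun k : ℕ+ => (k : ℕ)) d := by
    simp only [Finsupp.weight_apply, Finsupp.sum, smul_eq_mul, Finset.mul_sum]
    exact Finset.sum_congr rfl fun k _ => by ring
  split_ifs with hn
  · congr 1
    ext d
    rw [coeff_weightedHomogeneousComponent, coeff_weightedHomogeneousComponent, hweight]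
    congr 1
    exact propext (by rw [Nat.eq_div_iff_mul_eq_left hi hn, mul_comm, eq_comm])
  · have hzero : weightedHomogeneousComponent (fun k : ℕ+ => (k : ℕ) * i) n P = 0 := by
      ext d
      rw [coeff_weightedHomogeneousComponent, hweight, if_neg fun h => hn ⟨_, h.symm⟩, map_zero]
    rw [hzero, ← coe_substAlgHom hs, map_zero]

theorem coeff_sumAll (q : ℕ → Ser) (d : ℕ →₀ ℕ) : coeff d (sumAll q) = coeff d (q d.degree) := rfl

theorem isSymmSeries_sumAll {q : ℕ → Ser} (hq : ∀ n, IsSymmSeries (q n)) :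
    IsSymmSeries (sumAll q) := fun σ d => by
  rw [coeff_sumAll, coeff_sumAll, Finsupp.degree_mapDomain, hq]

theorem homogeneousComponent_sumAll {q : ℕ → Ser} {n : ℕ} (hq : (q n).IsHomogeneous n) :
    homogeneousComponent n (sumAll q) = q n := by
  ext d
  rw [coeff_homogeneousComponent, coeff_sumAll]
  split_ifs with h
  · rw [h]
  · rw [IsHomogeneous.coeff_eq_zero hq h]

theorem coeff_sumPos (q : ℕ → Ser) {d : ℕ →₀ ℕ} (hd : d.degree ≠ 0) :
    coeff d (sumPos q) = coeff d (q d.degree) := by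
  rw [sumPos, coeff_sumAll, if_neg hd]

theorem homogeneousComponent_sumPos {q : ℕ → Ser} {n : ℕ} (hn : n ≠ 0)
    (hq : (q n).IsHomogeneous n) : homogeneousComponent n (sumPos q) = q n := by
  rw [sumPos, homogeneousComponent_sumAll] <;> rw [if_neg hn]
  exact hq

theorem constantCoeff_sumPos (q : ℕ → Ser) : constantCoeff (sumPos q) = 0 := by
  rw [← coeff_zero_eq_constantCoeff_apply, sumPos, coeff_sumAll, map_zero, if_pos rfl, map_zero]

theorem isSymmSeries_sumPos {q : ℕ → Ser} (hq : ∀ n, 1 ≤ n → IsSymmSeries (q n)) :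
    IsSymmSeries (sumPos q) := by
  refine isSymmSeries_sumAll fun n => ?_
  split_ifs with h
  · exact isSymmSeries_zero
  · exact hq n (Nat.one_le_iff_ne_zero.2 h)

/-! ### The series `H`, `E`, `H^±` and `E^±` -/

/-- The power sum combination `∑_{k ≥ 1} w_k p_k[g]`. -/
def psumPlethSum (w : ℕ+ → ℂ) (g : Ser) : Ser := subst (fun k => psumPleth k g) (linSeries w)

theorem evalPsum_linSeries (w : ℕ+ → ℂ) : evalPsum (linSeries w) = psumPlethSum w (psum 1) := by
  simp only [evalPsum, psumPlethSum, psumPleth_psum, mul_one]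

theorem coeff_psumPlethSum (w : ℕ+ → ℂ) {g : Ser} (hg : constantCoeff g = 0) (e : ℕ →₀ ℕ) :
    coeff e (psumPlethSum w g) = ∑ᶠ k, w k * coeff e (psumPleth k g) :=
  coeff_subst_linSeries (hasSubst_psumPleth hg) w e

theorem constantCoeff_psumPlethSum (w : ℕ+ → ℂ) {g : Ser} (hg : constantCoeff g = 0) :
    constantCoeff (psumPlethSum w g) = 0 := by
  rw [psumPlethSum, constantCoeff_subst_of_constantCoeff_eq_zero (hasSubst_psumPleth hg),
    constantCoeff_linSeries]
  exact fun k => (constantCoeff_psumPleth k g).trans hg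

theorem psumPlethSum_add (w : ℕ+ → ℂ) {f g : Ser} (hf : constantCoeff f = 0)
    (hg : constantCoeff g = 0) :
    psumPlethSum w (f + g) = psumPlethSum w f + psumPlethSum w g := by
  have hfg : constantCoeff (f + g) = 0 := by rw [map_add, hf, hg, add_zero]
  have hfinite {g : Ser} (hg : constantCoeff g = 0) (e : ℕ →₀ ℕ) :
      (Function.support fun k : ℕ+ => w k * coeff e (psumPleth k g)).Finite :=
    ((hasSubst_psumPleth hg).coeff_zero e).subset fun _ hk => right_ne_zero_of_mul hk
  ext e
  rw [map_add, coeff_psumPlethSum w hfg, coeff_psumPlethSum w hf, coeff_psumPlethSum w hg,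
    ← finsum_add_distrib (hfinite hf e) (hfinite hg e)]
  refine finsum_congr fun k => ?_
  rw [psumPleth, map_add, map_add, mul_add]
  rfl

theorem euler_psumPlethSum {g : Ser} (hg : constantCoeff g = 0) :
    euler (psumPlethSum (fun k => ((k : ℕ) : ℂ)⁻¹) g) = psumPlethSum 1 (euler g) := by
  ext e
  rw [coeff_euler, coeff_psumPlethSum _ hg, coeff_psumPlethSum _ (constantCoeff_euler g),
    ← smul_eq_mul, smul_finsum]
  refine finsum_congr fun k => ?_
  have h : e.degree * coeff e (psumPleth k g) = k * coeff e (psumPleth k (euler g)) :=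
    congrArg (coeff e) (euler_expand k.ne_zero g)
  rw [smul_eq_mul, mul_left_comm, h, Pi.one_apply, one_mul,
    inv_mul_cancel_left₀ (Nat.cast_ne_zero.2 k.ne_zero)]

theorem coeff_hsymm (n : ℕ) (d : ℕ →₀ ℕ) : coeff d (hsymm n) = if d.degree = n then 1 else 0 := rfl

theorem coeff_esymm (n : ℕ) (d : ℕ →₀ ℕ) : coeff d (esymm n) =
    open Classical in if d.degree = n ∧ ∀ i, d i ≤ 1 then 1 else 0 := rfl

theorem isHomogeneous_hsymm (n : ℕ) : (hsymm n).IsHomogeneous n := by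
  intro d hd
  refine (DFunLike.congr_fun Finsupp.degree_eq_weight_one d).symm.trans ?_
  exact not_not.1 fun h => hd (if_neg h)

theorem isHomogeneous_esymm (n : ℕ) : (esymm n).IsHomogeneous n := by
  intro d hd
  refine (DFunLike.congr_fun Finsupp.degree_eq_weight_one d).symm.trans ?_
  exact not_not.1 fun h => hd (if_neg fun h' => h h'.1)

theorem isSymmSeries_hsymm (n : ℕ) : IsSymmSeries (hsymm n) := fun σ d => by
  rw [coeff_hsymm, coeff_hsymm, Finsupp.degree_mapDomain]

theorem isSymmSeries_esymm (n : ℕ) : IsSymmSeries (esymm n) := fun σ d => by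
  have h : (∀ i, d.mapDomain σ i ≤ 1) ↔ ∀ i, d i ≤ 1 := by
    rw [← σ.forall_congr_right]
    simp only [Finsupp.mapDomain_apply σ.injective]
  rw [coeff_esymm, coeff_esymm, Finsupp.degree_mapDomain, h]

theorem isSymmSeries_hSeries : IsSymmSeries hSeries := isSymmSeries_sumAll isSymmSeries_hsymm

theorem isSymmSeries_eSeries : IsSymmSeries eSeries := isSymmSeries_sumAll isSymmSeries_esymm

theorem isSymmSeries_hpmSeries : IsSymmSeries hpmSeries :=
  isSymmSeries_sumAll fun n => (isSymmSeries_hsymm n).smul _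

theorem coeff_hSeries (d : ℕ →₀ ℕ) : coeff d hSeries = 1 := if_pos rfl

theorem coeff_eSeries (d : ℕ →₀ ℕ) : coeff d eSeries =
    open Classical in if ∀ i, d i ≤ 1 then 1 else 0 := by
  rw [eSeries, coeff_sumAll, coeff_esymm]
  congr 1
  exact propext (and_iff_right rfl)

theorem constantCoeff_hSeries : constantCoeff hSeries = 1 := coeff_hSeries 0

theorem hpmSeries_eq_rescale : hpmSeries = rescale (fun _ => -1) hSeries := by
  ext d
  rw [hpmSeries, coeff_sumAll, coeff_smul, coeff_rescale_const, coeff_hsymm, if_pos rfl,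
    coeff_hSeries]

/-- The alternating series `E^± = ∑_{r ≥ 0} (-1)^r e_r`. -/
def epmSeries : Ser := sumAll fun r => (-1 : ℂ) ^ r • esymm r

theorem isSymmSeries_epmSeries : IsSymmSeries epmSeries :=
  isSymmSeries_sumAll fun n => (isSymmSeries_esymm n).smul _

theorem epmSeries_eq_rescale : epmSeries = rescale (fun _ => -1) eSeries := by
  ext d
  rw [epmSeries, coeff_sumAll, coeff_smul, coeff_rescale_const, eSeries, coeff_sumAll]

/-- The series `∑_{k ≥ 1} p_k`, the logarithmic derivative of `H`. -/
def psumSeries : Ser := psumPlethSum 1 (psum 1)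

theorem constantCoeff_psumSeries : constantCoeff psumSeries = 0 :=
  constantCoeff_psumPlethSum 1 (constantCoeff_psum one_ne_zero)

theorem coeff_psumSeries (d : ℕ →₀ ℕ) :
    coeff d psumSeries = if d.support.card = 1 then 1 else 0 := by
  rw [psumSeries, coeff_psumPlethSum 1 (constantCoeff_psum one_ne_zero)]
  simp only [Pi.one_apply, one_mul, psumPleth_psum, mul_one]
  split_ifs with h
  · obtain ⟨i, k, hk, rfl⟩ := Finsupp.card_support_eq_one'.1 h
    rw [finsum_eq_single _ (Nat.toPNat k (Nat.pos_of_ne_zero hk))]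
    · rw [coeff_psum]
      exact if_pos ⟨i, rfl⟩
    · intro j hj
      rw [IsHomogeneous.coeff_eq_zero (isHomogeneous_psum j)]
      rw [Finsupp.degree_single]
      exact fun h => hj (PNat.coe_injective h.symm)
  · refine finsum_eq_zero_of_forall_eq_zero fun k => ?_
    rw [coeff_psum, if_neg]
    exact fun ⟨i, hi⟩ => h (Finsupp.card_support_eq_one'.2 ⟨i, k, k.ne_zero, hi⟩)

theorem card_filter_antidiagonal_card_support_eq_one (d : ℕ →₀ ℕ) :
    {p ∈ Finset.HasAntidiagonal.antidiagonal d | p.1.support.card = 1}.card = d.degree := by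
  have hcard : d.degree = (d.support.sigma fun i => Finset.Icc 1 (d i)).card := by
    simp only [Finset.card_sigma, Nat.card_Icc, Nat.add_sub_cancel, Finsupp.degree_apply]
  rw [hcard, eq_comm]
  refine Finset.card_bij (fun x _ => (Finsupp.single x.1 x.2, d - Finsupp.single x.1 x.2))
    ?_ ?_ ?_
  · rintro ⟨i, k⟩ hx
    obtain ⟨-, hk, hki⟩ : _ ∧ 1 ≤ k ∧ k ≤ d i := by simpa using hx
    simp only [Finset.mem_filter, Finset.HasAntidiagonal.mem_antidiagonal]
    exact ⟨add_tsub_cancel_of_le (Finsupp.single_le_iff.2 hki),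
      Finsupp.card_support_eq_one'.2 ⟨i, k, Nat.one_le_iff_ne_zero.1 hk, rfl⟩⟩
  · rintro ⟨i, k⟩ hx ⟨j, l⟩ - h
    obtain ⟨-, hk, -⟩ : _ ∧ 1 ≤ k ∧ k ≤ d i := by simpa using hx
    obtain ⟨rfl, rfl⟩ | ⟨rfl, -⟩ := (Finsupp.single_eq_single_iff _ _ _ _).1 (Prod.ext_iff.1 h).1
    · rfl
    · exact absurd hk (by decide)
  · rintro ⟨a, b⟩ hab
    simp only [Finset.mem_filter, Finset.HasAntidiagonal.mem_antidiagonal] at hab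
    obtain ⟨rfl, ha⟩ := hab
    obtain ⟨i, k, hk, rfl⟩ := Finsupp.card_support_eq_one'.1 ha
    refine ⟨⟨i, k⟩, ?_, by simp⟩
    simp only [Finset.mem_sigma, Finset.mem_Icc, Finsupp.mem_support_iff, Finsupp.add_apply,
      Finsupp.single_eq_same]
    omega

theorem euler_hSeries : euler hSeries = psumSeries * hSeries := by
  ext d
  rw [coeff_euler, coeff_mul]
  simp only [coeff_hSeries, mul_one, coeff_psumSeries]
  rw [Finset.sum_boole, card_filter_antidiagonal_card_support_eq_one]

theorem hSeries_eq_evalPsum :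
    hSeries = evalPsum (expSeries (linSeries fun k => ((k : ℕ) : ℂ)⁻¹)) := by
  have hp := constantCoeff_psum one_ne_zero
  have h0 := constantCoeff_psumPlethSum (fun k => ((k : ℕ) : ℂ)⁻¹) hp
  rw [evalPsum, subst_expSeries hasSubst_psum (constantCoeff_linSeries _), ← evalPsum,
    evalPsum_linSeries]
  refine eq_of_euler_eq_mul constantCoeff_psumSeries euler_hSeries ?_ ?_
  · rw [euler_expSeries h0, euler_psumPlethSum hp, euler_of_isHomogeneous (isHomogeneous_psum 1),
      Nat.cast_one, one_smul, psumSeries]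
  · rw [constantCoeff_expSeries h0, constantCoeff_hSeries]

theorem pleth_hSeries {g : Ser} (hg : constantCoeff g = 0) :
    pleth hSeries g = expSeries (psumPlethSum (fun k => ((k : ℕ) : ℂ)⁻¹) g) := by
  rw [hSeries_eq_evalPsum, pleth_evalPsum,
    subst_expSeries (hasSubst_psumPleth hg) (constantCoeff_linSeries _), psumPlethSum]

theorem constantCoeff_pleth_hSeries {g : Ser} (hg : constantCoeff g = 0) :
    constantCoeff (pleth hSeries g) = 1 := by
  rw [pleth_hSeries hg, constantCoeff_expSeries (constantCoeff_psumPlethSum _ hg)]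

theorem euler_pleth_hSeries {g : Ser} (hg : constantCoeff g = 0) :
    euler (pleth hSeries g) = psumPlethSum 1 (euler g) * pleth hSeries g := by
  rw [pleth_hSeries hg, euler_expSeries (constantCoeff_psumPlethSum _ hg), euler_psumPlethSum hg]

theorem pleth_hSeries_add {f g : Ser} (hf : constantCoeff f = 0) (hg : constantCoeff g = 0) :
    pleth hSeries (f + g) = pleth hSeries f * pleth hSeries g := by
  have hfg : constantCoeff (f + g) = 0 := by rw [map_add, hf, hg, add_zero]
  rw [pleth_hSeries hf, pleth_hSeries hg, pleth_hSeries hfg, psumPlethSum_add _ hf hg,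
    expSeries_add (constantCoeff_psumPlethSum _ hf) (constantCoeff_psumPlethSum _ hg)]

theorem psumSeries_add_rescale :
    psumSeries + rescale (fun _ => -1) psumSeries = (2 : ℂ) • psumPleth 2 psumSeries := by
  ext d
  rw [map_add, coeff_rescale_const, coeff_smul]
  obtain ⟨m, rfl⟩ | h := exists_eq_smul_or_coeff_expand_eq_zero (R := ℂ) two_ne_zero d
  · have hm : coeff (2 • m) (psumPleth 2 psumSeries) = coeff m psumSeries :=
      coeff_expand_smul 2 two_ne_zero psumSeries m
    rw [hm, coeff_psumSeries, coeff_psumSeries, Finsupp.support_smul_eq two_ne_zero, map_nsmul,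
      smul_eq_mul, pow_mul, neg_one_sq, one_pow, one_mul, two_mul]
  · have hodd : coeff d psumSeries ≠ 0 → Odd d.degree := fun hd => by
      rw [coeff_psumSeries, ite_ne_right_iff] at hd
      obtain ⟨i, k, -, rfl⟩ := Finsupp.card_support_eq_one'.1 hd.1
      rw [Finsupp.degree_single, ← Nat.not_even_iff_odd, even_iff_exists_two_mul]
      rintro ⟨l, rfl⟩
      have hl := h hSeries
      rw [← smul_eq_mul, ← Finsupp.smul_single, coeff_expand_smul, coeff_hSeries] at hl
      exact one_ne_zero hl
    have hp : coeff d (psumPleth 2 psumSeries) = 0 := h psumSeries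
    rw [hp, mul_zero]
    by_cases hd : coeff d psumSeries = 0
    · rw [hd, mul_zero, add_zero]
    · rw [(hodd hd).neg_one_pow, neg_one_mul, add_neg_cancel]

theorem hSeries_mul_hpmSeries : hSeries * hpmSeries = psumPleth 2 hSeries := by
  refine eq_of_euler_eq_mul (N := (2 : ℂ) • psumPleth 2 psumSeries) ?_ ?_ ?_ ?_
  · rw [constantCoeff_smul, constantCoeff_psumPleth, constantCoeff_psumSeries, smul_zero]
  · rw [Derivation.leibniz, hpmSeries_eq_rescale, euler_rescale, euler_hSeries, map_mul,
      ← psumSeries_add_rescale, smul_eq_mul, smul_eq_mul]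
    ring
  · have h : euler (psumPleth 2 hSeries) = (2 : ℂ) • psumPleth 2 (euler hSeries) :=
      euler_expand two_ne_zero hSeries
    rw [h, euler_hSeries, psumPleth, map_mul, smul_mul_assoc]
    rfl
  · rw [map_mul, constantCoeff_psumPleth, constantCoeff_hSeries, one_mul, hpmSeries_eq_rescale,
      ← coeff_zero_eq_constantCoeff_apply, coeff_rescale_const, map_zero, pow_zero, one_mul,
      coeff_hSeries]

theorem coeff_epmSeries_indicator (s : Finset ℕ) :
    coeff (Finsupp.indicator s fun _ _ => 1) epmSeries = (-1) ^ s.card := by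
  have hle : ∀ i, (Finsupp.indicator s fun _ _ => 1 : ℕ →₀ ℕ) i ≤ 1 := fun i => by
    rw [Finsupp.indicator_apply]
    split_ifs <;> simp
  have hdegree : (Finsupp.indicator s fun _ _ => 1 : ℕ →₀ ℕ).degree = s.card := by
    rw [Finsupp.degree_apply, Finset.card_eq_sum_ones]
    refine Finset.sum_congr ?_ fun i hi => ?_
    · ext i
      simp [Finsupp.indicator_apply]
    · rw [Finsupp.indicator_of_mem hi]
  rw [epmSeries_eq_rescale, coeff_rescale_const, coeff_eSeries, if_pos hle, hdegree, mul_one]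

theorem indicator_one_le {s : Finset ℕ} {d : ℕ →₀ ℕ} (hs : s ⊆ d.support) :
    (Finsupp.indicator s fun _ _ => 1) ≤ d := fun i => by
  rw [Finsupp.indicator_apply]
  split_ifs with hi
  · exact Nat.one_le_iff_ne_zero.2 (Finsupp.mem_support_iff.1 (hs hi))
  · exact Nat.zero_le _

theorem indicator_support_one {d : ℕ →₀ ℕ} (hd : ∀ i, d i ≤ 1) :
    (Finsupp.indicator d.support fun _ _ => 1) = d := by
  ext i
  have hi := hd i
  simp only [Finsupp.indicator_apply, Finsupp.mem_support_iff]
  split_ifs <;> omega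

theorem epmSeries_mul_hSeries : epmSeries * hSeries = 1 := by
  classical
  ext d
  calc coeff d (epmSeries * hSeries)
      = ∑ p ∈ Finset.HasAntidiagonal.antidiagonal d, coeff p.1 epmSeries := by
        simp only [coeff_mul, coeff_hSeries, mul_one]
    _ = ∑ s ∈ d.support.powerset, (-1) ^ s.card := by
        refine (Finset.sum_of_injOn
          (fun s => (Finsupp.indicator s fun _ _ => 1, d - Finsupp.indicator s fun _ _ => 1))
          ?_ ?_ ?_ fun s _ => (coeff_epmSeries_indicator s).symm).symm
        · intro s _ t _ h
          ext i
          have hi := DFunLike.congr_fun (Prod.ext_iff.1 h).1 i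
          simp only [Finsupp.indicator_apply] at hi
          split_ifs at hi <;> simp_all
        · intro s hs
          exact Finset.HasAntidiagonal.mem_antidiagonal.2
            (add_tsub_cancel_of_le (indicator_one_le (Finset.mem_powerset.1 hs)))
        · rintro ⟨a, b⟩ hab hne
          obtain rfl : a + b = d := Finset.HasAntidiagonal.mem_antidiagonal.1 hab
          rw [epmSeries_eq_rescale, coeff_rescale_const, coeff_eSeries, if_neg, mul_zero]
          intro ha
          have hind := indicator_support_one ha
          refine hne ⟨a.support, ?_, Prod.ext hind ?_⟩
          · exact Finset.mem_coe.2 (Finset.mem_powerset.2 (Finsupp.support_mono le_self_add))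
          · simp only [hind, add_tsub_cancel_left]
    _ = coeff d 1 := by
        have h := congrArg (Int.cast (R := ℂ))
          (Finset.sum_powerset_neg_one_pow_card (x := d.support))
        push_cast at h
        rw [h, coeff_one]
        simp only [Finsupp.support_eq_empty]

theorem eSeries_mul_hpmSeries : eSeries * hpmSeries = 1 := by
  have h := congrArg (rescale fun _ => (-1 : ℂ)) epmSeries_mul_hSeries
  have hinvol : ((fun _ => -1) * fun _ => -1 : ℕ → ℂ) = 1 :=
    funext fun _ => (neg_one_mul _).trans (neg_neg 1)
  rwa [map_mul, map_one, ← hpmSeries_eq_rescale, epmSeries_eq_rescale, rescale_rescale, hinvol,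
    rescale_one, RingHom.id_apply] at h

theorem eSeries_mul_psumPleth_hSeries : eSeries * psumPleth 2 hSeries = hSeries := by
  rw [← hSeries_mul_hpmSeries, mul_left_comm, eSeries_mul_hpmSeries, mul_one]

/-! ### Plethysm by `H`, `E`, `H^±` and `E^±` -/

theorem pleth_hSeries_zero : pleth hSeries 0 = 1 := by
  have h0 : constantCoeff (0 : Ser) = 0 := map_zero _
  have hne : pleth hSeries 0 ≠ 0 := fun h => by
    have hone := constantCoeff_pleth_hSeries h0
    rw [h, map_zero] at hone
    exact zero_ne_one hone
  have hadd := pleth_hSeries_add h0 h0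
  rwa [add_zero, left_eq_mul₀ hne] at hadd

theorem pleth_hSeries_neg {g : Ser} (hg : constantCoeff g = 0) :
    pleth hSeries (-g) * pleth hSeries g = 1 := by
  rw [← pleth_hSeries_add (by rw [map_neg, hg, neg_zero]) hg, neg_add_cancel, pleth_hSeries_zero]

theorem pleth_hSeries_ne_zero {g : Ser} (hg : constantCoeff g = 0) : pleth hSeries g ≠ 0 :=
  right_ne_zero_of_mul_eq_one (pleth_hSeries_neg hg)

theorem pleth_eSeries_mul {g : Ser} (hg : constantCoeff g = 0) :
    pleth eSeries g * psumPleth 2 (pleth hSeries g) = pleth hSeries g := by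
  rw [← pleth_psumPleth 2 isSymmSeries_hSeries hg, ← pleth_mul hg isSymmSeries_eSeries
    (isSymmSeries_hSeries.psumPleth 2), eSeries_mul_psumPleth_hSeries]

theorem pleth_eSeries_mul_hpm {g : Ser} (hg : constantCoeff g = 0) :
    pleth eSeries g * pleth hpmSeries g = 1 := by
  rw [← pleth_mul hg isSymmSeries_eSeries isSymmSeries_hpmSeries, eSeries_mul_hpmSeries,
    pleth_one hg]

theorem pleth_epmSeries_mul {g : Ser} (hg : constantCoeff g = 0) :
    pleth epmSeries g * pleth hSeries g = 1 := by
  rw [← pleth_mul hg isSymmSeries_epmSeries isSymmSeries_hSeries, epmSeries_mul_hSeries,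
    pleth_one hg]

theorem pleth_eSeries_zero : pleth eSeries 0 = 1 := by
  have h := pleth_eSeries_mul (map_zero (constantCoeff (σ := ℕ) (R := ℂ)))
  rwa [pleth_hSeries_zero, psumPleth, map_one, mul_one] at h

section Add

variable {f g : Ser} (hf : constantCoeff f = 0) (hg : constantCoeff g = 0)
include hf hg

theorem pleth_epmSeries_add :
    pleth epmSeries (f + g) = pleth epmSeries f * pleth epmSeries g := by
  have hfg : constantCoeff (f + g) = 0 := by rw [map_add, hf, hg, add_zero]
  apply mul_right_cancel₀ (pleth_hSeries_ne_zero hfg)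
  rw [pleth_epmSeries_mul hfg, pleth_hSeries_add hf hg, mul_mul_mul_comm, pleth_epmSeries_mul hf,
    pleth_epmSeries_mul hg, one_mul]

theorem pleth_eSeries_add : pleth eSeries (f + g) = pleth eSeries f * pleth eSeries g := by
  have hfg : constantCoeff (f + g) = 0 := by rw [map_add, hf, hg, add_zero]
  have hne : psumPleth 2 (pleth hSeries (f + g)) ≠ 0 :=
    (map_ne_zero_iff _ (expand_injective two_ne_zero)).2 (pleth_hSeries_ne_zero hfg)
  apply mul_right_cancel₀ hne
  have hmul : psumPleth 2 (pleth hSeries f * pleth hSeries g) =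
    psumPleth 2 (pleth hSeries f) * psumPleth 2 (pleth hSeries g) := map_mul _ _ _
  rw [pleth_eSeries_mul hfg, pleth_hSeries_add hf hg, hmul, mul_mul_mul_comm,
    pleth_eSeries_mul hf, pleth_eSeries_mul hg]

theorem pleth_hpmSeries_add :
    pleth hpmSeries (f + g) = pleth hpmSeries f * pleth hpmSeries g := by
  have hfg : constantCoeff (f + g) = 0 := by rw [map_add, hf, hg, add_zero]
  apply mul_left_cancel₀ (left_ne_zero_of_mul_eq_one (pleth_eSeries_mul_hpm hfg))
  rw [pleth_eSeries_mul_hpm hfg, pleth_eSeries_add hf hg, mul_mul_mul_comm,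
    pleth_eSeries_mul_hpm hf, pleth_eSeries_mul_hpm hg, one_mul]

end Add

theorem eq_of_mul_psumPleth_eq {k : ℕ+} (hk : 1 < (k : ℕ)) {U U' V : Ser}
    (h0 : constantCoeff U = 1) (h0' : constantCoeff U' = 1) (h : V * psumPleth k U = U)
    (h' : V * psumPleth k U' = U') : U = U' := by
  have hU : U' * U'⁻¹ = 1 := MvPowerSeries.mul_inv_cancel _ (h0' ▸ one_ne_zero)
  have hexpand : psumPleth k U' * psumPleth k U'⁻¹ = 1 := by
    simp only [psumPleth, ← map_mul, hU, map_one]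
  have hquot : psumPleth k (U * U'⁻¹) = U * U'⁻¹ := by
    apply mul_right_cancel₀ (left_ne_zero_of_mul_eq_one hU)
    apply mul_right_cancel₀ (left_ne_zero_of_mul_eq_one hexpand)
    have hmul : psumPleth k (U * U'⁻¹) = psumPleth k U * psumPleth k U'⁻¹ := map_mul _ _ _
    rw [hmul]
    linear_combination (psumPleth k U * U') * hexpand - psumPleth k U * h' + psumPleth k U' * h
      - U * psumPleth k U' * hU
  have hone := eq_C_of_expand_eq hk hquot
  rw [map_mul, h0, one_mul, MvPowerSeries.constantCoeff_inv, h0', inv_one, map_one] at hone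
  calc U = U * U'⁻¹ * U' := by rw [mul_assoc, mul_comm _ U', hU, mul_one]
    _ = U' := by rw [hone, one_mul]

theorem eq_zero_of_psumPlethSum_eq_zero {g : Ser} (hg : constantCoeff g = 0)
    (h : psumPlethSum 1 g = 0) : g = 0 := by
  ext d
  rw [map_zero]
  induction hm : d.degree using Nat.strong_induction_on generalizing d with
  | _ m ih =>
    obtain rfl | hd := eq_or_ne d 0
    · rwa [coeff_zero_eq_constantCoeff_apply]
    have hcoeff := congrArg (coeff d) h
    rw [coeff_psumPlethSum 1 hg, map_zero, finsum_eq_single _ 1] at hcoeff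
    · rw [Pi.one_apply, one_mul] at hcoeff
      exact (congrArg (coeff d) (expand_one_apply g)).symm.trans hcoeff
    intro k hk
    obtain ⟨e, rfl⟩ | hzero := exists_eq_smul_or_coeff_expand_eq_zero (R := ℂ) k.ne_zero d
    · have he : e.degree ≠ 0 := (Finsupp.degree_eq_zero_iff e).not.2 (right_ne_zero_of_smul hd)
      have hk1 : 1 < (k : ℕ) := PNat.coe_lt_coe 1 k |>.2 (lt_of_le_of_ne one_le hk.symm)
      have hlt : e.degree < m := by
        rw [← hm, map_nsmul, smul_eq_mul]
        exact lt_mul_of_one_lt_left (Nat.pos_of_ne_zero he) hk1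
      rw [psumPleth, coeff_expand_smul, ih _ hlt e rfl, mul_zero]
    · rw [psumPleth, hzero, mul_zero]

theorem eq_zero_of_pleth_hSeries_eq_one {g : Ser} (hg : constantCoeff g = 0)
    (h : pleth hSeries g = 1) : g = 0 := by
  have heuler := euler_pleth_hSeries hg
  rw [h, Derivation.map_one_eq_zero, mul_one] at heuler
  have hg' := eq_zero_of_psumPlethSum_eq_zero (constantCoeff_euler g) heuler.symm
  exact eq_zero_of_euler_eq_mul (map_zero _) (hg'.trans (zero_mul g).symm) hg

theorem pleth_eSeries_injective {f g : Ser} (hf : constantCoeff f = 0)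
    (hg : constantCoeff g = 0) (h : pleth eSeries f = pleth eSeries g) : f = g := by
  have hfg : constantCoeff (f - g) = 0 := by rw [map_sub, hf, hg, sub_zero]
  have hadd := pleth_eSeries_add hfg hg
  rw [sub_add_cancel, h, right_eq_mul₀ (left_ne_zero_of_mul_eq_one (pleth_eSeries_mul_hpm hg))]
    at hadd
  have hexpand := pleth_eSeries_mul hfg
  rw [hadd, one_mul] at hexpand
  have hconst := eq_C_of_expand_eq one_lt_two hexpand
  rw [constantCoeff_pleth_hSeries hfg, map_one] at hconst
  exact sub_eq_zero.1 (eq_zero_of_pleth_hSeries_eq_one hfg hconst)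

/-! ### The involution `p_k ↦ -p_k` -/

/-- The involution `p_k ↦ -p_k`, which is `(-1)^n ω` in degree `n`. -/
def psumNeg (f : Ser) : Ser := pleth f (-psum 1)

theorem constantCoeff_neg_psum_one : constantCoeff (-psum 1) = 0 := by
  rw [map_neg, constantCoeff_psum one_ne_zero, neg_zero]

theorem isHomogeneous_neg_psum_one : (-psum 1).IsHomogeneous 1 :=
  isHomogeneous_neg (isHomogeneous_psum 1)

theorem isSymmSeries_psumNeg (f : Ser) : IsSymmSeries (psumNeg f) :=
  isSymmSeries_pleth f (isSymmSeries_psum 1).neg constantCoeff_neg_psum_one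

theorem psumNeg_mul {f g : Ser} (hf : IsSymmSeries f) (hg : IsSymmSeries g) :
    psumNeg (f * g) = psumNeg f * psumNeg g := pleth_mul constantCoeff_neg_psum_one hf hg

theorem psumNeg_add {f g : Ser} (hf : IsSymmSeries f) (hg : IsSymmSeries g) :
    psumNeg (f + g) = psumNeg f + psumNeg g := pleth_add constantCoeff_neg_psum_one hf hg

theorem psumNeg_zero : psumNeg 0 = 0 := by
  have h := pleth_smul constantCoeff_neg_psum_one isSymmSeries_zero 0
  rwa [zero_smul, zero_smul] at h

theorem psumNeg_one : psumNeg 1 = 1 := pleth_one constantCoeff_neg_psum_one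

theorem psumPleth_neg_psum_one (k : ℕ+) : psumPleth k (-psum 1) = -psum k := by
  have h : psumPleth k (-psum 1) = -psumPleth k (psum 1) := map_neg _ _
  rw [h, psumPleth_psum, mul_one]

theorem psumNeg_psum (k : ℕ+) : psumNeg (psum k) = -psum k := by
  rw [psumNeg, pleth_psum constantCoeff_neg_psum_one, psumPleth_neg_psum_one]

theorem psumNeg_psumNeg {f : Ser} (hf : IsSymmSeries f) : psumNeg (psumNeg f) = f := by
  have h : pleth (psum 1) (-psum 1) = -psum 1 := psumNeg_psum 1
  rw [psumNeg, psumNeg, pleth_assoc f (isSymmSeries_psum 1).neg constantCoeff_neg_psum_one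
    constantCoeff_neg_psum_one, pleth_neg constantCoeff_neg_psum_one (isSymmSeries_psum 1), h,
    neg_neg, pleth_psum_one hf]

theorem homogeneousComponent_psumNeg {f : Ser} (hf : IsSymmSeries f) (n : ℕ) :
    homogeneousComponent n (psumNeg f) = psumNeg (homogeneousComponent n f) := by
  rw [psumNeg, homogeneousComponent_pleth hf one_ne_zero isHomogeneous_neg_psum_one,
    if_pos (one_dvd n), Nat.div_one, psumNeg]

theorem constantCoeff_psumNeg {f : Ser} (hf : IsSymmSeries f) :
    constantCoeff (psumNeg f) = constantCoeff f :=
  constantCoeff_pleth hf constantCoeff_neg_psum_one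

theorem psumNeg_pleth (f : Ser) {g : Ser} (hg : IsSymmSeries g) (hg0 : constantCoeff g = 0) :
    psumNeg (pleth f g) = pleth f (psumNeg g) :=
  pleth_assoc f hg hg0 constantCoeff_neg_psum_one

theorem omega_eq_rescale_psumNeg (f : Ser) : omega f = rescale (fun _ => -1) (psumNeg f) := by
  have hrescale (k : ℕ+) : rescale (fun _ => (-1 : ℂ)) (psumPleth k (-psum 1)) =
      (-1 : ℂ) ^ ((k : ℕ) - 1) • psum k := by
    rw [psumPleth_neg_psum_one, map_neg, rescale_const_of_isHomogeneous _ (isHomogeneous_psum k),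
      ← neg_smul, ← pow_sub_one_mul k.ne_zero, mul_neg_one, neg_neg]
  rw [psumNeg, pleth, rescale_eq_subst, subst_comp_subst_apply
    (hasSubst_psumPleth constantCoeff_neg_psum_one) (HasSubst.smul_X _), omega]
  simp only [← rescale_eq_subst, hrescale]

theorem isHomogeneous_psumNeg {f : Ser} (hf : IsSymmSeries f) {n : ℕ} (h : f.IsHomogeneous n) :
    (psumNeg f).IsHomogeneous n := by
  rw [isHomogeneous_iff_eq_homogeneousComponent, homogeneousComponent_psumNeg hf,
    homogeneousComponent_of_isHomogeneous h, if_pos rfl]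

theorem omega_of_isHomogeneous {f : Ser} (hf : IsSymmSeries f) {n : ℕ} (h : f.IsHomogeneous n) :
    omega f = (-1 : ℂ) ^ n • psumNeg f := by
  rw [omega_eq_rescale_psumNeg,
    rescale_const_of_isHomogeneous _ (isHomogeneous_psumNeg hf h)]

theorem altOmega_of_isHomogeneous {q : ℕ → Ser} {n : ℕ} (hn : n ≠ 0) (hf : IsSymmSeries (q n))
    (h : (q n).IsHomogeneous n) : altOmega q n = -psumNeg (q n) := by
  rw [altOmega, omega_of_isHomogeneous hf h, smul_smul, ← neg_one_smul ℂ (psumNeg (q n)),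
    ← pow_sub_one_mul hn, ← mul_assoc, ← mul_pow, neg_one_mul, neg_neg, one_pow, one_mul]

/-! ### Graded sequences -/

/-- A sequence `(q n)` for `n ≥ 1` of symmetric functions, with `q n` homogeneous of degree `n`;
nothing is required of `q 0`. -/
def IsGraded (q : ℕ → Ser) : Prop := ∀ n, 1 ≤ n → IsSymmSeries (q n) ∧ (q n).IsHomogeneous n

theorem IsGraded.altOmega {q : ℕ → Ser} (hq : IsGraded q) : IsGraded (altOmega q) := by
  intro n hn
  obtain ⟨hsymm, hhom⟩ := hq n hn
  rw [altOmega_of_isHomogeneous (Nat.one_le_iff_ne_zero.1 hn) hsymm hhom]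
  exact ⟨(isSymmSeries_psumNeg _).neg, isHomogeneous_neg (isHomogeneous_psumNeg hsymm hhom)⟩

theorem IsGraded.constantCoeff {q : ℕ → Ser} (hq : IsGraded q) {n : ℕ} (hn : n ≠ 0) :
    constantCoeff (q n) = 0 :=
  constantCoeff_of_isHomogeneous (hq n (Nat.one_le_iff_ne_zero.2 hn)).2 hn

theorem IsGraded.isSymmSeries_sumPos {q : ℕ → Ser} (hq : IsGraded q) :
    IsSymmSeries (sumPos q) :=
  PlethLie.isSymmSeries_sumPos fun n hn => (hq n hn).1

theorem IsGraded.homogeneousComponent_sumPos {q : ℕ → Ser} (hq : IsGraded q) (n : ℕ) :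
    homogeneousComponent n (sumPos q) = if n = 0 then 0 else q n := by
  split_ifs with hn
  · rw [hn, homogeneousComponent_zero_of_constantCoeff_eq_zero (constantCoeff_sumPos q)]
  · exact PlethLie.homogeneousComponent_sumPos hn (hq n (Nat.one_le_iff_ne_zero.2 hn)).2

theorem sumPos_altOmega {q : ℕ → Ser} (hq : IsGraded q) :
    sumPos (altOmega q) = -psumNeg (sumPos q) := by
  refine eq_of_homogeneousComponent_eq fun n => ?_
  rw [hq.altOmega.homogeneousComponent_sumPos, map_neg,
    homogeneousComponent_psumNeg hq.isSymmSeries_sumPos, hq.homogeneousComponent_sumPos]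
  split_ifs with hn
  · rw [psumNeg_zero, neg_zero]
  · obtain ⟨hsymm, hhom⟩ := hq n (Nat.one_le_iff_ne_zero.2 hn)
    exact altOmega_of_isHomogeneous hn hsymm hhom

theorem pleth_hSeries_altOmega {q : ℕ → Ser} (hq : IsGraded q) :
    pleth hSeries (sumPos (altOmega q)) * psumNeg (pleth hSeries (sumPos q)) = 1 := by
  have hsymm := hq.isSymmSeries_sumPos
  rw [sumPos_altOmega hq, psumNeg_pleth _ hsymm (constantCoeff_sumPos q)]
  exact pleth_hSeries_neg ((constantCoeff_psumNeg hsymm).trans (constantCoeff_sumPos q))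

theorem pleth_eSeries_altOmega {q : ℕ → Ser} (hq : IsGraded q) :
    pleth eSeries (sumPos (altOmega q)) * psumNeg (pleth eSeries (sumPos q)) = 1 := by
  have hsymm := hq.isSymmSeries_sumPos
  have hzero : constantCoeff (psumNeg (sumPos q)) = 0 :=
    (constantCoeff_psumNeg hsymm).trans (constantCoeff_sumPos q)
  rw [sumPos_altOmega hq, psumNeg_pleth _ hsymm (constantCoeff_sumPos q),
    ← pleth_eSeries_add (by rw [map_neg, hzero, neg_zero]) hzero, neg_add_cancel,
    pleth_eSeries_zero]

section Order

variable {σ τ R : Type*} [CommRing R]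

/-- The ideal of the series of order at least `n`, for congruences of low degree terms. -/
def orderIdeal (n : ℕ∞) : Ideal (MvPowerSeries σ R) where
  carrier := {f | n ≤ f.order}
  zero_mem' := by rw [Set.mem_ofPred_eq, order_zero]; exact le_top
  add_mem' hf hg := (le_min hf hg).trans min_order_le_add
  smul_mem' _ _ hf := (hf.trans le_add_self).trans le_order_mul

theorem le_order_subst_sub_subst {a b : σ → MvPowerSeries τ R} (ha : HasSubst a) (hb : HasSubst b)
    {n : ℕ∞} (hab : ∀ s, n ≤ (a s - b s).order) (f : MvPowerSeries σ R) :
    n ≤ (subst a f - subst b f).order := by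
  refine le_order fun e he => ?_
  rw [map_sub, sub_eq_zero, coeff_subst ha, coeff_subst hb]
  refine finsum_congr fun d => congrArg _ ?_
  rw [← sub_eq_zero, ← map_sub]
  refine coeff_of_lt_order (he.trans_le ?_)
  suffices h : d.prod (fun s m => a s ^ m) - d.prod (fun s m => b s ^ m) ∈ orderIdeal n from h
  rw [← Ideal.Quotient.mk_eq_mk_iff_sub_mem, Finsupp.prod, Finsupp.prod, map_prod, map_prod]
  refine Finset.prod_congr rfl fun s _ => ?_
  rw [map_pow, map_pow, (Ideal.Quotient.mk_eq_mk_iff_sub_mem (a s) (b s)).2 (hab s)]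

end Order

theorem order_sub_le_order_pleth_sub_pleth (f : Ser) {g h : Ser} (hg : constantCoeff g = 0)
    (hh : constantCoeff h = 0) : (g - h).order ≤ (pleth f g - pleth f h).order := by
  refine le_order_subst_sub_subst (hasSubst_psumPleth hg) (hasSubst_psumPleth hh) (fun k => ?_) _
  have hsub : psumPleth k (g - h) = psumPleth k g - psumPleth k h := map_sub _ _ _
  rw [← hsub, psumPleth, order_expand]
  exact le_self_nsmul zero_le k.ne_zero

/-! ### Sums over partitions -/

/-- A sequence `a₀ = 1, a₁, a₂, …` of symmetric functions, `a n` homogeneous of degree `n`, whose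
sum `A` turns sums into products: `A[f + g] = A[f] A[g]`. -/
structure IsExponential (a : ℕ → Ser) : Prop where
  isSymmSeries (n : ℕ) : IsSymmSeries (a n)
  isHomogeneous (n : ℕ) : (a n).IsHomogeneous n
  zero : a 0 = 1
  pleth_add {f g : Ser} (hf : constantCoeff f = 0) (hg : constantCoeff g = 0) :
    pleth (sumAll a) (f + g) = pleth (sumAll a) f * pleth (sumAll a) g

theorem hsymm_zero : hsymm 0 = 1 := by
  classical
  ext d
  rw [coeff_hsymm, coeff_one]
  exact if_congr (Finsupp.degree_eq_zero_iff d) rfl rfl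

theorem esymm_zero : esymm 0 = 1 := by
  classical
  ext d
  rw [coeff_esymm, coeff_one]
  refine if_congr ⟨fun h => (Finsupp.degree_eq_zero_iff d).1 h.1, ?_⟩ rfl rfl
  rintro rfl
  exact ⟨map_zero _, fun _ => Nat.zero_le 1⟩

theorem isExponential_hsymm : IsExponential hsymm :=
  ⟨isSymmSeries_hsymm, isHomogeneous_hsymm, hsymm_zero, pleth_hSeries_add⟩

theorem isExponential_esymm : IsExponential esymm :=
  ⟨isSymmSeries_esymm, isHomogeneous_esymm, esymm_zero, pleth_eSeries_add⟩

theorem isExponential_neg_one_pow_smul_hsymm :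
    IsExponential fun r => (-1 : ℂ) ^ r • hsymm r :=
  ⟨fun n => (isSymmSeries_hsymm n).smul _, fun n => isHomogeneous_smul _ (isHomogeneous_hsymm n),
    by rw [pow_zero, one_smul, hsymm_zero], pleth_hpmSeries_add⟩

theorem isExponential_neg_one_pow_smul_esymm :
    IsExponential fun r => (-1 : ℂ) ^ r • esymm r :=
  ⟨fun n => (isSymmSeries_esymm n).smul _, fun n => isHomogeneous_smul _ (isHomogeneous_esymm n),
    by rw [pow_zero, one_smul, esymm_zero], pleth_epmSeries_add⟩

namespace IsExponential

variable {a : ℕ → Ser} (ha : IsExponential a)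
include ha

theorem pleth_zero : pleth (sumAll a) 0 = 1 := by
  have hzero : constantCoeff (0 : Ser) = 0 := map_zero _
  have hconst : constantCoeff (pleth (sumAll a) 0) = 1 := by
    rw [constantCoeff_pleth (isSymmSeries_sumAll ha.isSymmSeries) hzero,
      ← coeff_zero_eq_constantCoeff_apply, coeff_sumAll, map_zero, ha.zero, coeff_zero_one]
  have hne : pleth (sumAll a) 0 ≠ 0 := fun h => by
    rw [h, map_zero] at hconst
    exact zero_ne_one hconst
  have hadd := ha.pleth_add hzero hzero
  rwa [add_zero, eq_comm, mul_eq_left₀ hne] at hadd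

theorem pleth_finset_sum {ι : Type*} (s : Finset ι) {f : ι → Ser}
    (hf : ∀ i, constantCoeff (f i) = 0) :
    pleth (sumAll a) (∑ i ∈ s, f i) = ∏ i ∈ s, pleth (sumAll a) (f i) := by
  classical
  induction s using Finset.induction with
  | empty => exact ha.pleth_zero
  | insert i s hi ih =>
    have hsum : constantCoeff (∑ i ∈ s, f i) = 0 := by
      rw [map_sum]
      exact Finset.sum_eq_zero fun i _ => hf i
    rw [Finset.prod_insert hi, Finset.sum_insert hi, ha.pleth_add (hf i) hsum, ih]

theorem coeff_grade_pleth {g : Ser} {i : ℕ} (hi : i ≠ 0) (hg : g.IsHomogeneous i) (n : ℕ) :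
    PowerSeries.coeff n (grade (pleth (sumAll a) g)) =
      if i ∣ n then pleth (a (n / i)) g else 0 := by
  rw [coeff_grade, homogeneousComponent_pleth (isSymmSeries_sumAll ha.isSymmSeries) hi hg,
    homogeneousComponent_sumAll (ha.isHomogeneous _)]

theorem hasSum_pleth_smul_X_pow {g : Ser} {i : ℕ} (hi : i ≠ 0) (hg : g.IsHomogeneous i) :
    HasSum (fun j => pleth (a j) g • (PowerSeries.X : PowerSeries Ser) ^ (i * j))
      (grade (pleth (sumAll a) g)) := by
  refine (PowerSeries.WithPiTopology.hasSum_iff_hasSum_coeff _).2 fun n => ?_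
  have hterm (j : ℕ) : PowerSeries.coeff n
      (pleth (a j) g • (PowerSeries.X : PowerSeries Ser) ^ (i * j)) =
      if n = i * j then pleth (a j) g else 0 := by
    rw [PowerSeries.coeff_smul, PowerSeries.coeff_X_pow, smul_eq_mul, mul_ite, mul_one, mul_zero]
  simp only [hterm, ha.coeff_grade_pleth hi hg]
  by_cases hdvd : i ∣ n
  · obtain ⟨m, rfl⟩ := hdvd
    have hsingle := hasSum_single (f := fun j => if i * m = i * j then pleth (a j) g else 0) m
      fun j hj => if_neg fun h => hj (Nat.eq_of_mul_eq_mul_left (Nat.pos_of_ne_zero hi) h).symm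
    rw [if_pos rfl] at hsingle
    rwa [if_pos (dvd_mul_right i m), Nat.mul_div_cancel_left m (Nat.pos_of_ne_zero hi)]
  · rw [if_neg hdvd]
    simpa only [if_neg fun h => hdvd ⟨_, h⟩] using hasSum_zero

theorem one_add_tsum_pleth_smul_X_pow {g : Ser} {i : ℕ} (hi : i ≠ 0) (hg : g.IsHomogeneous i) :
    1 + ∑' j, pleth (a (j + 1)) g • (PowerSeries.X : PowerSeries Ser) ^ (i * (j + 1)) =
      grade (pleth (sumAll a) g) := by
  have hzero : pleth (a 0) g • (PowerSeries.X : PowerSeries Ser) ^ (i * 0) = 1 := by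
    rw [ha.zero, pleth_one (constantCoeff_of_isHomogeneous hg hi), mul_zero, pow_zero, one_smul]
  have hsum := ha.hasSum_pleth_smul_X_pow hi hg
  rw [← hsum.tsum_eq, hsum.summable.tsum_eq_zero_add, hzero]

end IsExponential

theorem lt_order_sum_sub_sumPos {q : ℕ → Ser} (hq : IsGraded q) {n : ℕ} {s : Finset ℕ}
    (hs : Finset.range n ⊆ s) : (n : ℕ∞) < (∑ i ∈ s, q (i + 1) - sumPos q).order := by
  rw [← ENat.add_one_le_iff (ENat.natCast_ne_top n)]
  refine le_order fun d hd => ?_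
  have hd : d.degree < n + 1 := by exact_mod_cast hd
  have hcoeff {i : ℕ} (hi : d.degree ≠ i + 1) : coeff d (q (i + 1)) = 0 := by
    rw [isHomogeneous_iff_eq_homogeneousComponent.1 (hq (i + 1) i.succ_pos).2,
      coeff_homogeneousComponent, if_neg hi]
  rw [map_sub, map_sum, sub_eq_zero, sumPos, coeff_sumAll]
  split_ifs with hzero
  · rw [map_zero]
    exact Finset.sum_eq_zero fun i _ => hcoeff (by omega)
  · have hmem : d.degree - 1 ∈ s := hs (Finset.mem_range.2 (by omega))
    rw [Finset.sum_eq_single_of_mem _ hmem fun i _ hi => hcoeff (by omega),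
      Nat.sub_add_cancel (Nat.one_le_iff_ne_zero.2 hzero)]

namespace IsExponential

variable {a : ℕ → Ser} (ha : IsExponential a) {q : ℕ → Ser} (hq : IsGraded q)
include ha hq

theorem hasProd_grade_pleth :
    HasProd (fun i => grade (pleth (sumAll a) (q (i + 1))))
      (grade (pleth (sumAll a) (sumPos q))) := by
  have hconst (i : ℕ) : constantCoeff (q (i + 1)) = 0 := hq.constantCoeff i.succ_ne_zero
  have hsum (s : Finset ℕ) : constantCoeff (∑ i ∈ s, q (i + 1)) = 0 := by
    rw [map_sum]
    exact Finset.sum_eq_zero fun i _ => hconst i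
  refine (PowerSeries.WithPiTopology.tendsto_iff_coeff_tendsto _ _ _ _).2 fun n => ?_
  refine tendsto_atTop_of_eventually_const (i₀ := Finset.range n) fun s hs => ?_
  rw [← map_prod, ← ha.pleth_finset_sum s hconst, coeff_grade, coeff_grade, ← sub_eq_zero,
    ← map_sub]
  exact homogeneousComponent_of_lt_order_eq_zero ((lt_order_sum_sub_sumPos hq hs).trans_le
    (order_sub_le_order_pleth_sub_pleth _ (hsum s) (constantCoeff_sumPos q)))

theorem mk_sum_partition :
    (PowerSeries.mk fun n => ∑ μ : n.Partition,
      ∏ i ∈ μ.parts.toFinset, pleth (a (μ.parts.count i)) (q i)) =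
      grade (pleth (sumAll a) (sumPos q)) := by
  have hgenFun := Nat.Partition.hasProd_genFun fun i c => pleth (a c) (q i)
  simp only [ha.one_add_tsum_pleth_smul_X_pow (Nat.succ_ne_zero _) (hq _ (Nat.succ_pos _)).2]
    at hgenFun
  exact hgenFun.unique (ha.hasProd_grade_pleth hq)

theorem sum_partition (n : ℕ) :
    ∑ μ : n.Partition, ∏ i ∈ μ.parts.toFinset, pleth (a (μ.parts.count i)) (q i) =
      homogeneousComponent n (pleth (sumAll a) (sumPos q)) := by
  rw [← coeff_grade, ← ha.mk_sum_partition hq, PowerSeries.coeff_mk]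

end IsExponential

section Graded

variable {q : ℕ → Ser} (hq : IsGraded q)
include hq

theorem genH_eq : genH q = grade (pleth hSeries (sumPos q)) :=
  isExponential_hsymm.mk_sum_partition hq

theorem genE_eq : genE q = grade (pleth eSeries (sumPos q)) :=
  isExponential_esymm.mk_sum_partition hq

theorem sum_Hpart (n : ℕ) :
    ∑ μ : n.Partition, Hpart q μ = homogeneousComponent n (pleth hSeries (sumPos q)) :=
  isExponential_hsymm.sum_partition hq n

theorem sum_Epart (n : ℕ) :
    ∑ μ : n.Partition, Epart q μ = homogeneousComponent n (pleth eSeries (sumPos q)) :=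
  isExponential_esymm.sum_partition hq n

theorem prod_pleth_neg_one_pow_smul {a : ℕ → Ser} (ha : ∀ n, IsSymmSeries (a n)) {n : ℕ}
    (μ : n.Partition) :
    ∏ i ∈ μ.parts.toFinset, pleth ((-1 : ℂ) ^ μ.parts.count i • a (μ.parts.count i)) (q i) =
      (-1 : ℂ) ^ len μ • ∏ i ∈ μ.parts.toFinset, pleth (a (μ.parts.count i)) (q i) := by
  rw [len, ← Multiset.toFinset_sum_count_eq, ← Finset.prod_pow_eq_pow_sum,
    ← Finset.prod_smul]
  refine Finset.prod_congr rfl fun i hi => ?_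
  have hi : i ≠ 0 := (μ.parts_pos (Multiset.mem_toFinset.1 hi)).ne'
  exact pleth_smul (hq.constantCoeff hi) (ha _) _

theorem sum_neg_one_pow_smul_Hpart (n : ℕ) :
    ∑ μ : n.Partition, (-1 : ℂ) ^ len μ • Hpart q μ =
      homogeneousComponent n (pleth hpmSeries (sumPos q)) := by
  rw [hpmSeries, ← isExponential_neg_one_pow_smul_hsymm.sum_partition hq]
  simp only [prod_pleth_neg_one_pow_smul hq isSymmSeries_hsymm, Hpart]

theorem sum_neg_one_pow_smul_Epart (n : ℕ) :
    ∑ μ : n.Partition, (-1 : ℂ) ^ len μ • Epart q μ =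
      homogeneousComponent n (pleth epmSeries (sumPos q)) := by
  rw [epmSeries, ← isExponential_neg_one_pow_smul_esymm.sum_partition hq]
  simp only [prod_pleth_neg_one_pow_smul hq isSymmSeries_esymm, Epart]

theorem genHpm_eq : genHpm q = grade (pleth hpmSeries (sumPos q)) := by
  ext1 n
  rw [coeff_grade, ← sum_neg_one_pow_smul_Hpart hq, genHpm, PowerSeries.coeff_mk]

end Graded

theorem len_le {n : ℕ} (μ : n.Partition) : len μ ≤ n :=
  (card_le_sum fun _ hk => (μ.parts_pos hk).ne').trans_eq μ.parts_sum

theorem neg_one_pow_sub_len {n : ℕ} (μ : n.Partition) :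
    (-1 : ℂ) ^ (n - len μ) = (-1) ^ n * (-1) ^ len μ := by
  rw [← pow_sub_mul_pow (-1 : ℂ) (len_le μ), mul_assoc, ← mul_pow, neg_one_mul, neg_neg, one_pow,
    mul_one]

/-! ### Partitions into powers of two -/

/-- The product `∏_{k ≥ 0} (1 + c p_{2^k})`. -/
def twoPowerProd (c : ℂ) : Ser := ∏' k : ℕ, (1 + c • psum (2 ^ k))

theorem le_order_of_isHomogeneous {σ R : Type*} [CommRing R] {f : MvPowerSeries σ R} {n : ℕ}
    (hf : f.IsHomogeneous n) : (n : ℕ∞) ≤ f.order := by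
  refine le_order fun d hd => ?_
  rw [isHomogeneous_iff_eq_homogeneousComponent.1 hf, coeff_homogeneousComponent,
    if_neg (Nat.cast_lt.1 hd).ne]

theorem hasProd_twoPowerProd (c : ℂ) :
    HasProd (fun k : ℕ => 1 + c • psum (2 ^ k)) (twoPowerProd c) := by
  refine (WithPiTopology.multipliable_one_add_of_tendsto_order_atTop_nhds_top ?_).hasProd
  refine ENat.tendsto_nhds_top_iff_natCast_lt.2 fun n => ?_
  filter_upwards [Filter.eventually_ge_atTop n] with k hk
  have hlt : n < 2 ^ k := hk.trans_lt Nat.lt_two_pow_self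
  exact (Nat.cast_lt.2 hlt).trans_le
    (le_order_of_isHomogeneous (isHomogeneous_smul c (isHomogeneous_psum (2 ^ k))))

theorem constantCoeff_twoPowerProd (c : ℂ) : constantCoeff (twoPowerProd c) = 1 := by
  have hprod := (hasProd_twoPowerProd c).map constantCoeff
    (WithPiTopology.continuous_constantCoeff ℂ)
  have hone (k : ℕ) : constantCoeff (1 + c • psum (2 ^ k)) = 1 := by
    rw [map_add, map_one, constantCoeff_smul, constantCoeff_psum (pow_ne_zero k two_ne_zero),
      smul_zero, add_zero]
  simp only [Function.comp_def, hone] at hprod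
  exact hprod.unique hasProd_one

theorem psumPleth_two_one_add_smul_psum (c : ℂ) (k : ℕ) :
    psumPleth 2 (1 + c • psum (2 ^ k)) = 1 + c • psum (2 ^ (k + 1)) := by
  have hadd : psumPleth 2 (1 + c • psum (2 ^ k)) = 1 + c • psumPleth 2 (psum (2 ^ k)) := by
    rw [psumPleth, map_add, map_one, map_smul]
    rfl
  rw [hadd, psumPleth_psum, PNat.val_ofNat, ← pow_succ']

theorem one_add_smul_psum_mul_psumPleth_twoPowerProd (c : ℂ) :
    (1 + c • psum 1) * psumPleth 2 (twoPowerProd c) = twoPowerProd c := by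
  have hprod : HasProd (fun k : ℕ => psumPleth 2 (1 + c • psum (2 ^ k)))
      (psumPleth 2 (twoPowerProd c)) :=
    (hasProd_twoPowerProd c).map (expand ((2 : ℕ+) : ℕ) (2 : ℕ+).ne_zero)
      (continuous_expand (2 : ℕ+).ne_zero)
  rw [funext (psumPleth_two_one_add_smul_psum c)] at hprod
  have hzero : psum 1 = psum (2 ^ 0) := by rw [pow_zero]
  rw [hzero]
  exact HasProd.unique (HasProd.zero_mul (f := fun k : ℕ => 1 + c • psum (2 ^ k)) hprod)
    (hasProd_twoPowerProd c)

theorem grade_psum (k : ℕ) : grade (psum k) = tpsum k :=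
  grade_of_isHomogeneous (isHomogeneous_psum k)

theorem hasProd_one_add_tpsum :
    HasProd (fun k : ℕ => 1 + tpsum (2 ^ k)) (grade (twoPowerProd 1)) := by
  have hprod := (hasProd_twoPowerProd 1).map grade continuous_grade
  simpa only [Function.comp_def, one_smul, map_add, map_one, grade_psum] using hprod

theorem hasProd_one_sub_tpsum :
    HasProd (fun k : ℕ => 1 - tpsum (2 ^ k)) (grade (twoPowerProd (-1))) := by
  have hprod := (hasProd_twoPowerProd (-1)).map grade continuous_grade
  simpa only [Function.comp_def, neg_smul, one_smul, ← sub_eq_add_neg, map_sub, map_one,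
    grade_psum] using hprod

theorem psumPart_eq_prod_pow {n : ℕ} (μ : n.Partition) :
    psumPart μ = ∏ i ∈ μ.parts.toFinset, psum i ^ μ.parts.count i :=
  Finset.prod_multiset_map_count _ _

section PartitionGenFun

variable {R : Type*} [CommSemiring R]

open Classical in
theorem mk_sum_filter_eq_genFun (p : ℕ → ℕ → Prop) (f : ℕ → ℕ → R) :
    (PowerSeries.mk fun n => ∑ μ : n.Partition with ∀ i ∈ μ.parts, p i (μ.parts.count i),
      ∏ i ∈ μ.parts.toFinset, f i (μ.parts.count i)) =
      Nat.Partition.genFun fun i c => if p i c then f i c else 0 := by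
  ext1 n
  rw [PowerSeries.coeff_mk, Nat.Partition.coeff_genFun, Finset.sum_filter]
  refine Finset.sum_congr rfl fun μ _ => ?_
  rw [Finsupp.prod, Multiset.toFinsupp_support]
  refine ((Finset.prod_ite_zero ..).trans ?_).symm
  simp only [Multiset.toFinsupp_apply, Multiset.mem_toFinset]

theorem injective_two_pow_sub_one : Function.Injective fun k : ℕ => 2 ^ k - 1 := fun _ _ h =>
  Nat.pow_right_injective le_rfl
    (Nat.pred_inj Nat.one_le_two_pow Nat.one_le_two_pow h)

theorem hasProd_genFun_two_pow [TopologicalSpace R] [T2Space R] {f : ℕ → ℕ → R}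
    (hf : ∀ i, (¬∃ k, i = 2 ^ k) → ∀ c, f i c = 0) :
    HasProd (fun k : ℕ => 1 + ∑' j, f (2 ^ k) (j + 1) •
      (PowerSeries.X : PowerSeries R) ^ (2 ^ k * (j + 1))) (Nat.Partition.genFun f) := by
  have hone (i : ℕ) (hi : i ∉ Set.range fun k : ℕ => 2 ^ k - 1) :
      1 + ∑' j, f (i + 1) (j + 1) • (PowerSeries.X : PowerSeries R) ^ ((i + 1) * (j + 1)) = 1 := by
    have hi' : ¬∃ k, i + 1 = 2 ^ k := fun ⟨k, hk⟩ => hi ⟨k, (Nat.eq_sub_of_add_eq hk).symm⟩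
    simp only [hf _ hi', zero_smul, tsum_zero, add_zero]
  have hprod := (injective_two_pow_sub_one.hasProd_iff hone).2 (Nat.Partition.hasProd_genFun f)
  simpa only [Function.comp_def, Nat.sub_add_cancel Nat.one_le_two_pow] using hprod

end PartitionGenFun

theorem mk_sum_twoPowerDistinctParts :
    (PowerSeries.mk fun n => ∑ μ ∈ twoPowerDistinctParts n, psumPart μ) =
      grade (twoPowerProd 1) := by
  classical
  have hfilter (n : ℕ) : twoPowerDistinctParts n = Finset.univ.filter fun μ : n.Partition =>
      ∀ i ∈ μ.parts, (∃ k : ℕ, i = 2 ^ k) ∧ μ.parts.count i = 1 := by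
    rw [twoPowerDistinctParts, twoPowerParts, Finset.filter_filter]
    simp only [forall₂_and, Multiset.nodup_iff_count_eq_one]
  have hfactor (k : ℕ) : 1 + ∑' j, (if (∃ l : ℕ, 2 ^ k = 2 ^ l) ∧ j + 1 = 1 then
      psum (2 ^ k) ^ (j + 1) else 0) • (PowerSeries.X : PowerSeries Ser) ^ (2 ^ k * (j + 1)) =
      1 + tpsum (2 ^ k) := by
    rw [tsum_eq_single 0 fun j hj => by rw [if_neg (by omega), zero_smul],
      if_pos ⟨⟨k, rfl⟩, rfl⟩, zero_add, pow_one, mul_one, PowerSeries.smul_eq_C_mul, tpsum]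
  have hprod := hasProd_genFun_two_pow
    (f := fun i c => if (∃ k : ℕ, i = 2 ^ k) ∧ c = 1 then psum i ^ c else 0)
    fun i hi c => if_neg fun h => hi h.1
  simp only [hfactor] at hprod
  simp only [hfilter, psumPart_eq_prod_pow]
  refine Eq.trans ?_ (hprod.unique hasProd_one_add_tpsum)
  convert mk_sum_filter_eq_genFun (fun i c => (∃ k : ℕ, i = 2 ^ k) ∧ c = 1) fun i c => psum i ^ c

theorem one_add_tsum_mul_one_sub {R : Type*} [CommRing R] [TopologicalSpace R]
    [IsTopologicalRing R] [T2Space R] {f : PowerSeries R} (hf : PowerSeries.constantCoeff f = 0) :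
    (1 + ∑' j, f ^ (j + 1)) * (1 - f) = 1 := by
  have h := PowerSeries.WithPiTopology.tsum_pow_mul_one_sub_of_constantCoeff_eq_zero hf
  rwa [(PowerSeries.WithPiTopology.summable_pow_of_constantCoeff_eq_zero hf).tsum_eq_zero_add,
      pow_zero] at h

theorem constantCoeff_tpsum {k : ℕ} (hk : k ≠ 0) : PowerSeries.constantCoeff (tpsum k) = 0 := by
  rw [tpsum, map_mul, map_pow, PowerSeries.constantCoeff_X, zero_pow hk, mul_zero]

theorem mk_sum_twoPowerParts_mul :
    (PowerSeries.mk fun n => ∑ μ ∈ twoPowerParts n, psumPart μ) * grade (twoPowerProd (-1)) =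
      1 := by
  classical
  have hfactor (k : ℕ) : 1 + ∑' j, (if ∃ l : ℕ, 2 ^ k = 2 ^ l then
      psum (2 ^ k) ^ (j + 1) else 0) • (PowerSeries.X : PowerSeries Ser) ^ (2 ^ k * (j + 1)) =
      1 + ∑' j, tpsum (2 ^ k) ^ (j + 1) := by
    refine congrArg _ (tsum_congr fun j => ?_)
    rw [if_pos ⟨k, rfl⟩, tpsum, mul_pow, ← pow_mul, PowerSeries.smul_eq_C_mul, map_pow]
  have hprod := hasProd_genFun_two_pow
    (f := fun i c => if ∃ k : ℕ, i = 2 ^ k then psum i ^ c else 0) fun i hi c => if_neg hi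
  simp only [hfactor, ← mk_sum_filter_eq_genFun fun i _ => ∃ k : ℕ, i = 2 ^ k,
    ← psumPart_eq_prod_pow] at hprod
  refine HasProd.unique (hprod.mul hasProd_one_sub_tpsum) ?_
  simp only [one_add_tsum_mul_one_sub (constantCoeff_tpsum (pow_ne_zero _ two_ne_zero))]
  exact hasProd_one

theorem mk_sum_twoPowerParts :
    (PowerSeries.mk fun n => ∑ μ ∈ twoPowerParts n, psumPart μ) =
      grade (twoPowerProd (-1))⁻¹ := by
  have hne : constantCoeff (twoPowerProd (-1)) ≠ 0 := by
    rw [constantCoeff_twoPowerProd]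
    exact one_ne_zero
  refine left_inv_eq_right_inv mk_sum_twoPowerParts_mul ?_
  rw [← map_mul, MvPowerSeries.mul_inv_cancel _ hne, map_one]

/-! ### Geometric series and low degrees -/

section GeometricSeries

variable {R : Type*} [CommRing R] {A : PowerSeries R}

theorem mk_pow_mul_one_sub (a : R) :
    (PowerSeries.mk fun n => a ^ n) * (1 - PowerSeries.C a * PowerSeries.X) = 1 := by
  have h := congrArg (PowerSeries.rescale a) (PowerSeries.mk_one_mul_one_sub_eq_one R)
  simpa only [map_mul, map_sub, map_one, PowerSeries.rescale_X, PowerSeries.rescale_mk,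
    Pi.one_apply, mul_one] using h

theorem mul_one_sub_eq_one_iff (a : R) :
    A * (1 - PowerSeries.C a * PowerSeries.X) = 1 ↔ ∀ n, PowerSeries.coeff n A = a ^ n := by
  have hunit := IsUnit.of_mul_eq_one_right _ (mk_pow_mul_one_sub a)
  calc A * (1 - PowerSeries.C a * PowerSeries.X) = 1
    _ ↔ A * (1 - PowerSeries.C a * PowerSeries.X) =
          (PowerSeries.mk fun n => a ^ n) * (1 - PowerSeries.C a * PowerSeries.X) := by
        rw [mk_pow_mul_one_sub]
    _ ↔ ∀ n, PowerSeries.coeff n A = a ^ n := by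
        rw [hunit.mul_left_inj, PowerSeries.ext_iff]
        simp only [PowerSeries.coeff_mk]

theorem mul_one_sub_eq_one_sub_sq_iff {a b : R} (hzero : PowerSeries.coeff 0 A = 1)
    (hone : PowerSeries.coeff 1 A = a) :
    A * (1 - PowerSeries.C a * PowerSeries.X) = 1 - PowerSeries.C b * PowerSeries.X ^ 2 ↔
      ∀ n, PowerSeries.coeff (n + 2) A = (a ^ 2 - b) * a ^ n := by
  set G : PowerSeries R := PowerSeries.mk fun n => a ^ n
  set B : PowerSeries R := 1 + PowerSeries.C a * PowerSeries.X +
    PowerSeries.X ^ 2 * (PowerSeries.C (a ^ 2 - b) * G) with hB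
  have hmul : B * (1 - PowerSeries.C a * PowerSeries.X) =
      1 - PowerSeries.C b * PowerSeries.X ^ 2 := by
    rw [hB, map_sub, map_pow]
    linear_combination PowerSeries.X ^ 2 * (PowerSeries.C a ^ 2 - PowerSeries.C b) *
      mk_pow_mul_one_sub a
  have hunit := IsUnit.of_mul_eq_one_right _ (mk_pow_mul_one_sub a)
  have hBzero : PowerSeries.coeff 0 B = 1 := by
    simp [B]
  have hBone : PowerSeries.coeff 1 B = a := by
    simp [B, PowerSeries.coeff_one, PowerSeries.coeff_X_pow_mul']
  have hcoeff (n : ℕ) : PowerSeries.coeff (n + 2) B = (a ^ 2 - b) * a ^ n := by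
    simp [B, G, -map_sub, PowerSeries.coeff_one, PowerSeries.coeff_C_mul,
      PowerSeries.coeff_X_pow_mul]
  rw [← hmul, hunit.mul_left_inj, PowerSeries.ext_iff]
  refine ⟨fun h n => by rw [h, hcoeff], fun h n => ?_⟩
  match n with
  | 0 => rw [hzero, hBzero]
  | 1 => rw [hone, hBone]
  | n + 2 => rw [h, hcoeff]

end GeometricSeries

theorem hsymm_one : hsymm 1 = psum 1 := by
  classical
  ext d
  rw [coeff_hsymm, coeff_psum]
  exact if_congr (Finsupp.sum_eq_one_iff d) rfl rfl

theorem esymm_one : esymm 1 = psum 1 := by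
  classical
  ext d
  rw [coeff_esymm, coeff_psum]
  refine if_congr ⟨fun h => (Finsupp.sum_eq_one_iff d).1 h.1, ?_⟩ rfl rfl
  rintro ⟨i, rfl⟩
  refine ⟨Finsupp.degree_single i 1, fun j => ?_⟩
  rw [Finsupp.single_apply]
  split_ifs <;> omega

theorem homogeneousComponent_psumSeries {n : ℕ} (hn : n ≠ 0) :
    homogeneousComponent n psumSeries = psum n := by
  classical
  ext d
  rw [coeff_homogeneousComponent, coeff_psumSeries, coeff_psum, ← ite_and]
  refine if_congr ⟨?_, ?_⟩ rfl rfl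
  · rintro ⟨hd, hcard⟩
    obtain ⟨i, -, hi⟩ := Finsupp.card_support_eq_one.1 hcard
    rw [hi, Finsupp.degree_single] at hd
    exact ⟨i, hd ▸ hi⟩
  · rintro ⟨i, rfl⟩
    exact ⟨Finsupp.degree_single i n, Finsupp.card_support_eq_one.2 ⟨i, by simpa using hn, by simp⟩⟩

theorem homogeneousComponent_euler {σ R : Type*} [CommRing R] (n : ℕ) (f : MvPowerSeries σ R) :
    homogeneousComponent n (euler f) = (n : R) • homogeneousComponent n f := by
  ext d
  rw [coeff_smul, coeff_homogeneousComponent, coeff_homogeneousComponent, coeff_euler]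
  split_ifs with hd
  · rw [hd]
  · rw [mul_zero]

theorem homogeneousComponent_two_mul {σ R : Type*} [CommRing R] (f g : MvPowerSeries σ R) :
    homogeneousComponent 2 (f * g) = homogeneousComponent 0 f * homogeneousComponent 2 g +
      homogeneousComponent 1 f * homogeneousComponent 1 g +
      homogeneousComponent 2 f * homogeneousComponent 0 g := by
  have h : Finset.HasAntidiagonal.antidiagonal 2 = {(0, 2), (1, 1), (2, 0)} := by decide
  rw [homogeneousComponent_mul, h, Finset.sum_insert (by decide), Finset.sum_insert (by decide),
    Finset.sum_singleton, ← add_assoc]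

theorem homogeneousComponent_hSeries (n : ℕ) : homogeneousComponent n hSeries = hsymm n :=
  homogeneousComponent_sumAll (isHomogeneous_hsymm n)

theorem homogeneousComponent_eSeries (n : ℕ) : homogeneousComponent n eSeries = esymm n :=
  homogeneousComponent_sumAll (isHomogeneous_esymm n)

theorem homogeneousComponent_hpmSeries (n : ℕ) :
    homogeneousComponent n hpmSeries = (-1 : ℂ) ^ n • hsymm n :=
  homogeneousComponent_sumAll (isHomogeneous_smul _ (isHomogeneous_hsymm n))

theorem two_mul_hsymm_two : 2 * hsymm 2 = psum 1 ^ 2 + psum 2 := by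
  have h := congrArg (homogeneousComponent 2) euler_hSeries
  rw [homogeneousComponent_euler, homogeneousComponent_two_mul,
    homogeneousComponent_zero_of_constantCoeff_eq_zero constantCoeff_psumSeries,
    homogeneousComponent_psumSeries one_ne_zero, homogeneousComponent_psumSeries two_ne_zero,
    homogeneousComponent_hSeries, homogeneousComponent_hSeries, homogeneousComponent_hSeries,
    hsymm_one, hsymm_zero, Nat.cast_ofNat, ofNat_smul_eq_nsmul, nsmul_eq_mul, Nat.cast_ofNat] at h
  linear_combination h

theorem two_mul_esymm_two : 2 * esymm 2 = psum 1 ^ 2 - psum 2 := by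
  have h := congrArg (homogeneousComponent 2) eSeries_mul_hpmSeries
  rw [homogeneousComponent_two_mul, homogeneousComponent_of_isHomogeneous isHomogeneous_one,
    if_neg two_ne_zero] at h
  simp only [homogeneousComponent_eSeries, homogeneousComponent_hpmSeries, esymm_zero, esymm_one,
    hsymm_zero, hsymm_one, neg_one_sq, pow_zero, pow_one, one_smul, neg_one_smul] at h
  linear_combination 2 * h - two_mul_hsymm_two

section Exponential

variable {a q : ℕ → Ser} (ha : IsExponential a) (hq : IsGraded q)
include ha hq

theorem IsExponential.homogeneousComponent_zero_pleth :
    homogeneousComponent 0 (pleth (sumAll a) (sumPos q)) = 1 := by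
  rw [← ha.sum_partition hq, Fintype.sum_unique, Nat.Partition.partition_zero_parts,
    Multiset.toFinset_zero, Finset.prod_empty]

theorem IsExponential.homogeneousComponent_one_pleth (hone : q 1 = psum 1) :
    homogeneousComponent 1 (pleth (sumAll a) (sumPos q)) = a 1 := by
  rw [← ha.sum_partition hq, Fintype.sum_unique, Nat.Partition.partition_one_parts,
    Multiset.toFinset_singleton, Finset.prod_singleton, Multiset.count_singleton_self, hone,
    pleth_psum_one (ha.isSymmSeries 1)]

end Exponential

/-! ### Equivalent forms of the identities -/

theorem tpsum_one : tpsum 1 = PowerSeries.C (psum 1) * PowerSeries.X := by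
  rw [tpsum, pow_one]

theorem constantCoeff_one_sub_psum_one : constantCoeff (1 - psum 1) = 1 := by
  rw [map_sub, map_one, constantCoeff_psum one_ne_zero, sub_zero]

theorem psumPleth_two_one_sub_psum_one : psumPleth 2 (1 - psum 1) = 1 - psum 2 := by
  have h := psumPleth_two_one_add_smul_psum (-1) 0
  simpa only [neg_one_smul, ← sub_eq_add_neg, pow_zero, zero_add, pow_one] using h

theorem psumNeg_one_sub_psum_one : psumNeg (1 - psum 1) = 1 + psum 1 := by
  have h : psumNeg (psum 1) = -psum 1 := psumNeg_psum 1
  have hneg : psumNeg (-psum 1) = psum 1 := by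
    rw [← h, psumNeg_psumNeg (isSymmSeries_psum 1)]
  rw [sub_eq_add_neg, psumNeg_add isSymmSeries_one (isSymmSeries_psum 1).neg, psumNeg_one, hneg]

theorem eq_one_sub_psum_one_iff {f : Ser} (hzero : homogeneousComponent 0 f = 1)
    (hone : homogeneousComponent 1 f = -psum 1) :
    f = 1 - psum 1 ↔ ∀ n, 2 ≤ n → homogeneousComponent n f = 0 := by
  have hcomp (n : ℕ) : homogeneousComponent n (1 - psum 1) =
      (if n = 0 then 1 else 0) - if n = 1 then psum 1 else 0 := by
    rw [map_sub, homogeneousComponent_of_isHomogeneous isHomogeneous_one,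
      homogeneousComponent_of_isHomogeneous (isHomogeneous_psum 1)]
  refine ⟨?_, fun h => eq_of_homogeneousComponent_eq fun n => ?_⟩
  · rintro rfl n hn
    rw [hcomp, if_neg (by omega), if_neg (by omega), sub_zero]
  · match n with
    | 0 => rw [hcomp, hzero, if_pos rfl, if_neg zero_ne_one, sub_zero]
    | 1 => rw [hcomp, hone, if_neg one_ne_zero, if_pos rfl, zero_sub]
    | n + 2 => rw [hcomp, h _ (by omega), if_neg (by omega), if_neg (by omega), sub_zero]

theorem grade_mul_one_sub_tpsum_one_eq_iff {f g : Ser} :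
    grade f * (1 - tpsum 1) = grade g ↔ f * (1 - psum 1) = g := by
  rw [← grade_psum, ← map_one grade, ← map_sub, ← map_mul, grade_injective.eq_iff]

theorem forall_homogeneousComponent_eq_pow_iff {f : Ser} :
    (∀ n, homogeneousComponent n f = psum 1 ^ n) ↔ f * (1 - psum 1) = 1 := by
  rw [← grade_mul_one_sub_tpsum_one_eq_iff, map_one, tpsum_one, mul_one_sub_eq_one_iff]
  simp only [coeff_grade]

theorem forall_homogeneousComponent_eq_esymm_two_mul_pow_iff {f : Ser}
    (hzero : homogeneousComponent 0 f = 1) (hone : homogeneousComponent 1 f = psum 1) :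
    (∀ n, 2 ≤ n → homogeneousComponent n f = 2 * esymm 2 * psum 1 ^ (n - 2)) ↔
      f * (1 - psum 1) = 1 - psum 2 := by
  rw [← grade_mul_one_sub_tpsum_one_eq_iff, map_sub, map_one, grade_psum, tpsum_one, tpsum,
    mul_one_sub_eq_one_sub_sq_iff (by rw [coeff_grade, hzero]) (by rw [coeff_grade, hone])]
  simp only [coeff_grade, ← two_mul_esymm_two]
  refine ⟨fun h n => h _ (Nat.le_add_left 2 n), fun h n hn => ?_⟩
  obtain ⟨m, rfl⟩ := Nat.exists_eq_add_of_le' hn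
  exact h m

section Inverse

theorem eq_one_sub_iff_of_mul_eq_one {R : Type*} [CommRing R] {a b c : R} (h : a * b = 1) :
    a = c ↔ b * c = 1 :=
  ⟨fun hac => by rw [← hac, mul_comm, h], left_inv_eq_right_inv h⟩

theorem eq_one_add_psum_one_iff_of_mul_psumNeg_eq_one {f g : Ser} (hg : IsSymmSeries g)
    (h : f * psumNeg g = 1) : f = 1 + psum 1 ↔ g * (1 - psum 1) = 1 := by
  have hsymm : IsSymmSeries (1 - psum 1) := isSymmSeries_one.sub (isSymmSeries_psum 1)
  rw [eq_one_sub_iff_of_mul_eq_one h, ← psumNeg_one_sub_psum_one, ← psumNeg_mul hg hsymm]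
  refine ⟨fun hinv => ?_, fun hinv => by rw [hinv, psumNeg_one]⟩
  rw [← psumNeg_psumNeg (hg.mul hsymm), hinv, psumNeg_one]

variable {k : ℕ+} (hk : 1 < (k : ℕ)) {U V : Ser} (hU : constantCoeff U = 1)
  (hUV : V * psumPleth k U = U)
include hk hU hUV

theorem eq_iff_mul_psumPleth_eq {U' : Ser} (hU' : constantCoeff U' = 1) :
    U = U' ↔ V * psumPleth k U' = U' :=
  ⟨fun h => h ▸ hUV, eq_of_mul_psumPleth_eq hk hU hU' hUV⟩

theorem mul_eq_one_iff_mul_eq_psumPleth {P : Ser} (hP : constantCoeff P = 1) :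
    U * P = 1 ↔ V * P = psumPleth k P := by
  have hne : constantCoeff P ≠ 0 := hP ▸ one_ne_zero
  have hinv : P * P⁻¹ = 1 := MvPowerSeries.mul_inv_cancel _ hne
  have hinv' : psumPleth k P * psumPleth k P⁻¹ = 1 := by
    simp only [psumPleth, ← map_mul, hinv, map_one]
  rw [← MvPowerSeries.eq_inv_iff_mul_eq_one hne, eq_iff_mul_psumPleth_eq hk hU hUV
    (by rw [MvPowerSeries.constantCoeff_inv, hP, inv_one])]
  refine ⟨fun h => ?_, fun h => ?_⟩
  · linear_combination P * psumPleth k P * h - V * P * hinv' + psumPleth k P * hinv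
  · linear_combination P⁻¹ * psumPleth k P⁻¹ * h - V * psumPleth k P⁻¹ * hinv + P⁻¹ * hinv'

end Inverse

section Graded

variable {F : ℕ → Ser} (hF : IsGraded F)
include hF

theorem isSymmSeries_pleth_sumPos (f : Ser) : IsSymmSeries (pleth f (sumPos F)) :=
  isSymmSeries_pleth f hF.isSymmSeries_sumPos (constantCoeff_sumPos F)

theorem forall_sum_Hpart_eq_pow_iff : (∀ n : ℕ, ∑ μ : n.Partition, Hpart F μ = psum 1 ^ n) ↔
    pleth hSeries (sumPos F) * (1 - psum 1) = 1 := by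
  simp only [sum_Hpart hF, forall_homogeneousComponent_eq_pow_iff]

theorem forall_sum_Epart_eq_pow_iff : (∀ n : ℕ, ∑ μ : n.Partition, Epart F μ = psum 1 ^ n) ↔
    pleth eSeries (sumPos F) * (1 - psum 1) = 1 := by
  simp only [sum_Epart hF, forall_homogeneousComponent_eq_pow_iff]

theorem pleth_hSeries_altOmega_eq_iff : pleth hSeries (sumPos (altOmega F)) = 1 + psum 1 ↔
    pleth hSeries (sumPos F) * (1 - psum 1) = 1 :=
  eq_one_add_psum_one_iff_of_mul_psumNeg_eq_one (isSymmSeries_pleth_sumPos hF _)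
    (pleth_hSeries_altOmega hF)

theorem pleth_eSeries_altOmega_eq_iff : pleth eSeries (sumPos (altOmega F)) = 1 + psum 1 ↔
    pleth eSeries (sumPos F) * (1 - psum 1) = 1 :=
  eq_one_add_psum_one_iff_of_mul_psumNeg_eq_one (isSymmSeries_pleth_sumPos hF _)
    (pleth_eSeries_altOmega hF)

section DegreeOne

variable (hone : F 1 = psum 1)
include hone

theorem forall_sum_neg_one_pow_smul_Hpart_eq_zero_iff :
    (∀ n : ℕ, 2 ≤ n → ∑ μ : n.Partition, (-1 : ℂ) ^ (n - len μ) • Hpart F μ = 0) ↔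
      pleth hpmSeries (sumPos F) = 1 - psum 1 := by
  have hexp := isExponential_neg_one_pow_smul_hsymm
  rw [hpmSeries, eq_one_sub_psum_one_iff (hexp.homogeneousComponent_zero_pleth hF)
    ((hexp.homogeneousComponent_one_pleth hF hone).trans
      (by rw [pow_one, neg_one_smul, hsymm_one]))]
  simp only [neg_one_pow_sub_len, ← smul_smul, ← Finset.smul_sum, sum_neg_one_pow_smul_Hpart hF,
    smul_eq_zero_iff_right (pow_ne_zero _ (neg_ne_zero.2 (one_ne_zero' ℂ)))]
  rfl

theorem forall_sum_neg_one_pow_smul_Epart_eq_zero_iff :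
    (∀ n : ℕ, 2 ≤ n → ∑ μ : n.Partition, (-1 : ℂ) ^ (n - len μ) • Epart F μ = 0) ↔
      pleth epmSeries (sumPos F) = 1 - psum 1 := by
  have hexp := isExponential_neg_one_pow_smul_esymm
  rw [epmSeries, eq_one_sub_psum_one_iff (hexp.homogeneousComponent_zero_pleth hF)
    ((hexp.homogeneousComponent_one_pleth hF hone).trans
      (by rw [pow_one, neg_one_smul, esymm_one]))]
  simp only [neg_one_pow_sub_len, ← smul_smul, ← Finset.smul_sum, sum_neg_one_pow_smul_Epart hF,
    smul_eq_zero_iff_right (pow_ne_zero _ (neg_ne_zero.2 (one_ne_zero' ℂ)))]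
  rfl

theorem forall_sum_Epart_eq_esymm_two_mul_pow_iff :
    (∀ n : ℕ, 2 ≤ n → ∑ μ : n.Partition, Epart F μ = 2 * esymm 2 * psum 1 ^ (n - 2)) ↔
      pleth eSeries (sumPos F) * (1 - psum 1) = 1 - psum 2 := by
  simp only [sum_Epart hF]
  exact forall_homogeneousComponent_eq_esymm_two_mul_pow_iff
    (isExponential_esymm.homogeneousComponent_zero_pleth hF)
    ((isExponential_esymm.homogeneousComponent_one_pleth hF hone).trans esymm_one)

end DegreeOne

end Graded

theorem psumPleth_twoPowerProd_ne_zero (k : ℕ+) (c : ℂ) : psumPleth k (twoPowerProd c) ≠ 0 := by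
  intro h
  have hzero := constantCoeff_psumPleth k (twoPowerProd c)
  rw [h, map_zero, constantCoeff_twoPowerProd] at hzero
  exact zero_ne_one hzero

section Plethysm

variable {g : Ser} (hg : constantCoeff g = 0)
include hg

theorem pleth_eSeries_mul_one_sub_psum_one_eq_iff :
    pleth eSeries g * (1 - psum 1) = 1 - psum 2 ↔ pleth hSeries g * (1 - psum 1) = 1 := by
  rw [mul_eq_one_iff_mul_eq_psumPleth (k := 2) one_lt_two (constantCoeff_pleth_hSeries hg)
    (pleth_eSeries_mul hg) constantCoeff_one_sub_psum_one, psumPleth_two_one_sub_psum_one]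

theorem pleth_hSeries_mul_twoPowerProd_eq_one_iff :
    pleth hSeries g * twoPowerProd (-1) = 1 ↔ pleth eSeries g * (1 - psum 1) = 1 := by
  have hprod := one_add_smul_psum_mul_psumPleth_twoPowerProd (-1)
  rw [neg_one_smul, ← sub_eq_add_neg] at hprod
  rw [mul_eq_one_iff_mul_eq_psumPleth (k := 2) one_lt_two (constantCoeff_pleth_hSeries hg)
    (pleth_eSeries_mul hg) (constantCoeff_twoPowerProd _),
    ← mul_eq_right₀ (psumPleth_twoPowerProd_ne_zero 2 _), mul_assoc, hprod]

theorem pleth_hSeries_eq_twoPowerProd_iff :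
    pleth hSeries g = twoPowerProd 1 ↔ pleth eSeries g = 1 + psum 1 := by
  have hprod := one_add_smul_psum_mul_psumPleth_twoPowerProd 1
  rw [one_smul] at hprod
  rw [eq_iff_mul_psumPleth_eq (k := 2) one_lt_two (constantCoeff_pleth_hSeries hg)
    (pleth_eSeries_mul hg) (constantCoeff_twoPowerProd _)]
  nth_rw 2 [← hprod]
  exact mul_left_inj' (psumPleth_twoPowerProd_ne_zero 2 1)

end Plethysm

theorem tfae_hSeries {F : ℕ → Ser} (hF : IsGraded F) (hone : F 1 = psum 1) :
    List.TFAE [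
      ∀ n : ℕ, ∑ μ : n.Partition, Hpart F μ = psum 1 ^ n,
      pleth hSeries (sumPos (altOmega F)) = 1 + psum 1,
      ∀ n : ℕ, 2 ≤ n → ∑ μ : n.Partition, (-1 : ℂ) ^ (n - len μ) • Epart F μ = 0,
      ∀ n : ℕ, 2 ≤ n → ∑ μ : n.Partition, Epart F μ = 2 * esymm 2 * psum 1 ^ (n - 2)] := by
  have hzero := constantCoeff_sumPos F
  rw [forall_sum_Hpart_eq_pow_iff hF, pleth_hSeries_altOmega_eq_iff hF,
    forall_sum_neg_one_pow_smul_Epart_eq_zero_iff hF hone,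
    eq_one_sub_iff_of_mul_eq_one (pleth_epmSeries_mul hzero),
    forall_sum_Epart_eq_esymm_two_mul_pow_iff hF hone,
    pleth_eSeries_mul_one_sub_psum_one_eq_iff hzero]
  tfae_finish

theorem isHomogeneous_pleth {f g : Ser} (hf : IsSymmSeries f) {m : ℕ} (hfm : f.IsHomogeneous m)
    {i : ℕ} (hi : i ≠ 0) (hg : g.IsHomogeneous i) : (pleth f g).IsHomogeneous (i * m) := by
  rw [isHomogeneous_iff_eq_homogeneousComponent, homogeneousComponent_pleth hf hi hg,
    if_pos (dvd_mul_right i m), Nat.mul_div_cancel_left m (Nat.pos_of_ne_zero hi),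
    homogeneousComponent_of_isHomogeneous hfm, if_pos rfl]

section GradedEquivalences

variable {F : ℕ → Ser} (hF : IsGraded F)
include hF

theorem forall_sum_Hpart_eq_sum_twoPowerParts_iff :
    (∀ n : ℕ, ∑ μ : n.Partition, Hpart F μ = ∑ μ ∈ twoPowerParts n, psumPart μ) ↔
      pleth hSeries (sumPos F) * twoPowerProd (-1) = 1 := by
  rw [← MvPowerSeries.eq_inv_iff_mul_eq_one (by rw [constantCoeff_twoPowerProd]; exact one_ne_zero),
    ← grade_injective.eq_iff, ← mk_sum_twoPowerParts, PowerSeries.ext_iff]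
  simp only [PowerSeries.coeff_mk, coeff_grade, sum_Hpart hF]

theorem forall_sum_Hpart_eq_sum_twoPowerDistinctParts_iff :
    (∀ n : ℕ, ∑ μ : n.Partition, Hpart F μ = ∑ μ ∈ twoPowerDistinctParts n, psumPart μ) ↔
      pleth hSeries (sumPos F) = twoPowerProd 1 := by
  rw [← grade_injective.eq_iff, ← mk_sum_twoPowerDistinctParts, PowerSeries.ext_iff]
  simp only [PowerSeries.coeff_mk, coeff_grade, sum_Hpart hF]

theorem exists_hasProd_one_sub_tpsum_iff :
    (∃ D : PowerSeries Ser, HasProd (fun k : ℕ => 1 - tpsum (2 ^ k)) D ∧ genH F * D = 1) ↔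
      pleth hSeries (sumPos F) * twoPowerProd (-1) = 1 := by
  rw [← grade_injective.eq_iff, map_mul, map_one, ← genH_eq hF]
  refine ⟨?_, fun h => ⟨_, hasProd_one_sub_tpsum, h⟩⟩
  rintro ⟨D, hD, h⟩
  rwa [← hD.unique hasProd_one_sub_tpsum]

theorem hasProd_one_add_tpsum_genH_iff :
    HasProd (fun k : ℕ => 1 + tpsum (2 ^ k)) (genH F) ↔
      pleth hSeries (sumPos F) = twoPowerProd 1 := by
  rw [← grade_injective.eq_iff, ← genH_eq hF]
  exact ⟨fun h => h.unique hasProd_one_add_tpsum, fun h => h ▸ hasProd_one_add_tpsum⟩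

theorem genE_mul_one_sub_tpsum_eq_one_iff :
    genE F * (1 - tpsum 1) = 1 ↔ pleth eSeries (sumPos F) * (1 - psum 1) = 1 := by
  rw [genE_eq hF, ← map_one grade, ← grade_mul_one_sub_tpsum_one_eq_iff, map_one]

theorem genHpm_eq_one_sub_tpsum_iff :
    genHpm F = 1 - tpsum 1 ↔ pleth hpmSeries (sumPos F) = 1 - psum 1 := by
  rw [genHpm_eq hF, ← grade_psum, ← map_one grade, ← map_sub, grade_injective.eq_iff]

theorem genE_eq_one_add_tpsum_iff :
    genE F = 1 + tpsum 1 ↔ pleth eSeries (sumPos F) = 1 + psum 1 := by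
  rw [genE_eq hF, ← grade_psum, ← map_one grade, ← map_add, grade_injective.eq_iff]

theorem isSymmSeries_Epart {n : ℕ} (μ : n.Partition) : IsSymmSeries (Epart F μ) := by
  refine Finset.prod_induction _ IsSymmSeries (fun _ _ h h' => h.mul h') isSymmSeries_one ?_
  intro i hi
  have hi : i ≠ 0 := (μ.parts_pos (Multiset.mem_toFinset.1 hi)).ne'
  exact isSymmSeries_pleth _ (hF i (Nat.one_le_iff_ne_zero.2 hi)).1 (hF.constantCoeff hi)

theorem isHomogeneous_Epart {n : ℕ} (μ : n.Partition) : (Epart F μ).IsHomogeneous n := by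
  have hdeg : ∑ i ∈ μ.parts.toFinset, i * μ.parts.count i = n := by
    conv_rhs => rw [← μ.parts_sum, Finset.sum_multiset_count]
    exact Finset.sum_congr rfl fun i _ => by rw [smul_eq_mul, mul_comm]
  have hprod : (Epart F μ).IsHomogeneous (∑ i ∈ μ.parts.toFinset, i * μ.parts.count i) := by
    refine isHomogeneous_prod _ fun i hi => ?_
    have hi : i ≠ 0 := (μ.parts_pos (Multiset.mem_toFinset.1 hi)).ne'
    apply isHomogeneous_pleth (isSymmSeries_esymm _) (isHomogeneous_esymm _) hi
    exact (hF i (Nat.one_le_iff_ne_zero.2 hi)).2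
  rwa [hdeg] at hprod

end GradedEquivalences

theorem isGraded_esymm : IsGraded esymm :=
  fun n _ => ⟨isSymmSeries_esymm n, isHomogeneous_esymm n⟩

theorem eSeries_eq_one_add_sumPos : eSeries = 1 + sumPos esymm := by
  refine eq_of_homogeneousComponent_eq fun n => ?_
  rw [homogeneousComponent_eSeries, map_add, isGraded_esymm.homogeneousComponent_sumPos,
    homogeneousComponent_of_isHomogeneous isHomogeneous_one]
  split_ifs with hn
  · rw [hn, esymm_zero, add_zero]
  · rw [zero_add]

theorem psum_one_pleth {g : Ser} (hg : constantCoeff g = 0) : pleth (psum 1) g = g :=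
  (pleth_psum hg 1).trans (expand_one_apply g)

theorem isPlethInverse_esymm_iff {g : Ser} (hg : IsSymmSeries g) (hg0 : constantCoeff g = 0) :
    IsPlethInverse (sumPos esymm) g ↔ pleth eSeries g = 1 + psum 1 := by
  have hzero := constantCoeff_sumPos esymm
  have hadd : pleth eSeries g = 1 + pleth (sumPos esymm) g := by
    rw [eSeries_eq_one_add_sumPos,
      pleth_add hg0 isSymmSeries_one isGraded_esymm.isSymmSeries_sumPos, pleth_one hg0]
  refine ⟨fun h => by rw [hadd, h.1], fun h => ⟨add_left_cancel (hadd.symm.trans h), ?_⟩⟩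
  refine pleth_eSeries_injective ((constantCoeff_pleth hg hzero).trans hg0)
    (constantCoeff_psum one_ne_zero) ?_
  rw [← pleth_assoc _ hg hg0 hzero, h, pleth_add hzero isSymmSeries_one (isSymmSeries_psum 1),
    pleth_one hzero, pleth_psum_one isSymmSeries_eSeries, psum_one_pleth hzero,
    eSeries_eq_one_add_sumPos]

theorem psumNeg_smul (c : ℂ) {f : Ser} (hf : IsSymmSeries f) :
    psumNeg (c • f) = c • psumNeg f := pleth_smul constantCoeff_neg_psum_one hf c

theorem psumNeg_sum {ι : Type*} (s : Finset ι) {f : ι → Ser} (hf : ∀ i ∈ s, IsSymmSeries (f i)) :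
    psumNeg (∑ i ∈ s, f i) = ∑ i ∈ s, psumNeg (f i) := by
  classical
  induction s using Finset.induction with
  | empty => exact psumNeg_zero
  | insert i s hi ih =>
    have hs := fun j hj => hf j (Finset.mem_insert_of_mem hj)
    rw [Finset.sum_insert hi, Finset.sum_insert hi, psumNeg_add (hf i (Finset.mem_insert_self i s))
      (Finset.sum_induction f IsSymmSeries (fun _ _ h h' => h.add h') isSymmSeries_zero hs), ih hs]

theorem sum_neg_one_pow_smul_omega_Epart {F : ℕ → Ser} (hF : IsGraded F) (n : ℕ) :
    ∑ μ : n.Partition, (-1 : ℂ) ^ (n - len μ) • omega (Epart F μ) =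
      ∑ μ : n.Partition, Hpart (altOmega F) μ := by
  have hU := isSymmSeries_pleth_sumPos hF hSeries
  have hK := isSymmSeries_pleth_sumPos hF epmSeries
  have hinv : pleth hSeries (sumPos (altOmega F)) = psumNeg (pleth epmSeries (sumPos F)) := by
    refine left_inv_eq_right_inv (pleth_hSeries_altOmega hF) ?_
    rw [mul_comm, ← psumNeg_mul hK hU, pleth_epmSeries_mul (constantCoeff_sumPos F), psumNeg_one]
  rw [sum_Hpart hF.altOmega, hinv, homogeneousComponent_psumNeg hK,
    ← sum_neg_one_pow_smul_Epart hF, psumNeg_sum _ fun μ _ => (isSymmSeries_Epart hF μ).smul _]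
  refine Finset.sum_congr rfl fun μ _ => ?_
  rw [omega_of_isHomogeneous (isSymmSeries_Epart hF μ) (isHomogeneous_Epart hF μ), smul_smul,
    psumNeg_smul _ (isSymmSeries_Epart hF μ), neg_one_pow_sub_len, mul_right_comm, ← mul_pow,
    neg_one_mul, neg_neg, one_pow, one_mul]

theorem tfae_eSeries {F : ℕ → Ser} (hF : IsGraded F) (hone : F 1 = psum 1) :
    List.TFAE [
      ∀ n : ℕ, ∑ μ : n.Partition, Epart F μ = psum 1 ^ n,
      pleth eSeries (sumPos F) = (1 - psum 1)⁻¹,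
      genE F * (1 - tpsum 1) = 1,
      pleth hpmSeries (sumPos F) = 1 - psum 1,
      genHpm F = 1 - tpsum 1,
      pleth eSeries (sumPos (altOmega F)) = 1 + psum 1,
      genE (altOmega F) = 1 + tpsum 1,
      IsPlethInverse (sumPos esymm) (sumPos (altOmega F)),
      ∀ n : ℕ, 2 ≤ n → ∑ μ : n.Partition, (-1 : ℂ) ^ (n - len μ) • Hpart F μ = 0,
      ∀ n : ℕ, ∑ μ : n.Partition, Hpart F μ = ∑ μ ∈ twoPowerParts n, psumPart μ,
      ∃ D : PowerSeries Ser, HasProd (fun k : ℕ => 1 - tpsum (2 ^ k)) D ∧ genH F * D = 1,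
      ∀ n : ℕ, ∑ μ : n.Partition, (-1 : ℂ) ^ (n - len μ) • omega (Epart F μ) =
        ∑ μ ∈ twoPowerDistinctParts n, psumPart μ,
      ∀ n : ℕ, ∑ μ : n.Partition, Hpart (altOmega F) μ =
        ∑ μ ∈ twoPowerDistinctParts n, psumPart μ,
      HasProd (fun k : ℕ => 1 + tpsum (2 ^ k)) (genH (altOmega F))] := by
  have hG := hF.altOmega
  have hzero := constantCoeff_sumPos F
  have hzero' := constantCoeff_sumPos (altOmega F)
  simp only [sum_neg_one_pow_smul_omega_Epart hF]
  rw [forall_sum_Epart_eq_pow_iff hF,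
    MvPowerSeries.eq_inv_iff_mul_eq_one (constantCoeff_one_sub_psum_one ▸ one_ne_zero),
    genE_mul_one_sub_tpsum_eq_one_iff hF, genHpm_eq_one_sub_tpsum_iff hF,
    genE_eq_one_add_tpsum_iff hG, isPlethInverse_esymm_iff hG.isSymmSeries_sumPos hzero',
    forall_sum_neg_one_pow_smul_Hpart_eq_zero_iff hF hone,
    forall_sum_Hpart_eq_sum_twoPowerParts_iff hF, exists_hasProd_one_sub_tpsum_iff hF,
    forall_sum_Hpart_eq_sum_twoPowerDistinctParts_iff hG, hasProd_one_add_tpsum_genH_iff hG,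
    pleth_hSeries_eq_twoPowerProd_iff hzero', pleth_hSeries_mul_twoPowerProd_eq_one_iff hzero,
    eq_one_sub_iff_of_mul_eq_one ((mul_comm _ _).trans (pleth_eSeries_mul_hpm hzero)),
    pleth_eSeries_altOmega_eq_iff hF]
  tfae_finish

/-! ### Characters of induced representations -/

section Averaging

variable {k G V M : Type*} [CommRing k] [Group G] [Fintype G]
  [AddCommGroup V] [Module k V] [AddCommGroup M] [Module k M]

open scoped MonoidAlgebra in
theorem trace_of_forall_single {G : Type*} [Fintype G] [DecidableEq G]
    (f : k[G] →ₗ[k] k[G]) (φ : G → G)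
    (h : ∀ x, f (MonoidAlgebra.single x 1) = MonoidAlgebra.single (φ x) 1) :
    LinearMap.trace k _ f = ∑ x : G, if φ x = x then 1 else 0 := by
  rw [LinearMap.trace_eq_matrix_trace k (MonoidAlgebra.basis G k), Matrix.trace]
  refine Finset.sum_congr rfl fun x _ => ?_
  rw [Matrix.diag_apply, LinearMap.toMatrix_apply]
  change MonoidAlgebra.coeff (f (MonoidAlgebra.single x 1)) x = _
  rw [h, MonoidAlgebra.coeff_single, Finsupp.single_apply]

theorem averageMap_comp [Invertible (Fintype.card G : k)] (ρ : Representation k G V) (g : G) :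
    ρ.averageMap ∘ₗ ρ g = ρ.averageMap := by
  change ρ.asAlgebraHom (GroupAlgebra.average k G) * ρ g = _
  rw [← ρ.asAlgebraHom_single_one, ← map_mul, GroupAlgebra.mul_average_right]
  rfl

theorem averageMap_eq_smul_sum [Invertible (Fintype.card G : k)] (ρ : Representation k G V) :
    ρ.averageMap = ⅟(Fintype.card G : k) • ∑ g, ρ g := by
  rw [Representation.averageMap, GroupAlgebra.average, map_smul, map_sum]
  simp only [MonoidAlgebra.of_apply, ρ.asAlgebraHom_single_one]

theorem mk_comp_averageMap [Invertible (Fintype.card G : k)] (ρ : Representation k G V) :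
    Representation.Coinvariants.mk ρ ∘ₗ ρ.averageMap = Representation.Coinvariants.mk ρ := by
  ext v
  simp only [averageMap_eq_smul_sum, LinearMap.comp_apply, LinearMap.smul_apply,
    LinearMap.sum_apply, map_smul, map_sum, Representation.Coinvariants.mk_self_apply,
    Finset.sum_const, Finset.card_univ]
  rw [← Nat.cast_smul_eq_nsmul k, invOf_smul_smul]

theorem sum_ite_mul_mul_inv_smul [DecidableEq G] {f : G → M}
    (hf : ∀ g h, IsConj g h → f g = f h) (g : G) :
    ∑ h, (∑ x : G, if g * x * h⁻¹ = x then (1 : k) else 0) • f h = (Fintype.card G : k) • f g := by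
  have hx (x : G) : ∑ h, (if g * x * h⁻¹ = x then (1 : k) else 0) • f h = f g := by
    have hiff (h : G) : g * x * h⁻¹ = x ↔ x⁻¹ * g * x = h := by
      rw [mul_inv_eq_iff_eq_mul, mul_assoc x⁻¹, inv_mul_eq_iff_eq_mul]
    simp only [hiff, ite_smul, one_smul, zero_smul, Finset.sum_ite_eq, Finset.mem_univ, if_true]
    exact hf _ _ (isConj_iff.2 ⟨x, by group⟩)
  simp only [Finset.sum_smul]
  rw [Finset.sum_comm, Fintype.sum_congr _ _ hx, Finset.sum_const, Finset.card_univ,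
    Nat.cast_smul_eq_nsmul]

end Averaging

section Induced

variable {k G H V M : Type*} [Field k] [Group G] [Fintype G] [Group H] [Fintype H]
  [AddCommGroup V] [Module k V] [AddCommGroup M] [Module k M]

theorem character_leftRegular [DecidableEq G] (g : G) :
    (Representation.leftRegular k G).character g = if g = 1 then (Fintype.card G : k) else 0 := by
  rw [Representation.character, trace_of_forall_single _ (fun x => g * x) fun x => by simp]
  simp only [mul_eq_right, Finset.sum_ite_irrel, Finset.sum_const, Finset.card_univ, nsmul_eq_mul,
    mul_one, smul_zero]

theorem trace_coinvariants [Invertible (Fintype.card G : k)] [Module.Finite k V]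
    (ρ : Representation k G V) (f : V →ₗ[k] V) (F : ρ.Coinvariants →ₗ[k] ρ.Coinvariants)
    (hF : F ∘ₗ Representation.Coinvariants.mk ρ = Representation.Coinvariants.mk ρ ∘ₗ f) :
    LinearMap.trace k _ F = ⅟(Fintype.card G : k) * ∑ g, LinearMap.trace k V (f ∘ₗ ρ g) := by
  let s := Representation.Coinvariants.lift ρ ρ.averageMap (averageMap_comp ρ)
  have hs : Representation.Coinvariants.mk ρ ∘ₗ s = LinearMap.id :=
    Representation.Coinvariants.hom_ext (mk_comp_averageMap ρ)
  have hF' : F = Representation.Coinvariants.mk ρ ∘ₗ (f ∘ₗ s) := by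
    rw [← LinearMap.comp_assoc, ← hF, LinearMap.comp_assoc, hs, LinearMap.comp_id]
  calc
    LinearMap.trace k _ F = LinearMap.trace k V (f ∘ₗ ρ.averageMap) := by
      rw [hF', LinearMap.trace_comp_comm', LinearMap.comp_assoc,
        Representation.Coinvariants.lift_comp_mk]
    _ = _ := by
      rw [averageMap_eq_smul_sum, LinearMap.comp_smul, map_smul, smul_eq_mul,
        ← Module.End.mul_eq_comp, Finset.mul_sum, map_sum]
      rfl

theorem character_ind [Invertible (Fintype.card G : k)] [DecidableEq H] [Module.Finite k V]
    (φ : G →* H) (ρ : Representation k G V) (h : H) :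
    (Representation.ind φ ρ).character h = ⅟(Fintype.card G : k) *
      ∑ g, (∑ x : H, if φ g * x * h⁻¹ = x then 1 else 0) * ρ.character g := by
  rw [Representation.character, trace_coinvariants _
    ((MonoidAlgebra.mapDomainLinearMap k k fun x => x * h⁻¹).rTensor V) _ rfl]
  congr 1
  refine Finset.sum_congr rfl fun g _ => ?_
  rw [Representation.tprod_apply, LinearMap.rTensor_comp_map, LinearMap.trace_tensorProduct',
    trace_of_forall_single _ fun x => φ g * x * h⁻¹]
  · rfl
  · intro x
    simp [mul_assoc]

theorem sum_character_ind_smul [Invertible (Fintype.card G : k)] [Invertible (Fintype.card H : k)]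
    [Module.Finite k V] (φ : G →* H) (ρ : Representation k G V) {f : H → M}
    (hf : ∀ g h, IsConj g h → f g = f h) :
    ⅟(Fintype.card H : k) • ∑ h, (Representation.ind φ ρ).character h • f h =
      ⅟(Fintype.card G : k) • ∑ g, ρ.character g • f (φ g) := by
  classical
  simp only [character_ind, mul_smul, ← Finset.smul_sum, Finset.sum_smul]
  rw [smul_comm, Finset.sum_comm]
  simp only [smul_comm _ (ρ.character _), ← Finset.smul_sum, ← Finset.sum_smul,
    sum_ite_mul_mul_inv_smul hf]
  congr 1
  rw [Finset.smul_sum]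
  refine Finset.sum_congr rfl fun g _ => ?_
  rw [smul_comm (ρ.character g), invOf_smul_smul]

end Induced

theorem ch_eq_sum_character {n : ℕ} {V : Type*} [AddCommGroup V] [Module ℂ V]
    (ρ : Representation ℂ (Equiv.Perm (Fin n)) V) :
    ch ρ = (Fintype.card (Equiv.Perm (Fin n)) : ℂ)⁻¹ •
      ∑ σ, ρ.character σ • psumPart σ.partition := by
  have hcard : Fintype.card (Equiv.Perm (Fin n)) = n.factorial := by
    rw [Fintype.card_perm, Fintype.card_fin]
  rw [hcard]
  rfl

theorem ch_ind {n : ℕ} {G V : Type*} [Group G] [Fintype G] [AddCommGroup V] [Module ℂ V]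
    [Module.Finite ℂ V] (φ : G →* Equiv.Perm (Fin n)) (ρ : Representation ℂ G V) :
    ch (Representation.ind φ ρ) =
      (Fintype.card G : ℂ)⁻¹ • ∑ g, ρ.character g • psumPart (φ g).partition := by
  let := invertibleOfNonzero (Nat.cast_ne_zero.2 (Fintype.card_ne_zero (α := G)) : (_ : ℂ) ≠ 0)
  let := invertibleOfNonzero
    (Nat.cast_ne_zero.2 (Fintype.card_ne_zero (α := Equiv.Perm (Fin n))) : (_ : ℂ) ≠ 0)
  rw [ch_eq_sum_character, ← invOf_eq_inv, ← invOf_eq_inv]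
  exact sum_character_ind_smul φ ρ fun σ τ h => by rw [Equiv.Perm.partition_eq_of_isConj.1 h]

theorem ch_leftRegular (n : ℕ) :
    ch (Representation.leftRegular ℂ (Equiv.Perm (Fin n))) = psum 1 ^ n := by
  have hone : psumPart (1 : Equiv.Perm (Fin n)).partition = psum 1 ^ n := by
    rw [psumPart, Equiv.Perm.parts_partition, Equiv.Perm.cycleType_one, Equiv.Perm.support_one]
    simp
  rw [ch_eq_sum_character]
  simp only [character_leftRegular, ite_smul, zero_smul, Finset.sum_ite_eq', Finset.mem_univ,
    if_true, hone]
  exact inv_smul_smul₀ (Nat.cast_ne_zero.2 Fintype.card_ne_zero) _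

theorem isSymmSeries_ch {n : ℕ} {V : Type*} [AddCommGroup V] [Module ℂ V]
    (ρ : Representation ℂ (Equiv.Perm (Fin n)) V) : IsSymmSeries (ch ρ) :=
  .smul _ <| Finset.sum_induction _ _ (fun _ _ => .add) isSymmSeries_zero
    fun σ _ => .smul _ (isSymmSeries_psumMul σ.partition.parts)

theorem isHomogeneous_ch {n : ℕ} {V : Type*} [AddCommGroup V] [Module ℂ V]
    (ρ : Representation ℂ (Equiv.Perm (Fin n)) V) : (ch ρ).IsHomogeneous n := by
  have hσ (σ : Equiv.Perm (Fin n)) : (psumPart σ.partition).IsHomogeneous n := by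
    have h : (psumPart σ.partition).IsHomogeneous σ.partition.parts.sum :=
      isHomogeneous_psumMul σ.partition.parts
    rwa [σ.partition.parts_sum.trans (Fintype.card_fin n)] at h
  apply isHomogeneous_smul
  apply isHomogeneous_sum
  exact fun σ _ => isHomogeneous_smul _ (hσ σ)

/-! ### Combinations of the operators `p_k[·]` -/

theorem finsum_pnat_eq_sum_divisors {M : Type*} [AddCommMonoid M] {f : ℕ → M} {n : ℕ} (hn : n ≠ 0)
    (hf : ∀ k, ¬ k ∣ n → f k = 0) : ∑ᶠ k : ℕ+, f k = ∑ k ∈ n.divisors, f k := by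
  rw [← finsum_mem_range (f := f) PNat.coe_injective]
  refine finsum_mem_eq_sum_of_inter_support_eq f (Set.ext fun k => and_congr_left fun hk => ?_)
  have hdvd : k ∣ n := not_imp_comm.1 (hf k) hk
  exact iff_of_true ⟨⟨k, Nat.pos_of_dvd_of_pos hdvd (Nat.pos_of_ne_zero hn)⟩, rfl⟩
    (Nat.mem_divisors.2 ⟨hdvd, hn⟩)

theorem exists_coeff_psumPlethSum_eq_sum {g : Ser} (hg : constantCoeff g = 0) (e : ℕ →₀ ℕ) :
    ∃ s : Finset ℕ+, ∀ w, coeff e (psumPlethSum w g) = ∑ k ∈ s, w k * coeff e (psumPleth k g) :=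
  ⟨((hasSubst_psumPleth hg).coeff_zero e).toFinset, fun w => by
    rw [coeff_psumPlethSum w hg]
    exact finsum_eq_sum_of_support_subset _ fun k hk =>
      (Set.Finite.mem_toFinset _).2 (right_ne_zero_of_mul hk)⟩

theorem psumPlethSum_add_smul (v w : ℕ+ → ℂ) (c : ℂ) {g : Ser} (hg : constantCoeff g = 0) :
    psumPlethSum (v + c • w) g = psumPlethSum v g + c • psumPlethSum w g := by
  ext e
  obtain ⟨s, hs⟩ := exists_coeff_psumPlethSum_eq_sum hg e
  simp only [map_add, coeff_smul, hs, Pi.add_apply, Pi.smul_apply, smul_eq_mul, add_mul,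
    Finset.sum_add_distrib, Finset.mul_sum, mul_assoc]

theorem psumPlethSum_arithmeticFunction_one {g : Ser} (hg : constantCoeff g = 0) :
    psumPlethSum (fun k => (1 : ArithmeticFunction ℂ) k) g = g := by
  ext e
  rw [coeff_psumPlethSum _ hg, finsum_eq_single _ 1]
  · rw [PNat.one_coe, ArithmeticFunction.one_one, one_mul, psumPleth]
    exact congrArg _ (expand_one_apply g)
  · intro k hk
    rw [ArithmeticFunction.one_apply_ne (PNat.coe_eq_one_iff.not.2 hk), zero_mul]

theorem psumPleth_psumPlethSum (i : ℕ+) (w : ℕ → ℂ) {g : Ser} (hg : constantCoeff g = 0) :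
    psumPleth i (psumPlethSum (fun k => w k) g) =
      psumPlethSum (fun k => if (i : ℕ) ∣ k then w (k / i) else 0) g := by
  have hig : constantCoeff (psumPleth i g) = 0 := (constantCoeff_psumPleth i g).trans hg
  have hcomm (k : ℕ+) : psumPleth i (psumPleth k g) = psumPleth k (psumPleth i g) := by
    rw [psumPleth_psumPleth, mul_comm, ← psumPleth_psumPleth]
  rw [psumPlethSum, psumPleth_subst i (hasSubst_psumPleth hg)]
  simp only [hcomm]
  rw [← psumPlethSum]
  ext e
  rw [coeff_psumPlethSum _ hig, coeff_psumPlethSum _ hg,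
    ← finsum_mem_univ fun k : ℕ+ => ite _ _ _ * _,
    finsum_mem_inter_support_eq' _ Set.univ (Set.range (i * ·)), finsum_mem_range]
  · refine finsum_congr fun k => ?_
    rw [PNat.mul_coe, if_pos (dvd_mul_right _ _), Nat.mul_div_cancel_left _ i.pos,
      ← hcomm, psumPleth_psumPleth]
  · exact mul_right_injective i
  · intro k hk
    refine iff_of_true (Set.mem_univ k) ?_
    obtain ⟨l, hl⟩ := PNat.dvd_iff.2 (ite_ne_right_iff.1 (left_ne_zero_of_mul hk)).1
    exact ⟨l, hl.symm⟩

theorem psumPlethSum_psumPlethSum (v w : ArithmeticFunction ℂ) {g : Ser}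
    (hg : constantCoeff g = 0) :
    psumPlethSum (fun k => v k) (psumPlethSum (fun k => w k) g) =
      psumPlethSum (fun k => (v * w) k) g := by
  ext e
  obtain ⟨s, hs⟩ := exists_coeff_psumPlethSum_eq_sum hg e
  have hconv (m : ℕ+) (a : ℂ) :
      ∑ᶠ k : ℕ+, v k * ((if (k : ℕ) ∣ m then w (m / k) else 0) * a) = (v * w) m * a := by
    rw [finsum_pnat_eq_sum_divisors (f := fun k => v k * ((if k ∣ m then w (m / k) else 0) * a))
      m.ne_zero fun k hk => by rw [if_neg hk, zero_mul, mul_zero], ArithmeticFunction.mul_apply,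
      Nat.sum_divisorsAntidiagonal fun k l => v k * w l, Finset.sum_mul]
    exact Finset.sum_congr rfl fun k hk => by rw [if_pos (Nat.dvd_of_mem_divisors hk), mul_assoc]
  rw [coeff_psumPlethSum _ (constantCoeff_psumPlethSum _ hg), hs]
  simp only [psumPleth_psumPlethSum _ _ hg, hs, Finset.mul_sum]
  rw [finsum_sum_comm]
  · exact Finset.sum_congr rfl fun m _ => hconv m _
  · intro m _
    refine ((Nat.divisors m).finite_toSet.preimage PNat.coe_injective.injOn).subset fun k hk => ?_
    exact Nat.mem_divisors.2
      ⟨(ite_ne_right_iff.1 (left_ne_zero_of_mul (right_ne_zero_of_mul hk))).1, m.ne_zero⟩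

theorem psumPlethSum_sumPos_pow (w : ℕ → ℂ) : psumPlethSum (fun k => w k) (sumPos (psum 1 ^ ·)) =
    sumPos fun n => ∑ d ∈ n.divisors, w d • psum d ^ (n / d) := by
  have hterm (k : ℕ+) (e : ℕ →₀ ℕ) (he : e.degree ≠ 0) :
      coeff e (psumPleth k (sumPos (psum 1 ^ ·))) =
        if (k : ℕ) ∣ e.degree then coeff e (psum k ^ (e.degree / k)) else 0 := by
    have hpow (n : ℕ) : psum k ^ n = psumPleth k (psum 1 ^ n) := by
      rw [psumPleth, map_pow, ← psumPleth, psumPleth_psum, mul_one]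
    obtain ⟨m, rfl⟩ | hzero := exists_eq_smul_or_coeff_expand_eq_zero (R := ℂ) k.ne_zero e
    · rw [map_nsmul, smul_eq_mul] at he ⊢
      rw [if_pos (dvd_mul_right _ _), Nat.mul_div_cancel_left _ k.pos, hpow, psumPleth, psumPleth,
        coeff_expand_smul, coeff_expand_smul, coeff_sumPos _ (right_ne_zero_of_mul he)]
    · rw [hpow, psumPleth, psumPleth, hzero, hzero, ite_self]
  ext e
  by_cases he : e.degree = 0
  · rw [(Finsupp.degree_eq_zero_iff e).1 he, coeff_zero_eq_constantCoeff_apply,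
      coeff_zero_eq_constantCoeff_apply, constantCoeff_psumPlethSum _ (constantCoeff_sumPos _),
      constantCoeff_sumPos]
  · rw [coeff_psumPlethSum _ (constantCoeff_sumPos _), coeff_sumPos _ he]
    simp only [hterm _ _ he]
    rw [finsum_pnat_eq_sum_divisors
      (f := fun k => w k * if k ∣ e.degree then coeff e (psum k ^ (e.degree / k)) else 0) he
      fun k hk => by rw [if_neg hk, mul_zero], map_sum]
    exact Finset.sum_congr rfl fun k hk => by
      rw [if_pos (Nat.dvd_of_mem_divisors hk), coeff_smul]

theorem sumPos_psum_one_pow_mul : sumPos (psum 1 ^ ·) * (1 - psum 1) = psum 1 := by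
  have hsum : (1 + sumPos (psum 1 ^ ·)) * (1 - psum 1) = 1 := by
    refine forall_homogeneousComponent_eq_pow_iff.1 fun n => ?_
    rw [map_add, homogeneousComponent_of_isHomogeneous isHomogeneous_one]
    split_ifs with hn
    · rw [hn, pow_zero,
        homogeneousComponent_zero_of_constantCoeff_eq_zero (constantCoeff_sumPos _), add_zero]
    · rw [zero_add]
      apply homogeneousComponent_sumPos hn
      have hpow : (psum 1 ^ n).IsHomogeneous (n * 1) := isHomogeneous_pow (isHomogeneous_psum 1) n
      rwa [mul_one] at hpow
  linear_combination hsum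

theorem euler_mul_one_sub_psum_one (f : Ser) :
    euler (f * (1 - psum 1)) = euler f * (1 - psum 1) - f * psum 1 := by
  rw [Derivation.leibniz, map_sub, Derivation.map_one_eq_zero,
    euler_of_isHomogeneous (isHomogeneous_psum 1), Nat.cast_one, one_smul, smul_eq_mul, smul_eq_mul]
  ring

section

variable {g : Ser} (hg : constantCoeff g = 0)
include hg

theorem pleth_hSeries_mul_one_sub_psum_one
    (h : psumPlethSum 1 (euler g) = sumPos (psum 1 ^ ·)) :
    pleth hSeries g * (1 - psum 1) = 1 := by
  apply eq_of_euler_eq_mul (N := 0) (map_zero _)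
  · rw [euler_mul_one_sub_psum_one, euler_pleth_hSeries hg, h]
    linear_combination pleth hSeries g * sumPos_psum_one_pow_mul
  · rw [Derivation.map_one_eq_zero, zero_mul]
  · rw [map_mul, constantCoeff_pleth_hSeries hg, constantCoeff_one_sub_psum_one, mul_one, map_one]

theorem pleth_eSeries_mul_one_sub_psum_one
    (h : psumPlethSum 1 (euler g) =
      sumPos (psum 1 ^ ·) + (2 : ℂ) • psumPleth 2 (psumPlethSum 1 (euler g))) :
    pleth eSeries g * (1 - psum 1) = 1 := by
  have heuler := euler_pleth_hSeries hg
  have hzero := constantCoeff_psumPlethSum 1 (constantCoeff_euler g)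
  set M := psumPlethSum 1 (euler g)
  have hmul : pleth hSeries g * (1 - psum 1) = psumPleth 2 (pleth hSeries g) := by
    apply eq_of_euler_eq_mul (N := (2 : ℂ) • psumPleth 2 M)
    · rw [← coeff_zero_eq_constantCoeff_apply, coeff_smul, coeff_zero_eq_constantCoeff_apply,
        constantCoeff_psumPleth, hzero, mul_zero]
    · rw [euler_mul_one_sub_psum_one, heuler]
      linear_combination pleth hSeries g * sumPos_psum_one_pow_mul +
        pleth hSeries g * (1 - psum 1) * h
    · rw [psumPleth, euler_expand, heuler, map_mul, smul_mul_assoc]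
      rfl
    · rw [constantCoeff_psumPleth, map_mul, constantCoeff_pleth_hSeries hg,
        constantCoeff_one_sub_psum_one, mul_one]
  have hne : psumPleth 2 (pleth hSeries g) ≠ 0 :=
    (map_ne_zero_iff _ (expand_injective _)).2 (pleth_hSeries_ne_zero hg)
  refine mul_right_cancel₀ hne ?_
  rw [one_mul, mul_right_comm, pleth_eSeries_mul hg, hmul]

end

/-! ### Representations induced from cyclic groups -/

theorem orderOf_finRotate {n : ℕ} (hn : n ≠ 0) : orderOf (finRotate n) = n := by
  rcases n with _ | _ | n
  · exact absurd rfl hn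
  · exact orderOf_eq_one_iff.2 (Subsingleton.elim (α := Equiv.Perm (Fin 1)) _ _)
  · rw [← Equiv.Perm.lcm_cycleType, cycleType_finRotate, Multiset.lcm_singleton, normalize_eq]

theorem orderOf_cycGen {n : ℕ} (hn : n ≠ 0) : orderOf (cycGen n) = n :=
  (Subgroup.orderOf_mk ..).trans (orderOf_finRotate hn)

theorem card_cyc {n : ℕ} (hn : n ≠ 0) : Nat.card (cyc n) = n :=
  (Nat.card_zpowers _).trans (orderOf_finRotate hn)

theorem eq_one_of_mem_cyc_of_apply_eq {n : ℕ} {σ : Equiv.Perm (Fin n)} (hσ : σ ∈ cyc n) {x : Fin n}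
    (hx : σ x = x) : σ = 1 := by
  obtain ⟨j, rfl⟩ := hσ
  match n, x with
  | 1, _ => exact Subsingleton.elim (α := Equiv.Perm (Fin 1)) _ _
  | n + 2, x =>
    have hne (y : Fin (n + 2)) : finRotate (n + 2) y ≠ y := by
      rw [← Equiv.Perm.mem_support, support_finRotate]
      exact Finset.mem_univ y
    exact Equiv.ext fun y => by
      obtain ⟨i, rfl⟩ := isCycle_finRotate.exists_zpow_eq (hne x) (hne y)
      simp only at hx ⊢
      rw [← Equiv.Perm.mul_apply, (Commute.refl _).zpow_zpow, Equiv.Perm.mul_apply, hx,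
        Equiv.Perm.one_apply]

theorem eq_orderOf_of_mem_cycleType {n : ℕ} {σ : Equiv.Perm (Fin n)} (hσ : σ ∈ cyc n) {m : ℕ}
    (hm : m ∈ σ.cycleType) : m = orderOf σ := by
  refine Nat.dvd_antisymm (Equiv.Perm.dvd_of_mem_cycleType hm) ?_
  rw [Equiv.Perm.cycleType_def, Multiset.mem_map] at hm
  obtain ⟨c, hc, rfl⟩ := hm
  rw [Finset.mem_val] at hc
  have hcycle := (Equiv.Perm.mem_cycleFactorsFinset_iff.1 hc).1
  obtain ⟨x, hx⟩ := hcycle.nonempty_support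
  refine orderOf_dvd_of_pow_eq_one (eq_one_of_mem_cyc_of_apply_eq (x := x) (pow_mem hσ _) ?_)
  rw [Function.comp_apply, ← hcycle.orderOf, ← Equiv.Perm.cycleOf_pow_apply_self,
    ← Equiv.Perm.cycle_is_cycleOf hx hc, pow_orderOf_eq_one, Equiv.Perm.one_apply]

theorem eq_orderOf_of_mem_parts_partition {n : ℕ} {σ : Equiv.Perm (Fin n)} (hσ : σ ∈ cyc n) {m : ℕ}
    (hm : m ∈ σ.partition.parts) : m = orderOf σ := by
  rw [Equiv.Perm.parts_partition, Multiset.mem_add] at hm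
  rcases hm with hm | hm
  · exact eq_orderOf_of_mem_cycleType hσ hm
  · obtain ⟨hcard, rfl⟩ := Multiset.mem_replicate.1 hm
    obtain ⟨x, hx⟩ : ∃ x, x ∉ σ.support := by
      by_contra! h
      rw [Finset.eq_univ_iff_forall.2 h, Finset.card_univ, Nat.sub_self] at hcard
      exact hcard rfl
    rw [eq_one_of_mem_cyc_of_apply_eq hσ (Equiv.Perm.notMem_support.1 hx), orderOf_one]

theorem psumPart_partition_of_mem_cyc {n : ℕ} {σ : Equiv.Perm (Fin n)} (hσ : σ ∈ cyc n) :
    psumPart σ.partition = psum (orderOf σ) ^ (n / orderOf σ) := by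
  have hparts := Multiset.eq_replicate_card.2 fun _ => eq_orderOf_of_mem_parts_partition hσ
  have hcard : σ.partition.parts.card * orderOf σ = n := by
    rw [← smul_eq_mul, ← Multiset.sum_replicate, ← hparts]
    exact σ.partition.parts_sum.trans (Fintype.card_fin n)
  rw [psumPart, hparts, Multiset.map_replicate, Multiset.prod_replicate,
    Nat.div_eq_of_eq_mul_left (orderOf_pos σ) hcard.symm]

theorem rootExp_pow_div_eq_one_iff {n r d : ℕ} (hn : n ≠ 0) (hd : d ∣ n) :
    rootExp n r ^ (n / d) = 1 ↔ d ∣ r := by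
  obtain ⟨m, rfl⟩ := hd
  have hd0 : (d : ℂ) ≠ 0 := Nat.cast_ne_zero.2 (left_ne_zero_of_mul hn)
  have hm0 : (m : ℂ) ≠ 0 := Nat.cast_ne_zero.2 (right_ne_zero_of_mul hn)
  have hexp : (m : ℂ) * (2 * Real.pi * Complex.I / (d * m : ℕ) * r) =
      r / d * (2 * Real.pi * Complex.I) := by
    push_cast
    field_simp
  rw [Nat.mul_div_cancel_left _ (Nat.pos_of_ne_zero (left_ne_zero_of_mul hn)), Units.ext_iff,
    Units.val_pow_eq_pow_val, rootExp, Units.val_mk0, Units.val_one, ← Complex.exp_nat_mul, hexp,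
    Complex.exp_eq_one_iff, ← Int.natCast_dvd_natCast]
  simp only [mul_left_inj' Complex.two_pi_I_ne_zero, div_eq_iff hd0]
  refine exists_congr fun a => ?_
  rw [mul_comm (a : ℂ)]
  exact_mod_cast Iff.rfl

theorem pow_eq_one_iff_mem_zpowers {n d : ℕ} (hn : n ≠ 0) (hd : d ∣ n) (x : cyc n) :
    x ^ d = 1 ↔ x ∈ Subgroup.zpowers (cycGen n ^ (n / d)) := by
  obtain ⟨m, rfl⟩ := hd
  have hd0 : d ≠ 0 := left_ne_zero_of_mul hn
  have hgen : (cycGen (d * m) ^ m) ^ d = 1 := by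
    rw [← pow_mul, ← orderOf_dvd_iff_pow_eq_one, orderOf_cycGen hn, mul_comm]
  rw [Nat.mul_div_cancel_left _ (Nat.pos_of_ne_zero hd0)]
  constructor
  · obtain ⟨j, rfl⟩ := mem_zpowers_cycGen (d * m) x
    intro h
    rw [← zpow_natCast, ← zpow_mul, ← orderOf_dvd_iff_zpow_eq_one, orderOf_cycGen hn,
      Nat.cast_mul, mul_comm] at h
    obtain ⟨i, rfl⟩ := Int.dvd_of_mul_dvd_mul_right (Nat.cast_ne_zero.2 hd0) h
    exact ⟨i, by simp only [← zpow_natCast, ← zpow_mul]⟩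
  · rintro ⟨i, rfl⟩
    rw [← zpow_natCast, zpow_comm, zpow_natCast, hgen, one_zpow]

theorem sum_divisors_sum_orderOf_eq {G M : Type*} [Group G] [Fintype G] [DecidableEq G]
    [AddCommMonoid M] (f : G → M) {n : ℕ} (hn : n ≠ 0) :
    ∑ d ∈ n.divisors, ∑ x with orderOf x = d, f x = ∑ x with x ^ n = 1, f x := by
  have hmaps : ∀ x ∈ Finset.univ.filter fun x : G => x ^ n = 1, orderOf x ∈ n.divisors := by
    intro x hx
    rw [Finset.mem_filter_univ, ← orderOf_dvd_iff_pow_eq_one] at hx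
    exact Nat.mem_divisors.2 ⟨hx, hn⟩
  rw [← Finset.sum_fiberwise_of_maps_to hmaps]
  refine Finset.sum_congr rfl fun d hd => Finset.sum_congr ?_ fun _ _ => rfl
  ext x
  simp only [Finset.mem_filter, Finset.mem_univ, true_and, ← orderOf_dvd_iff_pow_eq_one]
  exact ⟨fun h => ⟨h ▸ Nat.dvd_of_mem_divisors hd, h⟩, And.right⟩

open Classical in
theorem sum_cycChar_of_pow_eq_one {n d : ℕ} (hn : n ≠ 0) (hd : d ∣ n) (r : ℕ) :
    ∑ x : cyc n with x ^ d = 1, (cycChar n r x : ℂ) = if d ∣ r then (d : ℂ) else 0 := by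
  let A : Subgroup (cyc n) := Subgroup.zpowers (cycGen n ^ (n / d))
  let χ : A →* ℂ := ((Units.coeHom ℂ).comp (cycChar n r)).comp A.subtype
  have hsum : ∑ x : cyc n with x ^ d = 1, (cycChar n r x : ℂ) = ∑ x : A, χ x :=
    Finset.sum_subtype _ (fun x =>
      (Finset.mem_filter_univ x).trans (pow_eq_one_iff_mem_zpowers hn hd x)) _
  have hχ : χ = 1 ↔ d ∣ r := by
    rw [← rootExp_pow_div_eq_one_iff hn hd, ← cycChar_gen, ← map_pow]
    constructor
    · exact fun h => Units.ext
        (DFunLike.congr_fun h (⟨cycGen n ^ (n / d), Subgroup.mem_zpowers _⟩ : A))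
    · intro h
      ext ⟨_, i, rfl⟩
      exact congrArg Units.val (by rw [map_zpow, h, one_zpow] :
        cycChar n r ((cycGen n ^ (n / d)) ^ i) = 1)
  have hcard : Fintype.card A = d := by
    rw [← Nat.card_eq_fintype_card, Nat.card_zpowers, orderOf_pow, orderOf_cycGen hn,
      Nat.gcd_eq_right (Nat.div_dvd_of_dvd hd), Nat.div_div_self hd hn]
  rw [hsum, sum_hom_units, hcard]
  simp only [hχ, Nat.cast_ite, Nat.cast_zero]

open Classical in
/-- The sum of the character `cycChar n r` over the elements of order `d` of `C_n`. It is `0`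
unless `d` divides `n`, and a Ramanujan sum if it does. -/
def charSum (n r d : ℕ) : ℂ := ∑ x : cyc n with orderOf x = d, (cycChar n r x : ℂ)

theorem sum_divisors_charSum {n d : ℕ} (hn : n ≠ 0) (hd : d ∣ n) (r : ℕ) :
    ∑ i ∈ d.divisors, charSum n r i = if d ∣ r then (d : ℂ) else 0 := by
  classical
  rw [← sum_cycChar_of_pow_eq_one hn hd]
  exact sum_divisors_sum_orderOf_eq _ (ne_zero_of_dvd_ne_zero hn hd)

theorem charSum_eq_moebius_mul {n r : ℕ} (hn : n ≠ 0) {K : ArithmeticFunction ℂ}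
    (hK : ∀ d, d ∣ n → K d = if d ∣ r then (d : ℂ) else 0) {d : ℕ} (hd : d ∣ n) :
    charSum n r d = ((ArithmeticFunction.moebius : ArithmeticFunction ℂ) * K) d := by
  have hinv := (ArithmeticFunction.sum_eq_iff_sum_mul_moebius_eq_on (f := charSum n r) (g := K)
    {d | d ∣ n} fun _ _ => dvd_trans).1
    (fun d _ hd => (sum_divisors_charSum hn hd r).trans (hK d hd).symm) d
    (Nat.pos_of_dvd_of_pos hd (Nat.pos_of_ne_zero hn)) hd
  simp only [ArithmeticFunction.mul_apply, ArithmeticFunction.intCoe_apply, hinv]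

theorem character_cycRep (n r : ℕ) (x : cyc n) : (cycRep n r).character x = cycChar n r x :=
  Algebra.trace_self_apply (R := ℂ) (cycChar n r x : ℂ)

theorem card_smul_ch_cycInd {n : ℕ} (hn : n ≠ 0) (r : ℕ) :
    (n : ℂ) • ch (cycInd n r) = ∑ d ∈ n.divisors, charSum n r d • psum d ^ (n / d) := by
  classical
  have hcard : Fintype.card (cyc n) = n := Nat.card_eq_fintype_card.symm.trans (card_cyc hn)
  rw [cycInd, ch_ind, hcard, smul_inv_smul₀ (Nat.cast_ne_zero.2 hn),
    ← Finset.sum_fiberwise_of_maps_to (g := orderOf) (t := n.divisors)]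
  · refine Finset.sum_congr rfl fun d _ => ?_
    rw [charSum, Finset.sum_smul]
    refine Finset.sum_congr rfl fun x hx => ?_
    rw [Subgroup.subtype_apply, psumPart_partition_of_mem_cyc x.2, Subgroup.orderOf_coe,
      (Finset.mem_filter.1 hx).2, character_cycRep]
  · exact fun x _ => Nat.mem_divisors.2 ⟨(orderOf_dvd_natCard x).trans (card_cyc hn).dvd, hn⟩

theorem euler_sumPos_ch_cycInd {r : ℕ → ℕ} {K : ArithmeticFunction ℂ}
    (hK : ∀ n d, n ≠ 0 → d ∣ n → K d = if d ∣ r n then (d : ℂ) else 0) :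
    euler (sumPos fun n => ch (cycInd n (r n))) =
      psumPlethSum (fun k => ((ArithmeticFunction.moebius : ArithmeticFunction ℂ) * K) k)
        (sumPos (psum 1 ^ ·)) := by
  rw [psumPlethSum_sumPos_pow]
  ext e
  by_cases he : e.degree = 0
  · rw [coeff_euler, he, Nat.cast_zero, zero_mul, (Finsupp.degree_eq_zero_iff e).1 he,
      coeff_zero_eq_constantCoeff_apply, constantCoeff_sumPos]
  · rw [coeff_euler, coeff_sumPos _ he, coeff_sumPos _ he, ← coeff_smul, card_smul_ch_cycInd he]
    exact congrArg _ (Finset.sum_congr rfl fun d hd => by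
      rw [charSum_eq_moebius_mul he (hK _ · he) (Nat.dvd_of_mem_divisors hd)])

theorem psumPlethSum_euler_sumPos_ch_cycInd {r : ℕ → ℕ} {K : ArithmeticFunction ℂ}
    (hK : ∀ n d, n ≠ 0 → d ∣ n → K d = if d ∣ r n then (d : ℂ) else 0) :
    psumPlethSum 1 (euler (sumPos fun n => ch (cycInd n (r n)))) =
      psumPlethSum (fun k => K k) (sumPos (psum 1 ^ ·)) := by
  have hzeta : (1 : ℕ+ → ℂ) = fun k : ℕ+ => (ArithmeticFunction.zeta : ArithmeticFunction ℂ) k :=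
    funext fun k => by
      rw [ArithmeticFunction.natCoe_apply, ArithmeticFunction.zeta_apply_ne k.ne_zero,
        Nat.cast_one, Pi.one_apply]
  rw [euler_sumPos_ch_cycInd hK, hzeta, psumPlethSum_psumPlethSum _ _ (constantCoeff_sumPos _),
    ← mul_assoc, ArithmeticFunction.coe_zeta_mul_coe_moebius, one_mul]

theorem isGraded_ch_cycInd (r : ℕ → ℕ) : IsGraded fun n => ch (cycInd n (r n)) :=
  fun _ _ => ⟨isSymmSeries_ch _, isHomogeneous_ch _⟩

theorem ch_cycInd_one (r : ℕ) : ch (cycInd 1 r) = psum 1 := by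
  have hsum := sum_divisors_charSum one_ne_zero (dvd_refl 1) r
  have h := card_smul_ch_cycInd one_ne_zero r
  rw [Nat.divisors_one, Finset.sum_singleton] at hsum h
  rwa [hsum, if_pos (one_dvd r), Nat.cast_one, one_smul, one_smul, Nat.div_self one_pos,
    pow_one] at h

theorem pleth_hSeries_LieSym : pleth hSeries (sumPos LieSym) * (1 - psum 1) = 1 := by
  have hK (n d : ℕ) (_ : n ≠ 0) (_ : d ∣ n) :
      (1 : ArithmeticFunction ℂ) d = if d ∣ 1 then (d : ℂ) else 0 := by
    rw [ArithmeticFunction.one_apply]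
    simp only [Nat.dvd_one]
    split_ifs with hd
    · rw [hd, Nat.cast_one]
    · rfl
  exact pleth_hSeries_mul_one_sub_psum_one (constantCoeff_sumPos _)
    ((psumPlethSum_euler_sumPos_ch_cycInd (r := fun _ => 1) hK).trans
      (psumPlethSum_arithmeticFunction_one (constantCoeff_sumPos _)))

theorem dvd_two_pow_padicValNat_iff {n d : ℕ} (hn : n ≠ 0) (hd : d ∣ n) :
    d ∣ 2 ^ padicValNat 2 n ↔ ∃ a, d = 2 ^ a := by
  constructor
  · intro h
    obtain ⟨a, -, ha⟩ := (Nat.dvd_prime_pow Nat.prime_two).1 h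
    exact ⟨a, ha⟩
  · rintro ⟨a, rfl⟩
    exact pow_dvd_pow 2 ((padicValNat_dvd_iff_le hn).1 hd)

open Classical in
/-- The arithmetic function that is the identity on the powers of `2` and `0` elsewhere. -/
def twoPowId : ArithmeticFunction ℂ where
  toFun d := if ∃ a, d = 2 ^ a then (d : ℂ) else 0
  map_zero' := by rw [Nat.cast_zero, ite_self]

open Classical in
theorem twoPowId_apply (d : ℕ) : twoPowId d = if ∃ a, d = 2 ^ a then (d : ℂ) else 0 := rfl

theorem exists_two_mul_eq_two_pow_iff {d : ℕ} : (∃ a, 2 * d = 2 ^ a) ↔ ∃ a, d = 2 ^ a := by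
  constructor
  · rintro ⟨_ | a, ha⟩
    · omega
    · exact ⟨a, Nat.eq_of_mul_eq_mul_left two_pos (ha.trans (pow_succ' 2 a))⟩
  · rintro ⟨a, rfl⟩
    exact ⟨a + 1, (pow_succ' 2 a).symm⟩

theorem twoPowId_eq (d : ℕ) : twoPowId d =
    (1 : ArithmeticFunction ℂ) d + 2 * if 2 ∣ d then twoPowId (d / 2) else 0 := by
  classical
  by_cases hd : 2 ∣ d
  · obtain ⟨d, rfl⟩ := hd
    rw [if_pos (dvd_mul_right 2 d), Nat.mul_div_cancel_left d two_pos, twoPowId_apply,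
      twoPowId_apply, ArithmeticFunction.one_apply_ne (by omega), zero_add, mul_ite, mul_zero,
      Nat.cast_mul, Nat.cast_ofNat]
    exact if_congr exists_two_mul_eq_two_pow_iff rfl rfl
  · have hpow : (∃ a, d = 2 ^ a) ↔ d = 1 := by
      constructor
      · rintro ⟨_ | a, rfl⟩
        · rfl
        · exact absurd (dvd_pow_self 2 a.succ_ne_zero) hd
      · exact fun h => ⟨0, h⟩
    rw [if_neg hd, mul_zero, add_zero, twoPowId_apply, ArithmeticFunction.one_apply]
    simp only [hpow]
    split_ifs with h
    · rw [h, Nat.cast_one]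
    · rfl

theorem pleth_eSeries_LieTwoSym : pleth eSeries (sumPos LieTwoSym) * (1 - psum 1) = 1 := by
  have hK (n d : ℕ) (hn : n ≠ 0) (hd : d ∣ n) :
      twoPowId d = if d ∣ 2 ^ padicValNat 2 n then (d : ℂ) else 0 := by
    classical
    exact (twoPowId_apply d).trans (if_congr (dvd_two_pow_padicValNat_iff hn hd).symm rfl rfl)
  have hsum : psumPlethSum 1 (euler (sumPos LieTwoSym)) = _ :=
    psumPlethSum_euler_sumPos_ch_cycInd (r := fun n => 2 ^ padicValNat 2 n) hK
  have hrec : (fun k : ℕ+ => twoPowId k) = (fun k : ℕ+ => (1 : ArithmeticFunction ℂ) k) +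
      (2 : ℂ) • fun k : ℕ+ => if ((2 : ℕ+) : ℕ) ∣ k then twoPowId (k / (2 : ℕ+)) else 0 :=
    funext fun k => twoPowId_eq k
  have hzero := constantCoeff_sumPos (psum 1 ^ ·)
  apply pleth_eSeries_mul_one_sub_psum_one (constantCoeff_sumPos _)
  rw [hsum, psumPleth_psumPlethSum 2 twoPowId hzero]
  conv_lhs => rw [hrec]
  rw [psumPlethSum_add_smul _ _ _ hzero, psumPlethSum_arithmeticFunction_one hzero]

end

end PlethLie

theorem mainTheorem1 :
    -- `p₁ⁿ` is the characteristic of the regular representation of `S_n`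
    (∀ n : ℕ, ch (Representation.leftRegular ℂ (Equiv.Perm (Fin n))) = psum 1 ^ n) ∧
    -- the regular representation as the sum of the exterior powers of `Lie^(2)`
    (∀ n : ℕ, ∑ μ : n.Partition, Epart LieTwoSym μ =
      ch (Representation.leftRegular ℂ (Equiv.Perm (Fin n)))) ∧
    -- the identities for `Lie`
    (∀ n : ℕ, ∑ μ : n.Partition, Hpart LieSym μ = psum 1 ^ n) ∧
    (pleth hSeries (sumPos (altOmega LieSym)) = 1 + psum 1) ∧
    (∀ n : ℕ, 2 ≤ n →
      ∑ μ : n.Partition, (-1 : ℂ) ^ (n - len μ) • Epart LieSym μ = 0) ∧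
    (∀ n : ℕ, 2 ≤ n →
      ∑ μ : n.Partition, Epart LieSym μ = 2 * esymm 2 * psum 1 ^ (n - 2)) ∧
    -- the identities for `Lie^(2)`: exterior powers
    (∀ n : ℕ, ∑ μ : n.Partition, Epart LieTwoSym μ = psum 1 ^ n) ∧
    (pleth eSeries (sumPos LieTwoSym) = (1 - psum 1)⁻¹) ∧
    (genE LieTwoSym * (1 - tpsum 1) = 1) ∧
    (pleth hpmSeries (sumPos LieTwoSym) = 1 - psum 1) ∧
    (genHpm LieTwoSym = 1 - tpsum 1) ∧
    -- the plethystic inverse of `∑_{n ≥ 1} e_n`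
    (pleth eSeries (sumPos (altOmega LieTwoSym)) = 1 + psum 1) ∧
    (genE (altOmega LieTwoSym) = 1 + tpsum 1) ∧
    IsPlethInverse (sumPos esymm) (sumPos (altOmega LieTwoSym)) ∧
    -- alternating symmetric powers
    (∀ n : ℕ, 2 ≤ n →
      ∑ μ : n.Partition, (-1 : ℂ) ^ (n - len μ) • Hpart LieTwoSym μ = 0) ∧
    -- symmetric powers
    (∀ n : ℕ, ∑ μ : n.Partition, Hpart LieTwoSym μ = ∑ μ ∈ twoPowerParts n, psumPart μ) ∧
    (∃ D : PowerSeries Ser, HasProd (fun k : ℕ => 1 - tpsum (2 ^ k)) D ∧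
      genH LieTwoSym * D = 1) ∧
    -- alternating exterior powers
    (∀ n : ℕ, ∑ μ : n.Partition, (-1 : ℂ) ^ (n - len μ) • omega (Epart LieTwoSym μ) =
      ∑ μ ∈ twoPowerDistinctParts n, psumPart μ) ∧
    (∀ n : ℕ, ∑ μ : n.Partition, Hpart (altOmega LieTwoSym) μ =
      ∑ μ ∈ twoPowerDistinctParts n, psumPart μ) ∧
    HasProd (fun k : ℕ => 1 + tpsum (2 ^ k)) (genH (altOmega LieTwoSym)) ∧
    -- the equivalences, for an arbitrary sequence of symmetric functions that starts with `p₁`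
    (∀ F : ℕ → Ser, (∀ n : ℕ, 1 ≤ n → IsSymmSeries (F n) ∧ (F n).IsHomogeneous n) →
      F 1 = psum 1 →
      List.TFAE [
        ∀ n : ℕ, ∑ μ : n.Partition, Hpart F μ = psum 1 ^ n,
        pleth hSeries (sumPos (altOmega F)) = 1 + psum 1,
        ∀ n : ℕ, 2 ≤ n → ∑ μ : n.Partition, (-1 : ℂ) ^ (n - len μ) • Epart F μ = 0,
        ∀ n : ℕ, 2 ≤ n → ∑ μ : n.Partition, Epart F μ = 2 * esymm 2 * psum 1 ^ (n - 2)] ∧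
      List.TFAE [
        ∀ n : ℕ, ∑ μ : n.Partition, Epart F μ = psum 1 ^ n,
        pleth eSeries (sumPos F) = (1 - psum 1)⁻¹,
        genE F * (1 - tpsum 1) = 1,
        pleth hpmSeries (sumPos F) = 1 - psum 1,
        genHpm F = 1 - tpsum 1,
        pleth eSeries (sumPos (altOmega F)) = 1 + psum 1,
        genE (altOmega F) = 1 + tpsum 1,
        IsPlethInverse (sumPos esymm) (sumPos (altOmega F)),
        ∀ n : ℕ, 2 ≤ n → ∑ μ : n.Partition, (-1 : ℂ) ^ (n - len μ) • Hpart F μ = 0,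
        ∀ n : ℕ, ∑ μ : n.Partition, Hpart F μ = ∑ μ ∈ twoPowerParts n, psumPart μ,
        ∃ D : PowerSeries Ser, HasProd (fun k : ℕ => 1 - tpsum (2 ^ k)) D ∧ genH F * D = 1,
        ∀ n : ℕ, ∑ μ : n.Partition, (-1 : ℂ) ^ (n - len μ) • omega (Epart F μ) =
          ∑ μ ∈ twoPowerDistinctParts n, psumPart μ,
        ∀ n : ℕ, ∑ μ : n.Partition, Hpart (altOmega F) μ =
          ∑ μ ∈ twoPowerDistinctParts n, psumPart μ,
        HasProd (fun k : ℕ => 1 + tpsum (2 ^ k)) (genH (altOmega F))]) := by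
  have hL : IsGraded LieSym := isGraded_ch_cycInd fun _ => 1
  have hT : IsGraded LieTwoSym := isGraded_ch_cycInd fun n => 2 ^ padicValNat 2 n
  have tL := tfae_hSeries hL (ch_cycInd_one 1)
  have tT := tfae_eSeries hT (ch_cycInd_one _)
  have hL0 := (forall_sum_Hpart_eq_pow_iff hL).2 pleth_hSeries_LieSym
  have hT0 := (forall_sum_Epart_eq_pow_iff hT).2 pleth_eSeries_LieTwoSym
  exact ⟨ch_leftRegular, fun n => (hT0 n).trans (ch_leftRegular n).symm, hL0,
    (tL.out 0 1).1 hL0, (tL.out 0 2).1 hL0, (tL.out 0 3).1 hL0, hT0,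
    (tT.out 0 1).1 hT0, (tT.out 0 2).1 hT0, (tT.out 0 3).1 hT0, (tT.out 0 4).1 hT0,
    (tT.out 0 5).1 hT0, (tT.out 0 6).1 hT0, (tT.out 0 7).1 hT0, (tT.out 0 8).1 hT0,
    (tT.out 0 9).1 hT0, (tT.out 0 10).1 hT0, (tT.out 0 11).1 hT0, (tT.out 0 12).1 hT0,
    (tT.out 0 13).1 hT0, fun F hF h1 => ⟨tfae_hSeries hF h1, tfae_eSeries hF h1⟩⟩
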